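/- \textbf{Definitions.} Let $\Sigma_1(\mathbf R^d)$ be the Gelfand--Shilov space of Beurling type of order one, i.e. the set of all $f\in C^\infty(\mathbf R^d)$ such that for every $h>0$ $$\sup_{\alpha,\beta\in\mathbf N^d,\ x\in\mathbf R^d}\frac{|x^\beta\partial^\alpha f(x)|}{h^{|\alpha+\beta|}\alpha!\,\beta!}<\infty ,$$ with the topology defined by these seminorms, and let $\Sigma_1'(\mathbf R^d)\supseteq\Sigma_1(\mathbf R^d)$ be its dual. For $f\in\Sigma_1'(\mathbf R^d)$ and $\phi\in\Sigma_1(\mathbf R^d)$ the short-time Fourier transform is $V_\phi f(x,\xi)=(2\pi)^{-d/2}(f,\phi(\,\cdot\,-x)e^{i\langle\,\cdot\,,\xi\rangle})$, where $(\,\cdot\,,\,\cdot\,)$ extends the scalar product of $L^2(\mathbf R^d)$. A weight on $\mathbf R^{n}$ is a positive function $\omega\in L^\infty_{loc}(\mathbf R^{n})$ with $1/\omega\in L^\infty_{loc}(\mathbf R^{n})$. Let $\mathscr P_E(\mathbf R^{n})$ be the set of moderate weights, i.e. weights $\omega$ for which there are a weight $v$ and a constant $C\ge1$ with $\omega(x+y)\le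 C\,\omega(x)v(y)$ for all $x,y\in\mathbf R^{n}$. For $p,q\in(0,\infty)$, $\omega\in\mathscr P_E(\mathbf R^{2d})$ and a window $\phi\in\Sigma_1(\mathbf R^d)\setminus\{0\}$, the modulation space $M^{p,q}_{(\omega)}(\mathbf R^d)$ consists of all $f\in\Sigma_1'(\mathbf R^d)$ for which $$\|f\|_{M^{p,q}_{(\omega)}}=\Big(\int_{\mathbf R^d}\Big(\int_{\mathbf R^d}|V_\phi f(x,\xi)\,\omega(x,\xi)|^p\,dx\Big)^{q/p}d\xi\Big)^{1/q}$$ is finite, with the topology defined by this quasi-norm. \textbf{Theorem.} Let $p_j,q_j\in(0,\infty)$ and $\omega_j\in\mathscr P_E(\mathbf R^{2d})$, $j=0,1,2$, satisfy $$\frac1{p_0}\le\frac1{p_1}+\frac1{p_2},\qquad \frac1{q_0}\le\frac1{q_1}+\frac1{q_2}-\max\Big(1,\frac1{p_0},\frac1{q_1},\frac1{q_2}\Big),$$ $$\omega_0(x,\xi_1+\xi_2)\le\omega_1(x,\xi_1)\,\omega_2(x,\xi_2),\qquad x,\xi_1,\xi_2\in\mathbf R^d,$$ and let the quasi-norm of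 $M^{p_j,q_j}_{(\omega_j)}(\mathbf R^d)$ be defined by an arbitrary window $\phi_j\in\Sigma_1(\mathbf R^d)\setminus\{0\}$. Then $\Sigma_1(\mathbf R^d)\subseteq M^{p_j,q_j}_{(\omega_j)}(\mathbf R^d)$ for $j=0,1,2$, and the pointwise product $(f_1,f_2)\mapsto f_1f_2$ from $\Sigma_1(\mathbf R^d)\times\Sigma_1(\mathbf R^d)$ to $\Sigma_1(\mathbf R^d)$ extends uniquely to a continuous map from $M^{p_1,q_1}_{(\omega_1)}(\mathbf R^d)\times M^{p_2,q_2}_{(\omega_2)}(\mathbf R^d)$ to $M^{p_0,q_0}_{(\omega_0)}(\mathbf R^d)$. Moreover there is a constant $C$ such that this extension satisfies $$\|f_1f_2\|_{M^{p_0,q_0}_{(\omega_0)}}\le C\,\|f_1\|_{M^{p_1,q_1}_{(\omega_1)}}\|f_2\|_{M^{p_2,q_2}_{(\omega_2)}},\qquad f_j\in M^{p_j,q_j}_{(\omega_j)}(\mathbf R^d),\ j=1,2.$$ -/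

import Mathlib

open MeasureTheory
open scoped ENNReal NNReal

/-- The Euclidean space `ℝ^d`. -/
abbrev Rd (d : ℕ) : Type := EuclideanSpace ℝ (Fin d)

/-! ### The Gelfand-Shilov space `Σ₁` and its dual -/

/-- The Gelfand-Shilov seminorm of order one,
`sup_{k, n, x} ‖x‖ ^ k ‖D ^ n f (x)‖ / (h ^ (k + n) k! n!)`, with values in `[0, ∞]`.
As for Mathlib's Schwartz space, powers of the norm and total derivatives are used instead of
multi-indices. Since `|x ^ β ∂ ^ α f (x)| ≤ ‖x‖ ^ |β| ‖D ^ |α| f (x)‖`, since `‖x‖ ^ k` and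
`‖D ^ n f (x)‖` are at most `C ^ (k + n)` times the largest `|x ^ β|` and `|∂ ^ α f (x)|`, and
since `α! ≤ |α|! ≤ d ^ |α| α!`, this changes `h` only by a factor that depends on `d`; the
families over all `h > 0` are equivalent. -/
noncomputable def gsNorm {d : ℕ} (h : ℝ) (f : Rd d → ℂ) : ℝ≥0∞ :=
  ⨆ (k : ℕ) (n : ℕ) (x : Rd d),
    ENNReal.ofReal (‖x‖ ^ k * ‖iteratedFDeriv ℝ n f x‖ / (h ^ (k + n) * (k.factorial * n.factorial)))

theorem gsNorm_le_iff {d : ℕ} {h : ℝ} (hh : 0 < h) (f : Rd d → ℂ) {A : ℝ} (hA : 0 ≤ A) :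
    gsNorm h f ≤ ENNReal.ofReal A ↔
      ∀ k n x, ‖x‖ ^ k * ‖iteratedFDeriv ℝ n f x‖ ≤ A * (h ^ (k + n) * (k.factorial * n.factorial)) := by
  unfold gsNorm
  simp only [iSup_le_iff]
  refine forall_congr' fun k => forall_congr' fun n => forall_congr' fun x => ?_
  rw [ENNReal.ofReal_le_ofReal_iff hA, div_le_iff₀ (by positivity)]

theorem gsNorm_lt_top_iff {d : ℕ} {h : ℝ} (hh : 0 < h) (f : Rd d → ℂ) :
    gsNorm h f < ∞ ↔ ∃ A : ℝ, 0 ≤ A ∧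
      ∀ k n x, ‖x‖ ^ k * ‖iteratedFDeriv ℝ n f x‖ ≤ A * (h ^ (k + n) * (k.factorial * n.factorial)) := by
  constructor
  · intro hf
    refine ⟨(gsNorm h f).toReal, ENNReal.toReal_nonneg, ?_⟩
    rw [← gsNorm_le_iff hh f ENNReal.toReal_nonneg, ENNReal.ofReal_toReal hf.ne]
  · rintro ⟨A, hA, hf⟩
    exact ((gsNorm_le_iff hh f hA).2 hf).trans_lt ENNReal.ofReal_lt_top

theorem gsNorm_anti {d : ℕ} {h h' : ℝ} (hh : 0 < h) (hle : h ≤ h') (f : Rd d → ℂ) :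
    gsNorm h' f ≤ gsNorm h f := by
  unfold gsNorm
  gcongr

/-- The Gelfand-Shilov space `Σ₁(ℝ^d)` of Beurling type: the smooth functions for which all
seminorms `gsNorm h`, `h > 0`, are finite. -/
def GSSpace (d : ℕ) : Submodule ℂ (Rd d → ℂ) where
  carrier := {f | ContDiff ℝ (⊤ : ℕ∞) f ∧ ∀ h : ℝ, 0 < h → gsNorm h f < ∞}
  zero_mem' := by
    refine ⟨contDiff_const, fun h hh => (gsNorm_lt_top_iff hh _).2 ⟨0, le_rfl, ?_⟩⟩
    intro k n x
    have : (0 : Rd d → ℂ) = fun _ => 0 := rfl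
    simp [this]
  add_mem' := by
    rintro f g ⟨hf, hf'⟩ ⟨hg, hg'⟩
    refine ⟨hf.add hg, fun h hh => (gsNorm_lt_top_iff hh _).2 ?_⟩
    obtain ⟨A, hA, hfA⟩ := (gsNorm_lt_top_iff hh _).1 (hf' h hh)
    obtain ⟨B, hB, hgB⟩ := (gsNorm_lt_top_iff hh _).1 (hg' h hh)
    refine ⟨A + B, by positivity, fun k n x => ?_⟩
    rw [iteratedFDeriv_add_apply (hf.of_le (mod_cast le_top)).contDiffAt
      (hg.of_le (mod_cast le_top)).contDiffAt]
    calc _ ≤ ‖x‖ ^ k * (‖iteratedFDeriv ℝ n f x‖ + ‖iteratedFDeriv ℝ n g x‖) := by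
          gcongr; exact norm_add_le _ _
      _ ≤ _ := by
          have := hfA k n x
          have := hgB k n x
          linarith
  smul_mem' := by
    rintro c f ⟨hf, hf'⟩
    refine ⟨hf.const_smul c, fun h hh => (gsNorm_lt_top_iff hh _).2 ?_⟩
    obtain ⟨A, hA, hfA⟩ := (gsNorm_lt_top_iff hh _).1 (hf' h hh)
    refine ⟨‖c‖ * A, by positivity, fun k n x => ?_⟩
    rw [iteratedFDeriv_const_smul_apply (hf.of_le (mod_cast le_top)).contDiffAt, norm_smul]
    have := mul_le_mul_of_nonneg_left (hfA k n x) (norm_nonneg c)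
    linarith

/-- Pointwise products of elements of `Σ₁` belong to `Σ₁`. -/
theorem GSSpace.mul_mem {d : ℕ} {f g : Rd d → ℂ} (hf : f ∈ GSSpace d) (hg : g ∈ GSSpace d) :
    (fun x => f x * g x) ∈ GSSpace d := by
  refine ⟨hf.1.mul hg.1, fun h hh => (gsNorm_lt_top_iff hh _).2 ?_⟩
  obtain ⟨A, hA, hfA⟩ := (gsNorm_lt_top_iff (half_pos hh) _).1 (hf.2 _ (half_pos hh))
  obtain ⟨B, hB, hgB⟩ := (gsNorm_lt_top_iff (half_pos hh) _).1 (hg.2 _ (half_pos hh))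
  refine ⟨A * B, by positivity, fun k n x => ?_⟩
  have key := norm_iteratedFDeriv_mul_le hf.1 hg.1 x (n := n) (mod_cast le_top)
  have hn : ((n + 1 : ℕ) : ℝ) ≤ 2 ^ n := by
    exact_mod_cast Nat.lt_two_pow_self
  calc _ ≤ ‖x‖ ^ k * ∑ i ∈ Finset.range (n + 1), (n.choose i : ℝ) *
          ‖iteratedFDeriv ℝ i f x‖ * ‖iteratedFDeriv ℝ (n - i) g x‖ := by gcongr
    _ = ∑ i ∈ Finset.range (n + 1), (n.choose i : ℝ) *
          (‖x‖ ^ k * ‖iteratedFDeriv ℝ i f x‖) * ‖iteratedFDeriv ℝ (n - i) g x‖ := by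
        rw [Finset.mul_sum]; exact Finset.sum_congr rfl fun i _ => by ring
    _ ≤ ∑ i ∈ Finset.range (n + 1), A * B * ((h / 2) ^ (k + n) * (k.factorial * n.factorial)) := by
        refine Finset.sum_le_sum fun i hi => ?_
        have hi' : i ≤ n := Nat.lt_succ_iff.1 (Finset.mem_range.1 hi)
        have h1 := hfA k i x
        have h2 := hgB 0 (n - i) x
        simp only [pow_zero, one_mul, zero_add, Nat.factorial_zero, Nat.cast_one] at h2
        have hc : (n.choose i : ℝ) * (i.factorial * (n - i).factorial) = n.factorial := by
          rw [← mul_assoc]; exact_mod_cast Nat.choose_mul_factorial_mul_factorial hi'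
        calc _ ≤ (n.choose i : ℝ) * (A * ((h / 2) ^ (k + i) * (k.factorial * i.factorial))) *
              (B * ((h / 2) ^ (n - i) * (n - i).factorial)) := by gcongr
          _ = A * B * ((h / 2) ^ (k + i) * (h / 2) ^ (n - i)) *
                (k.factorial * ((n.choose i : ℝ) * (i.factorial * (n - i).factorial))) := by ring
          _ = _ := by
              rw [hc, ← pow_add, show k + i + (n - i) = k + n by omega]; ring
    _ = A * B * (((n + 1 : ℕ) : ℝ) * (h / 2) ^ (k + n) * (k.factorial * n.factorial)) := by
        rw [Finset.sum_const, Finset.card_range, nsmul_eq_mul]; ring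
    _ ≤ A * B * (2 ^ (k + n) * (h / 2) ^ (k + n) * (k.factorial * n.factorial)) := by
        gcongr
        exact hn.trans (pow_le_pow_right₀ one_le_two (by omega))
    _ = _ := by rw [← mul_pow, mul_div_cancel₀ h two_ne_zero]

/-- The pointwise product on `Σ₁`. -/
def GSSpace.mul {d : ℕ} (f g : GSSpace d) : GSSpace d :=
  ⟨fun x => (f : Rd d → ℂ) x * (g : Rd d → ℂ) x, GSSpace.mul_mem f.2 g.2⟩

/-- The space `Σ₁'(ℝ^d)` of Gelfand-Shilov (ultra-)distributions: the linear forms on `Σ₁` that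
are bounded by a multiple of one of the seminorms `gsNorm h`, that is, the continuous linear
forms for the topology of `Σ₁` defined by these seminorms. -/
def GSDual (d : ℕ) : Submodule ℂ (GSSpace d →ₗ[ℂ] ℂ) where
  carrier := {u | ∃ h : ℝ, 0 < h ∧ ∃ C : ℝ≥0, ∀ f : GSSpace d, ‖u f‖ₑ ≤ C * gsNorm h (f : Rd d → ℂ)}
  zero_mem' := ⟨1, one_pos, 0, fun f => by simp⟩
  add_mem' := by
    rintro u v ⟨h, hh, C, hu⟩ ⟨h', hh', C', hv⟩
    refine ⟨min h h', lt_min hh hh', C + C', fun f => ?_⟩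
    rw [LinearMap.add_apply, ENNReal.coe_add, add_mul]
    refine (enorm_add_le _ _).trans (add_le_add ((hu f).trans ?_) ((hv f).trans ?_))
    · gcongr
      exact gsNorm_anti (lt_min hh hh') (min_le_left _ _) _
    · gcongr
      exact gsNorm_anti (lt_min hh hh') (min_le_right _ _) _
  smul_mem' := by
    rintro c u ⟨h, hh, C, hu⟩
    refine ⟨h, hh, ‖c‖₊ * C, fun f => ?_⟩
    rw [LinearMap.smul_apply, enorm_smul, ENNReal.coe_mul, mul_assoc]
    gcongr
    · exact le_rfl
    · exact hu f

/-- Elements of `Σ₁` are Schwartz functions. -/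
def GSSpace.toSchwartz {d : ℕ} (f : GSSpace d) : SchwartzMap (Rd d) ℂ where
  toFun := f
  smooth' := f.2.1
  decay' := fun k n => by
    obtain ⟨A, -, hA⟩ := (gsNorm_lt_top_iff one_pos _).1 (f.2.2 1 one_pos)
    exact ⟨_, hA k n⟩

/-- The embedding of `Σ₁` into `Σ₁'`: the function `f` acts by `g ↦ ∫ f(x) g(x) dx`. -/
noncomputable def GSSpace.toDual {d : ℕ} (f : GSSpace d) : GSDual d :=
  have hf : Integrable (f : Rd d → ℂ) := (GSSpace.toSchwartz f).integrable
  have hint : ∀ g : GSSpace d,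
      Integrable (fun x => (f : Rd d → ℂ) x * (g : Rd d → ℂ) x) := fun g =>
    (GSSpace.toSchwartz (GSSpace.mul f g)).integrable
  ⟨{ toFun := fun g => ∫ x, (f : Rd d → ℂ) x * (g : Rd d → ℂ) x
     map_add' := fun g g' => by
       rw [← integral_add (hint g) (hint g')]
       exact integral_congr_ae (.of_forall fun x => mul_add _ _ _)
     map_smul' := fun c g => by
       rw [RingHom.id_apply, ← integral_smul]
       exact integral_congr_ae (.of_forall fun x => mul_left_comm _ _ _) },
   ⟨1, one_pos, (∫ x, ‖(f : Rd d → ℂ) x‖).toNNReal, fun g => by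
     have hg := g.2.2 1 one_pos
     have hsup : ∀ x, ‖(g : Rd d → ℂ) x‖ ≤ (gsNorm 1 (g : Rd d → ℂ)).toReal := fun x => by
       have := (gsNorm_le_iff one_pos (g : Rd d → ℂ) (A := (gsNorm 1 (g : Rd d → ℂ)).toReal)
         ENNReal.toReal_nonneg).1 (by rw [ENNReal.ofReal_toReal hg.ne]) 0 0 x
       simpa using this
     have hle : ‖∫ x, (f : Rd d → ℂ) x * (g : Rd d → ℂ) x‖ ≤
         (∫ x, ‖(f : Rd d → ℂ) x‖) * (gsNorm 1 (g : Rd d → ℂ)).toReal := by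
       rw [← integral_mul_const]
       refine norm_integral_le_of_norm_le (hf.norm.mul_const _) (.of_forall fun x => ?_)
       rw [norm_mul]
       gcongr
       exact hsup x
     change ‖∫ x, (f : Rd d → ℂ) x * (g : Rd d → ℂ) x‖ₑ ≤ _
     rw [← ofReal_norm]
     refine (ENNReal.ofReal_le_ofReal hle).trans ?_
     rw [ENNReal.ofReal_mul (by positivity), ENNReal.ofReal_toReal hg.ne]
     exact le_rfl⟩⟩

/-! ### The short-time Fourier transform -/

theorem iteratedDeriv_exp_neg_I (n : ℕ) (t : ℝ) :
    iteratedDeriv n (fun t : ℝ => Complex.exp (-(t * Complex.I))) t =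
      (-Complex.I) ^ n * Complex.exp (-(t * Complex.I)) := by
  induction n generalizing t with
  | zero => simp
  | succ n ih =>
    rw [iteratedDeriv_succ, funext ih]
    have h1 : HasDerivAt (fun t : ℝ => Complex.exp (-(t * Complex.I)))
        (Complex.exp (-(t * Complex.I)) * (-(1 * Complex.I))) t :=
      (((Complex.ofRealCLM.hasDerivAt (x := t)).mul_const Complex.I).neg).cexp
    rw [(h1.const_mul _).deriv]
    ring

theorem norm_iteratedFDeriv_character_le {d : ℕ} (ξ : Rd d) (n : ℕ) (y : Rd d) :
    ‖iteratedFDeriv ℝ n (fun y : Rd d => Complex.exp (-((inner ℝ ξ y : ℝ) * Complex.I))) y‖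
      ≤ ‖ξ‖ ^ n := by
  have hg : ContDiff ℝ (⊤ : ℕ∞) (fun t : ℝ => Complex.exp (-(t * Complex.I))) := by
    have := Complex.ofRealCLM.contDiff (n := (⊤ : ℕ∞))
    exact ((this.mul contDiff_const).neg).cexp
  have := ContinuousLinearMap.iteratedFDeriv_comp_right (innerSL ℝ ξ) hg y (i := n)
    (mod_cast le_top)
  change ‖iteratedFDeriv ℝ n ((fun t : ℝ => Complex.exp (-(t * Complex.I))) ∘ innerSL ℝ ξ) y‖ ≤ _
  rw [this]
  refine (ContinuousMultilinearMap.norm_compContinuousLinearMap_le _ _).trans ?_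
  rw [norm_iteratedFDeriv_eq_norm_iteratedDeriv, iteratedDeriv_exp_neg_I, norm_mul, norm_pow,
    norm_neg, Complex.norm_I, one_pow, one_mul, ← neg_mul, ← Complex.ofReal_neg,
    Complex.norm_exp_ofReal_mul_I, one_mul]
  simp

/-- Time-frequency shifts of conjugated elements of `Σ₁` belong to `Σ₁`. -/
theorem GSSpace.atom_mem {d : ℕ} {φ : Rd d → ℂ} (hφ : φ ∈ GSSpace d) (x ξ : Rd d) :
    (fun y : Rd d => starRingEnd ℂ (φ (y - x)) *
      Complex.exp (-((inner ℝ ξ y : ℝ) * Complex.I))) ∈ GSSpace d := by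
  have hE : ContDiff ℝ (⊤ : ℕ∞) (fun y : Rd d => Complex.exp (-((inner ℝ ξ y : ℝ) * Complex.I))) := by
    have h1 : ContDiff ℝ (⊤ : ℕ∞) (fun y : Rd d => ((inner ℝ ξ y : ℝ) : ℂ)) :=
      Complex.ofRealCLM.contDiff.comp (innerSL ℝ ξ).contDiff
    exact ((h1.mul contDiff_const).neg).cexp
  have hT : ContDiff ℝ (⊤ : ℕ∞) (fun y : Rd d => φ (y - x)) :=
    hφ.1.comp (contDiff_id.sub contDiff_const)
  have hC : ContDiff ℝ (⊤ : ℕ∞) (fun y : Rd d => starRingEnd ℂ (φ (y - x))) :=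
    Complex.conjCLE.contDiff.comp hT
  have hCn : ∀ n y, ‖iteratedFDeriv ℝ n (fun y : Rd d => starRingEnd ℂ (φ (y - x))) y‖ =
      ‖iteratedFDeriv ℝ n φ (y - x)‖ := fun n y => by
    have := Complex.conjLIE.norm_iteratedFDeriv_comp_left (𝕜 := ℝ)
      (fun y : Rd d => φ (y - x)) y n
    rw [iteratedFDeriv_comp_sub] at this
    exact this
  refine ⟨hC.mul hE, fun h hh => (gsNorm_lt_top_iff hh _).2 ?_⟩
  obtain ⟨A, hA, hfA⟩ := (gsNorm_lt_top_iff (half_pos hh) _).1 (hφ.2 _ (half_pos hh))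
  set a := Real.exp (‖x‖ / (h / 2)) with ha
  set b := Real.exp (‖ξ‖ / (h / 2)) with hb
  have ea : ∀ k : ℕ, ‖x‖ ^ k ≤ a * ((h / 2) ^ k * k.factorial) := fun k => by
    have := Real.pow_div_factorial_le_exp (x := ‖x‖ / (h / 2)) (by positivity) k
    rwa [div_pow, div_div, div_le_iff₀ (by positivity)] at this
  have eb : ∀ k : ℕ, ‖ξ‖ ^ k ≤ b * ((h / 2) ^ k * k.factorial) := fun k => by
    have := Real.pow_div_factorial_le_exp (x := ‖ξ‖ / (h / 2)) (by positivity) k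
    rwa [div_pow, div_div, div_le_iff₀ (by positivity)] at this
  -- the translated window
  have hbound : ∀ k n y, ‖y‖ ^ k * ‖iteratedFDeriv ℝ n φ (y - x)‖ ≤
      (A + a * A) * (h ^ k * (h / 2) ^ n * (k.factorial * n.factorial)) := fun k n y => by
    have h1 := hfA k n (y - x)
    have h2 := hfA 0 n (y - x)
    simp only [pow_zero, one_mul, zero_add, Nat.factorial_zero, Nat.cast_one] at h2
    have h3 : ‖y‖ ^ k ≤ 2 ^ k * (‖y - x‖ ^ k + ‖x‖ ^ k) := by
      have hy : ‖y‖ ≤ ‖y - x‖ + ‖x‖ := by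
        simpa using norm_add_le (y - x) x
      calc ‖y‖ ^ k ≤ (‖y - x‖ + ‖x‖) ^ k := by gcongr
        _ ≤ 2 ^ (k - 1) * (‖y - x‖ ^ k + ‖x‖ ^ k) :=
            add_pow_le (norm_nonneg _) (norm_nonneg _) k
        _ ≤ _ := by
            gcongr
            · exact one_le_two
            · omega
    calc _ ≤ 2 ^ k * (‖y - x‖ ^ k + ‖x‖ ^ k) * ‖iteratedFDeriv ℝ n φ (y - x)‖ := by gcongr
      _ = 2 ^ k * (‖y - x‖ ^ k * ‖iteratedFDeriv ℝ n φ (y - x)‖ +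
            ‖x‖ ^ k * ‖iteratedFDeriv ℝ n φ (y - x)‖) := by ring
      _ ≤ 2 ^ k * (A * ((h / 2) ^ (k + n) * (k.factorial * n.factorial)) +
            (a * ((h / 2) ^ k * k.factorial)) * (A * ((h / 2) ^ n * n.factorial))) := by
          gcongr
          exact ea k
      _ = (A + a * A) * ((2 ^ k * (h / 2) ^ k) * (h / 2) ^ n * (k.factorial * n.factorial)) := by
          rw [pow_add]; ring
      _ = _ := by rw [← mul_pow, mul_div_cancel₀ h two_ne_zero]
  refine ⟨(A + a * A) * b, by positivity, fun k n y => ?_⟩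
  have key := norm_iteratedFDeriv_mul_le hC hE y (n := n) (mod_cast le_top)
  have hn : ((n + 1 : ℕ) : ℝ) ≤ 2 ^ n := by
    exact_mod_cast Nat.lt_two_pow_self
  calc _ ≤ ‖y‖ ^ k * ∑ i ∈ Finset.range (n + 1), (n.choose i : ℝ) *
          ‖iteratedFDeriv ℝ i (fun y : Rd d => starRingEnd ℂ (φ (y - x))) y‖ *
          ‖iteratedFDeriv ℝ (n - i)
            (fun y : Rd d => Complex.exp (-((inner ℝ ξ y : ℝ) * Complex.I))) y‖ := by gcongr
    _ ≤ ‖y‖ ^ k * ∑ i ∈ Finset.range (n + 1), (n.choose i : ℝ) *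
          ‖iteratedFDeriv ℝ i φ (y - x)‖ * (b * ((h / 2) ^ (n - i) * (n - i).factorial)) := by
        gcongr with i hi
        · exact (hCn i y).le
        · exact (norm_iteratedFDeriv_character_le ξ _ y).trans (eb _)
    _ = ∑ i ∈ Finset.range (n + 1), (n.choose i : ℝ) *
          (‖y‖ ^ k * ‖iteratedFDeriv ℝ i φ (y - x)‖) *
            (b * ((h / 2) ^ (n - i) * (n - i).factorial)) := by
        rw [Finset.mul_sum]; exact Finset.sum_congr rfl fun i _ => by ring
    _ ≤ ∑ i ∈ Finset.range (n + 1), (A + a * A) * b * (h ^ k * (h / 2) ^ n * (k.factorial * n.factorial)) := by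
        refine Finset.sum_le_sum fun i hi => ?_
        have hi' : i ≤ n := Nat.lt_succ_iff.1 (Finset.mem_range.1 hi)
        have hc : (n.choose i : ℝ) * (i.factorial * (n - i).factorial) = n.factorial := by
          rw [← mul_assoc]; exact_mod_cast Nat.choose_mul_factorial_mul_factorial hi'
        calc _ ≤ (n.choose i : ℝ) * ((A + a * A) * (h ^ k * (h / 2) ^ i * (k.factorial * i.factorial))) *
              (b * ((h / 2) ^ (n - i) * (n - i).factorial)) := by
              exact mul_le_mul_of_nonneg_right
                (mul_le_mul_of_nonneg_left (hbound k i y) (by positivity)) (by positivity)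
          _ = (A + a * A) * b * (h ^ k * ((h / 2) ^ i * (h / 2) ^ (n - i)) *
                (k.factorial * ((n.choose i : ℝ) * (i.factorial * (n - i).factorial)))) := by ring
          _ = _ := by rw [hc, ← pow_add, Nat.add_sub_cancel' hi']
    _ = (A + a * A) * b * (h ^ k * (((n + 1 : ℕ) : ℝ) * (h / 2) ^ n) * (k.factorial * n.factorial)) := by
        rw [Finset.sum_const, Finset.card_range, nsmul_eq_mul]; ring
    _ ≤ (A + a * A) * b * (h ^ k * (2 ^ n * (h / 2) ^ n) * (k.factorial * n.factorial)) := by gcongr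
    _ = _ := by rw [← mul_pow, mul_div_cancel₀ h two_ne_zero, pow_add]

/-- The function `y ↦ conj (φ (y - x)) * exp (-i ⟨y, ξ⟩)`, as an element of `Σ₁`. -/
noncomputable def GSSpace.atom {d : ℕ} (φ : GSSpace d) (x ξ : Rd d) : GSSpace d :=
  ⟨fun y => starRingEnd ℂ ((φ : Rd d → ℂ) (y - x)) *
    Complex.exp (-((inner ℝ ξ y : ℝ) * Complex.I)), GSSpace.atom_mem φ.2 x ξ⟩

/-- The short-time Fourier transform
`V_φ f (x, ξ) = (2π)^(-d/2) (f, φ(· - x) exp(i⟨·, ξ⟩))_{L²}` of `f ∈ Σ₁'` with window `φ ∈ Σ₁`. -/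
noncomputable def stft {d : ℕ} (φ : GSSpace d) (f : GSDual d) (z : Rd d × Rd d) : ℂ :=
  (((2 * Real.pi) ^ (-(d : ℝ) / 2) : ℝ) : ℂ) * (f : GSSpace d →ₗ[ℂ] ℂ) (GSSpace.atom φ z.1 z.2)

/-! ### Weights -/

/-- A weight on `V`: a positive function `ω` such that `ω` and `1/ω` belong to `L^∞_loc`. -/
def IsWeight {V : Type*} [TopologicalSpace V] [MeasureSpace V] (ω : V → ℝ) : Prop :=
  (∀ x, 0 < ω x) ∧ ∀ K : Set V, IsCompact K →
    MemLp ω ∞ (volume.restrict K) ∧ MemLp (fun x => (ω x)⁻¹) ∞ (volume.restrict K)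

/-- The class `𝒫_E` of moderate weights. -/
def IsModerateWeight {V : Type*} [AddCommGroup V] [TopologicalSpace V] [MeasureSpace V]
    (ω : V → ℝ) : Prop :=
  IsWeight ω ∧ ∃ v : V → ℝ, IsWeight v ∧ ∃ C : ℝ, 1 ≤ C ∧ ∀ x y, ω (x + y) ≤ C * ω x * v y

/-! ### Modulation spaces -/

/-- The weighted mixed quasi-norm of `L^{p,q}_{(ω)}(ℝ^{2d})`: first the `L^p` quasi-norm in `x`,
then the `L^q` quasi-norm in `ξ`. -/
noncomputable def mixedNorm {d : ℕ} (p q : ℝ≥0∞) (ω : Rd d × Rd d → ℝ)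
    (F : Rd d × Rd d → ℂ) : ℝ≥0∞ :=
  eLpNorm (fun ξ : Rd d => eLpNorm (fun x : Rd d => F (x, ξ) * (ω (x, ξ) : ℂ)) p volume) q volume

/-- The modulation space quasi-norm of `f ∈ Σ₁'`, with window `φ`. -/
noncomputable def modNorm {d : ℕ} (p q : ℝ≥0∞) (ω : Rd d × Rd d → ℝ) (φ : GSSpace d)
    (f : GSDual d) : ℝ≥0∞ :=
  mixedNorm p q ω (stft φ f)

/-- The modulation space `M^{p,q}_{(ω)}(ℝ^d)`, with quasi-norm defined by the window `φ`. -/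
def ModulationSpace {d : ℕ} (p q : ℝ≥0∞) (ω : Rd d × Rd d → ℝ) (φ : GSSpace d) : Type :=
  {f : GSDual d // modNorm p q ω φ f < ∞}

/-- The topology of the modulation space, defined by its quasi-norm: a set is open if it contains
a quasi-norm ball around each of its points. -/
instance {d : ℕ} (p q : ℝ≥0∞) (ω : Rd d × Rd d → ℝ) (φ : GSSpace d) :
    TopologicalSpace (ModulationSpace p q ω φ) where
  IsOpen U := ∀ f ∈ U, ∃ ε : ℝ≥0∞, 0 < ε ∧
    ∀ g : ModulationSpace p q ω φ, modNorm p q ω φ (g.1 - f.1) < ε → g ∈ U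
  isOpen_univ := fun _ _ => ⟨1, one_pos, fun _ _ => trivial⟩
  isOpen_inter := by
    rintro U V hU hV f ⟨hfU, hfV⟩
    obtain ⟨ε, hε, h⟩ := hU f hfU
    obtain ⟨δ, hδ, h'⟩ := hV f hfV
    exact ⟨min ε δ, lt_min hε hδ, fun g hg =>
      ⟨h g (hg.trans_le (min_le_left _ _)), h' g (hg.trans_le (min_le_right _ _))⟩⟩
  isOpen_sUnion := by
    rintro S hS f ⟨U, hU, hf⟩
    obtain ⟨ε, hε, h⟩ := hS U hU f hf
    exact ⟨ε, hε, fun g hg => ⟨U, hU, h g hg⟩⟩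

/-- `T : M^{p₁,q₁}_{(ω₁)} × M^{p₂,q₂}_{(ω₂)} → M^{p₀,q₀}_{(ω₀)}` is continuous and extends the
pointwise product `(f₁, f₂) ↦ f₁ f₂` from `Σ₁ × Σ₁` to `Σ₁`. The window of the quasi-norm of
the `j`-th space is `φ j`. -/
def IsContinuousMulExtension {d : ℕ} (p q : Fin 3 → ℝ≥0∞) (ω : Fin 3 → Rd d × Rd d → ℝ)
    (φ : Fin 3 → GSSpace d)
    (T : ModulationSpace (p 1) (q 1) (ω 1) (φ 1) × ModulationSpace (p 2) (q 2) (ω 2) (φ 2) →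
      ModulationSpace (p 0) (q 0) (ω 0) (φ 0)) : Prop :=
  Continuous T ∧ ∀ (f₁ f₂ : GSSpace d) (g₁ : ModulationSpace (p 1) (q 1) (ω 1) (φ 1))
    (g₂ : ModulationSpace (p 2) (q 2) (ω 2) (φ 2)),
    g₁.1 = GSSpace.toDual f₁ → g₂.1 = GSSpace.toDual f₂ →
      (T (g₁, g₂)).1 = GSSpace.toDual (GSSpace.mul f₁ f₂)

/-! The short-time Fourier transform turns products into convolutions in frequency: with the window
φ², the transform of f₁f₂ at (x, ξ) is, up to a power of 2π, the convolution in ξ, for fixed x, of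
the transforms of f₁ and f₂ with window φ (`prodCoeff_toDual`). The reproducing formula
(`reproducing`) recovers an ultradistribution from its transform. Hence the product of two elements
of Σ₁' can be defined by inserting this convolution into the reproducing integral for φ²
(`mulForm`), whenever the convolution converges absolutely and grows at most exponentially
(`HasProduct`).

The estimate must cover exponents below 1, where neither Minkowski nor Young is available and L^s
norms of general functions are not comparable. The remedy is to replace the modulus of the transform
by local L^r averages with exponential weight (`expAvg`). These change under translation by at most
an exponential factor (`IsSlow`). They dominate the transform for every 0 < r ≤ 1, even after a
change of window (`rpow_le_of_le_lintegral`, `exists_ampl_le_expAvg`), and for r small their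
weighted mixed quasi-norm is bounded by that of the transform (`exists_mlpn_expAvg_mul_le`).
Moderate weights are themselves equivalent to slowly varying measurable functions
(`IsModerateWeight.exists_equiv`).

Slowly varying functions behave like sequences: smaller exponents give stronger quasi-norms
(`IsSlow.exists_lpn_le_lpn`). In `exists_mlpn_partialConv_le` the convolution integral is therefore
replaced by an L^r quasi-norm in the integration variable, where 1/r is the maximum in the
hypothesis on the q's. That maximum contains 1 so that r ≤ 1, it contains 1/p₀ so that Minkowski
holds in L^{p₀/r}, and it contains 1/q₁ and 1/q₂ so that Young applies with q₁/r and q₂/r. Hölder in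
x and the embedding for slowly varying functions account for the inequalities between the exponents.
A finite quasi-norm of a slowly varying function also bounds it pointwise, which yields `HasProduct`
(`exists_hasProduct_bound`).

Continuity follows from this bound and bilinearity. Uniqueness follows because the target is
Hausdorff and Σ₁ is dense: restricting the reproducing integral to large balls gives elements of Σ₁
(`exists_approx`), and since all exponents are finite, dominated convergence applies
(`exists_mlpn_ampl_sub_lt`). The functional analysis behind all of this is that time-frequency
shifts are continuous in every seminorm of Σ₁, and that elements of Σ₁' may be applied under the
integral sign (`exists_integral`). -/

open Filter Topology

/-! ### `L^s` quasi-norms of functions with values in `[0, ∞]` -/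

/-- The `L^s` quasi-norm of a function with values in `[0, ∞]`. -/
noncomputable def lpn {α : Type*} [MeasureSpace α] (s : ℝ) (f : α → ℝ≥0∞) : ℝ≥0∞ :=
  (∫⁻ x, f x ^ s) ^ (1 / s)

section lpn

variable {α β : Type*} [MeasureSpace α] [MeasureSpace β]

theorem lpn_mono {s : ℝ} (hs : 0 < s) {f g : α → ℝ≥0∞} (h : ∀ x, f x ≤ g x) :
    lpn s f ≤ lpn s g := by
  unfold lpn
  gcongr with x
  exact h x

theorem lpn_rpow_self {s : ℝ} (hs : 0 < s) (f : α → ℝ≥0∞) :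
    lpn s f ^ s = ∫⁻ x, f x ^ s := by
  rw [lpn, ← ENNReal.rpow_mul, one_div, inv_mul_cancel₀ hs.ne', ENNReal.rpow_one]

theorem lpn_const_mul {s : ℝ} (hs : 0 < s) {c : ℝ≥0∞} (hc : c ≠ ∞) (f : α → ℝ≥0∞) :
    lpn s (fun x => c * f x) = c * lpn s f := by
  unfold lpn
  simp_rw [ENNReal.mul_rpow_of_nonneg _ _ hs.le]
  rw [lintegral_const_mul' _ _ (ENNReal.rpow_ne_top_of_nonneg hs.le hc),
    ENNReal.mul_rpow_of_nonneg _ _ (by positivity), ← ENNReal.rpow_mul, mul_one_div_cancel hs.ne',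
    ENNReal.rpow_one]

theorem lpn_rpow {s r : ℝ} (hr : 0 < r) (f : α → ℝ≥0∞) :
    lpn s (fun x => f x ^ r) = lpn (r * s) f ^ r := by
  unfold lpn
  simp_rw [← ENNReal.rpow_mul]
  congr 1
  field_simp

theorem measurable_lpn_left [SFinite (volume : Measure α)] {s : ℝ} {f : α → β → ℝ≥0∞}
    (hf : Measurable (Function.uncurry f)) : Measurable (fun y => lpn s (fun x => f x y)) := by
  unfold lpn
  refine Measurable.pow_const ?_ _
  exact Measurable.lintegral_prod_left' (f := fun z : α × β => f z.1 z.2 ^ s) (hf.pow_const _)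

/-- The sum is at most twice the larger term, so one argument serves exponents below and above 1. -/
theorem rpow_add_le_two {s : ℝ} (hs : 0 < s) (a b : ℝ≥0∞) :
    (a + b) ^ s ≤ 2 ^ s * (a ^ s + b ^ s) := by
  wlog h : a ≤ b generalizing a b
  · rw [add_comm a, add_comm (a ^ s)]
    exact this b a (le_of_not_ge h)
  calc (a + b) ^ s ≤ (2 * b) ^ s := by
        gcongr
        rw [two_mul]
        gcongr
    _ = 2 ^ s * b ^ s := ENNReal.mul_rpow_of_nonneg _ _ hs.le
    _ ≤ _ := by
        gcongr
        exact le_add_self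

theorem lpn_add_le {s : ℝ} (hs : 0 < s) : ∃ C : ℝ≥0, ∀ f g : α → ℝ≥0∞, Measurable f →
    lpn s (fun x => f x + g x) ≤ C * (lpn s f + lpn s g) := by
  have hs' : 0 < 1 / s := by positivity
  refine ⟨2 * 2 ^ (1 / s), fun f g hf => ?_⟩
  calc lpn s (fun x => f x + g x) ≤ (∫⁻ x, 2 ^ s * (f x ^ s + g x ^ s)) ^ (1 / s) := by
        unfold lpn
        gcongr with x
        exact rpow_add_le_two hs _ _
    _ = 2 * ((∫⁻ x, f x ^ s) + ∫⁻ x, g x ^ s) ^ (1 / s) := by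
        rw [lintegral_const_mul' _ _ (by simp), lintegral_add_left (hf.pow_const _),
          ENNReal.mul_rpow_of_nonneg _ _ hs'.le, ← ENNReal.rpow_mul, mul_one_div_cancel hs.ne',
          ENNReal.rpow_one]
    _ ≤ 2 * (2 ^ (1 / s) * (lpn s f + lpn s g)) := by
        gcongr
        exact rpow_add_le_two hs' _ _
    _ = _ := by
        rw [ENNReal.coe_mul, ENNReal.coe_rpow_of_ne_zero two_ne_zero]
        simp [mul_assoc]

/-- Minkowski's integral inequality. -/
theorem lpn_lintegral_le [SigmaFinite (volume : Measure α)] [SigmaFinite (volume : Measure β)]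
    {P : ℝ} (hP : 1 ≤ P) {f : α → β → ℝ≥0∞} (hf : Measurable (Function.uncurry f)) :
    lpn P (fun x => ∫⁻ y, f x y) ≤ ∫⁻ y, lpn P (fun x => f x y) := by
  rcases hP.eq_or_lt with rfl | hP
  · simp only [lpn, ENNReal.rpow_one, one_div, inv_one]
    exact (lintegral_lintegral_swap hf.aemeasurable).le
  have hP0 : 0 < P := one_pos.trans hP
  set S : α → ℝ≥0∞ := fun x => ∫⁻ y, f x y with hS
  have hSm : Measurable S := hf.lintegral_prod_right'
  -- Truncation in height and in domain makes the integral `N` below finite, so that a power of it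
  -- can be cancelled.
  set B : ℕ → Set α := spanningSets (volume : Measure α)
  set T : ℕ → α → ℝ≥0∞ := fun n => (B n).indicator (fun x => min (S x) n) with hT
  have hTm : ∀ n, Measurable (T n) := fun n =>
    (hSm.min measurable_const).indicator (measurableSet_spanningSets _ n)
  have hTS : ∀ n x, T n x ≤ S x := fun n x =>
    (Set.indicator_le_self _ _ _).trans (min_le_left _ _)
  have hpq : Real.HolderConjugate P (P / (P - 1)) := Real.HolderConjugate.conjExponent hP
  have key : ∀ n, lpn P (T n) ≤ ∫⁻ y, lpn P (fun x => f x y) := by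
    intro n
    set N := ∫⁻ x, T n x ^ P with hN
    have hNtop : N ≠ ∞ := by
      refine ne_top_of_le_ne_top (b := (n : ℝ≥0∞) ^ P * volume (B n)) ?_ ?_
      · exact ENNReal.mul_ne_top (by simp [hP0.le]) (measure_spanningSets_lt_top _ n).ne
      · rw [← setLIntegral_const, ← lintegral_indicator (measurableSet_spanningSets _ n)]
        refine lintegral_mono fun x => ?_
        by_cases hx : x ∈ B n
        · rw [Set.indicator_of_mem hx, hT]
          simp only [Set.indicator_of_mem hx]
          exact ENNReal.rpow_le_rpow (min_le_right _ _) hP0.le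
        · simp [hT, Set.indicator_of_notMem hx, hP0]
    -- Duality: T^P ≤ S T^(P-1), then Tonelli, then Hölder in x for each y.
    have h1 : N ≤ (∫⁻ y, lpn P (fun x => f x y)) * N ^ (1 / (P / (P - 1))) := by
      calc N ≤ ∫⁻ x, S x * T n x ^ (P - 1) := by
            refine lintegral_mono fun x => ?_
            calc T n x ^ P = T n x ^ (1 + (P - 1)) := by ring_nf
              _ = T n x * T n x ^ (P - 1) := by
                rw [ENNReal.rpow_add_of_nonneg _ _ zero_le_one (by linarith), ENNReal.rpow_one]
              _ ≤ _ := by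
                gcongr
                exact hTS n x
        _ = ∫⁻ x, ∫⁻ y, f x y * T n x ^ (P - 1) := by
            refine lintegral_congr fun x => ?_
            rw [lintegral_mul_const _ (hf.of_uncurry_left)]
        _ = ∫⁻ y, ∫⁻ x, f x y * T n x ^ (P - 1) := by
            refine lintegral_lintegral_swap (Measurable.aemeasurable ?_)
            exact hf.mul (((hTm n).comp measurable_fst).pow_const _)
        _ ≤ ∫⁻ y, lpn P (fun x => f x y) * N ^ (1 / (P / (P - 1))) := by
            refine lintegral_mono fun y => ?_
            have := ENNReal.lintegral_mul_le_Lp_mul_Lq (volume : Measure α) hpq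
              (f := fun x => f x y) (g := fun x => T n x ^ (P - 1))
              (hf.of_uncurry_right).aemeasurable
              ((hTm n).pow_const _).aemeasurable
            refine this.trans (le_of_eq ?_)
            unfold lpn
            congr 2
            refine lintegral_congr fun x => ?_
            rw [← ENNReal.rpow_mul]
            congr 1
            field_simp [(sub_pos.2 hP).ne']
        _ = _ := by
            rw [lintegral_mul_const]
            exact measurable_lpn_left hf
    change N ^ (1 / P) ≤ _
    rcases eq_or_ne N 0 with h0 | h0
    · rw [h0, ENNReal.zero_rpow_of_pos (by positivity)]
      exact zero_le
    have h2 : N = N ^ (1 / P) * N ^ (1 / (P / (P - 1))) := by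
      rw [← ENNReal.rpow_add _ _ h0 hNtop]
      have : 1 / P + 1 / (P / (P - 1)) = 1 := by field_simp; ring
      rw [this, ENNReal.rpow_one]
    have h3 : N ^ (1 / (P / (P - 1))) ≠ 0 := (ENNReal.rpow_pos (pos_iff_ne_zero.2 h0) hNtop).ne'
    have h4 : N ^ (1 / (P / (P - 1))) ≠ ∞ :=
      ENNReal.rpow_ne_top_of_nonneg (by have := sub_pos.2 hP; positivity) hNtop
    rw [h2] at h1
    rw [← ENNReal.mul_le_mul_iff_left h3 h4]
    convert h1 using 2
    rw [← h2]
  have hlim : ∀ x, Tendsto (fun n => T n x ^ P) atTop (𝓝 (S x ^ P)) := by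
    intro x
    refine (ENNReal.continuous_rpow_const.tendsto _).comp ?_
    have h1 : Tendsto (fun n : ℕ => min (S x) (n : ℝ≥0∞)) atTop (𝓝 (min (S x) ∞)) :=
      tendsto_const_nhds.min ENNReal.tendsto_nat_nhds_top
    rw [min_eq_left le_top] at h1
    refine h1.congr' ?_
    filter_upwards [eventually_mem_spanningSets (volume : Measure α) x] with n hn
    simp only [hT, Set.indicator_of_mem (show x ∈ B n from hn)]
  -- Fatou's lemma removes the truncation.
  have h5 : ∫⁻ x, S x ^ P ≤ (∫⁻ y, lpn P (fun x => f x y)) ^ P := by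
    calc ∫⁻ x, S x ^ P = ∫⁻ x, liminf (fun n => T n x ^ P) atTop :=
          lintegral_congr fun x => (hlim x).liminf_eq.symm
      _ ≤ liminf (fun n => ∫⁻ x, T n x ^ P) atTop :=
          lintegral_liminf_le fun n => (hTm n).pow_const _
      _ ≤ liminf (fun _ : ℕ => (∫⁻ y, lpn P (fun x => f x y)) ^ P) atTop := by
          refine liminf_le_liminf (Eventually.of_forall fun n => ?_)
          rw [← lpn_rpow_self hP0]
          gcongr
          exact key n
      _ = _ := liminf_const _
  calc lpn P S ≤ ((∫⁻ y, lpn P (fun x => f x y)) ^ P) ^ (1 / P) := by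
        unfold lpn
        gcongr
        exact h5
    _ = _ := by rw [← ENNReal.rpow_mul, mul_one_div_cancel hP0.ne', ENNReal.rpow_one]

/-- Hölder's inequality. -/
theorem lpn_mul_le {p p₁ p₂ : ℝ} (hp : 0 < p) (h₁ : 0 < p₁) (h₂ : 0 < p₂)
    (h : 1 / p = 1 / p₁ + 1 / p₂) {f g : α → ℝ≥0∞} (hf : Measurable f) (hg : Measurable g) :
    lpn p (fun x => f x * g x) ≤ lpn p₁ f * lpn p₂ g := by
  have hc : Real.HolderConjugate (p₁ / p) (p₂ / p) := by
    have h3 : (p₁ / p)⁻¹ + (p₂ / p)⁻¹ = 1 := by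
      rw [inv_div, inv_div]
      field_simp at h ⊢
      linarith
    exact ⟨by simpa using h3, by positivity, by positivity⟩
  have := ENNReal.lintegral_mul_le_Lp_mul_Lq (volume : Measure α) hc
    (hf.pow_const p).aemeasurable (hg.pow_const p).aemeasurable
  calc lpn p (fun x => f x * g x) = (∫⁻ x, f x ^ p * g x ^ p) ^ (1 / p) := by
        unfold lpn
        simp_rw [ENNReal.mul_rpow_of_nonneg _ _ hp.le]
    _ ≤ _ := by
        refine (ENNReal.rpow_le_rpow this (by positivity)).trans (le_of_eq ?_)
        rw [ENNReal.mul_rpow_of_nonneg _ _ (by positivity), ← ENNReal.rpow_mul, ← ENNReal.rpow_mul]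
        simp only [lpn, ← ENNReal.rpow_mul]
        congr 2 <;> first | (congr 1; funext x; congr 1; field_simp) | field_simp

end lpn

/-! ### Exponential weights -/

/-- The function `y ↦ exp (l ‖y‖)` with values in `[0, ∞]`. -/
noncomputable def wexp {V : Type*} [Norm V] (l : ℝ) (y : V) : ℝ≥0∞ :=
  ENNReal.ofReal (Real.exp (l * ‖y‖))

section wexp

variable {V : Type*} [NormedAddCommGroup V]

theorem wexp_ne_top (l : ℝ) (y : V) : wexp l y ≠ ∞ := ENNReal.ofReal_ne_top

theorem wexp_ne_zero (l : ℝ) (y : V) : wexp l y ≠ 0 := by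
  simp [wexp, Real.exp_pos]

@[simp] theorem wexp_zero_right (l : ℝ) : wexp l (0 : V) = 1 := by simp [wexp]

theorem wexp_mul_wexp (l m : ℝ) (y : V) : wexp l y * wexp m y = wexp (l + m) y := by
  rw [wexp, wexp, wexp, ← ENNReal.ofReal_mul (Real.exp_pos _).le, ← Real.exp_add, add_mul]

theorem wexp_mono {l m : ℝ} (h : l ≤ m) (y : V) : wexp l y ≤ wexp m y := by
  unfold wexp
  gcongr

theorem wexp_rpow (l r : ℝ) (y : V) : wexp l y ^ r = wexp (l * r) y := by
  rw [wexp, wexp, ENNReal.ofReal_rpow_of_pos (Real.exp_pos _), ← Real.exp_mul]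
  ring_nf

@[simp] theorem wexp_neg_right (l : ℝ) (y : V) : wexp l (-y) = wexp l y := by simp [wexp]

theorem wexp_sub_comm (l : ℝ) (x y : V) : wexp l (x - y) = wexp l (y - x) := by
  rw [← neg_sub, wexp_neg_right]

theorem wexp_add_le {l : ℝ} (hl : 0 ≤ l) (x y : V) : wexp l (x + y) ≤ wexp l x * wexp l y := by
  rw [wexp, wexp, wexp, ← ENNReal.ofReal_mul (Real.exp_pos _).le, ← Real.exp_add, ← mul_add]
  gcongr
  exact norm_add_le x y

/-- The triangle inequality read backwards; it makes the decaying exponential slowly varying too. -/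
theorem wexp_neg_le {l : ℝ} (hl : 0 ≤ l) (x y : V) :
    wexp (-l) x ≤ wexp l y * wexp (-l) (x + y) := by
  rw [wexp, wexp, wexp, ← ENNReal.ofReal_mul (Real.exp_pos _).le, ← Real.exp_add]
  gcongr
  have := norm_add_le x y
  nlinarith

theorem wexp_neg_mul_wexp (l : ℝ) (y : V) : wexp (-l) y * wexp l y = 1 := by
  rw [wexp_mul_wexp]
  simp [wexp]

theorem continuous_wexp (l : ℝ) : Continuous (wexp l : V → ℝ≥0∞) := by
  exact ENNReal.continuous_ofReal.comp (by fun_prop)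

theorem measurable_wexp [MeasurableSpace V] [OpensMeasurableSpace V] (l : ℝ) :
    Measurable (wexp l : V → ℝ≥0∞) :=
  (continuous_wexp l).measurable

/-- Comparison with (1 + ‖y‖)^(-m), m = dim + 1, through the term of order m in the series of
exp(l(1 + ‖y‖)). -/
theorem lintegral_wexp_neg_lt_top [NormedSpace ℝ V] [FiniteDimensional ℝ V] [MeasureSpace V]
    [BorelSpace V] [(volume : Measure V).IsAddHaarMeasure] {l : ℝ} (hl : 0 < l) :
    ∫⁻ y : V, wexp (-l) y < ∞ := by
  set m := Module.finrank ℝ V + 1 with hm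
  have h0 := finite_integral_one_add_norm (E := V) (μ := volume) (r := m) (by simp [hm])
  have h1 : ∀ y : V, wexp (-l) y ≤ ENNReal.ofReal (Real.exp l * m.factorial / l ^ m) *
      ENNReal.ofReal ((1 + ‖y‖) ^ (-(m : ℝ))) := fun y => by
    rw [wexp, ← ENNReal.ofReal_mul (by positivity)]
    refine ENNReal.ofReal_le_ofReal ?_
    have hy : 0 < 1 + ‖y‖ := by positivity
    have := Real.pow_div_factorial_le_exp (x := l * (1 + ‖y‖)) (by positivity) m
    rw [Real.rpow_neg hy.le, Real.rpow_natCast, neg_mul, Real.exp_neg]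
    rw [mul_add, mul_one, Real.exp_add, ← mul_one_add, mul_pow] at this
    rw [← div_eq_mul_inv, inv_eq_one_div, div_div, div_le_div_iff₀ (Real.exp_pos _) (by positivity)]
    rw [div_le_iff₀ (by positivity)] at this
    linarith
  refine (lintegral_mono h1).trans_lt ?_
  rw [lintegral_const_mul' _ _ ENNReal.ofReal_ne_top]
  exact ENNReal.mul_lt_top ENNReal.ofReal_lt_top h0

end wexp

/-! ### Slowly varying functions -/

/-- Functions that change at most by the factor `K exp (l ‖y‖)` under translation by `y`. -/
def IsSlow {V : Type*} [NormedAddCommGroup V] (K : ℝ≥0) (l : ℝ) (H : V → ℝ≥0∞) : Prop :=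
  ∀ x y, H (x + y) ≤ K * wexp l y * H x

namespace IsSlow

section

variable {V : Type*} [NormedAddCommGroup V] {K K' : ℝ≥0} {l l' : ℝ} {H H' : V → ℝ≥0∞}

theorem le_sub (hH : IsSlow K l H) (x y : V) : H y ≤ K * wexp l (x - y) * H x := by
  have := hH x (y - x)
  rwa [add_sub_cancel, wexp_sub_comm] at this

theorem rpow (hH : IsSlow K l H) {s : ℝ} (hs : 0 < s) :
    IsSlow (K ^ s) (l * s) (fun x => H x ^ s) := fun x y => by
  calc H (x + y) ^ s ≤ (K * wexp l y * H x) ^ s := by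
        gcongr
        exact hH x y
    _ = _ := by
        rw [ENNReal.mul_rpow_of_nonneg _ _ hs.le, ENNReal.mul_rpow_of_nonneg _ _ hs.le, wexp_rpow,
          ENNReal.coe_rpow_of_nonneg _ hs.le]

theorem mul (hH : IsSlow K l H) (hH' : IsSlow K' l' H') :
    IsSlow (K * K') (l + l') (fun x => H x * H' x) := fun x y => by
  calc H (x + y) * H' (x + y) ≤ (K * wexp l y * H x) * (K' * wexp l' y * H' x) := by
        gcongr
        · exact hH x y
        · exact hH' x y
    _ = (K * K') * (wexp l y * wexp l' y) * (H x * H' x) := by ring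
    _ = _ := by rw [wexp_mul_wexp, ENNReal.coe_mul]

theorem const_sub (hH : IsSlow K l H) (x : V) : IsSlow K l (fun y => H (x - y)) := fun y z => by
  have := hH (x - y) (-z)
  rwa [← sub_eq_add_neg, wexp_neg_right, sub_sub] at this

theorem lintegral_apply {β : Type*} [MeasureSpace β] {H : V → β → ℝ≥0∞}
    (hH : ∀ b, IsSlow K l (fun x => H x b)) : IsSlow K l (fun x => ∫⁻ b, H x b) := fun x y => by
  simp only
  rw [← lintegral_const_mul' _ _ (ENNReal.mul_ne_top ENNReal.coe_ne_top (wexp_ne_top _ _))]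
  exact lintegral_mono fun b => hH b x y

theorem lpn_apply {β : Type*} [MeasureSpace β] {s : ℝ} (hs : 0 < s) {H : V → β → ℝ≥0∞}
    (hH : ∀ b, IsSlow K l (fun x => H x b)) : IsSlow K l (fun x => lpn s (H x)) := fun x y => by
  simp only
  rw [← lpn_const_mul hs (ENNReal.mul_ne_top ENNReal.coe_ne_top (wexp_ne_top _ _))]
  exact lpn_mono hs fun b => hH b x y

end

section

variable {E F : Type*} [NormedAddCommGroup E] [NormedAddCommGroup F] {K : ℝ≥0} {l : ℝ}
  {H : E × F → ℝ≥0∞}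

theorem fst (hH : IsSlow K l H) (ξ : F) : IsSlow K l (fun x => H (x, ξ)) := fun x y => by
  simpa [wexp] using hH (x, ξ) (y, 0)

theorem snd (hH : IsSlow K l H) (x : E) : IsSlow K l (fun ξ => H (x, ξ)) := fun ξ ζ => by
  simpa [wexp] using hH (x, ξ) (0, ζ)

end

section

variable {V : Type*} [NormedAddCommGroup V] [NormedSpace ℝ V] [FiniteDimensional ℝ V]
  [MeasureSpace V] [BorelSpace V] [(volume : Measure V).IsAddHaarMeasure]

/-- On the unit ball around x the function is at least a fixed multiple of its value at x, so its
integral over this ball controls that value. -/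
theorem exists_le_lpn (K : ℝ≥0) {l s : ℝ} (hl : 0 ≤ l) (hs : 0 < s) :
    ∃ C : ℝ≥0, ∀ a : V → ℝ≥0∞, IsSlow K l a → ∀ x, a x ≤ C * lpn s a := by
  set B := Metric.ball (0 : V) 1
  set v := volume B
  have hv0 : v ≠ 0 := (Metric.isOpen_ball.measure_pos volume ⟨0, by simp⟩).ne'
  have hvt : v ≠ ∞ := measure_ball_lt_top.ne
  set M : ℝ≥0∞ := K * ENNReal.ofReal (Real.exp l)
  have hM : M ≠ ∞ := ENNReal.mul_ne_top ENNReal.coe_ne_top ENNReal.ofReal_ne_top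
  have hCt : M * v⁻¹ ^ (1 / s) ≠ ∞ := ENNReal.mul_ne_top hM
    (ENNReal.rpow_ne_top_of_nonneg (by positivity) (ENNReal.inv_ne_top.2 hv0))
  refine ⟨(M * v⁻¹ ^ (1 / s)).toNNReal, fun a ha x => ?_⟩
  rw [ENNReal.coe_toNNReal hCt]
  have h1 : a x ^ s * v ≤ M ^ s * ∫⁻ y, a y ^ s := by
    rw [← setLIntegral_const, ← lintegral_add_left_eq_self (fun y => a y ^ s) x,
      ← lintegral_const_mul' _ _ (ENNReal.rpow_ne_top_of_nonneg hs.le hM)]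
    refine (setLIntegral_mono' Metric.isOpen_ball.measurableSet fun y hy => ?_).trans
      (setLIntegral_le_lintegral _ _)
    rw [← ENNReal.mul_rpow_of_nonneg _ _ hs.le]
    gcongr
    have h2 := ha (x + y) (-y)
    rw [add_neg_cancel_right, wexp_neg_right] at h2
    refine h2.trans ?_
    gcongr
    have : ‖y‖ ≤ 1 := (mem_ball_zero_iff.1 hy).le
    refine mul_le_mul_right ?_ _
    exact ENNReal.ofReal_le_ofReal (Real.exp_le_exp.2 (by nlinarith))
  have h2 : a x ^ s ≤ M ^ s * v⁻¹ * ∫⁻ y, a y ^ s := by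
    rw [mul_right_comm, ← div_eq_mul_inv, ENNReal.le_div_iff_mul_le (.inl hv0) (.inl hvt)]
    exact h1
  calc a x = (a x ^ s) ^ (1 / s) := by
        rw [← ENNReal.rpow_mul, mul_one_div_cancel hs.ne', ENNReal.rpow_one]
    _ ≤ (M ^ s * v⁻¹ * ∫⁻ y, a y ^ s) ^ (1 / s) := by gcongr
    _ = _ := by
        rw [ENNReal.mul_rpow_of_nonneg _ _ (by positivity),
          ENNReal.mul_rpow_of_nonneg _ _ (by positivity), ← ENNReal.rpow_mul,
          mul_one_div_cancel hs.ne', ENNReal.rpow_one, lpn]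

/-- The analogue of ℓ^s ⊂ ℓ^t: bound a^t by (sup a)^(t-s) a^s and the supremum by the L^s
quasi-norm. -/
theorem exists_lpn_le_lpn (K : ℝ≥0) {l s t : ℝ} (hl : 0 ≤ l) (hs : 0 < s) (hst : s ≤ t) :
    ∃ C : ℝ≥0, ∀ a : V → ℝ≥0∞, Measurable a → IsSlow K l a →
      lpn t a ≤ C * lpn s a := by
  obtain ⟨C, hC⟩ := exists_le_lpn (V := V) K hl hs
  have ht : 0 < t := hs.trans_le hst
  refine ⟨C ^ ((t - s) / t), fun a ham ha => ?_⟩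
  set X := lpn s a
  have hts : 0 ≤ t - s := sub_nonneg.2 hst
  calc (∫⁻ x, a x ^ t) ^ (1 / t) ≤ (∫⁻ x, (C * X) ^ (t - s) * a x ^ s) ^ (1 / t) := by
        gcongr with x
        calc a x ^ t = a x ^ ((t - s) + s) := by ring_nf
          _ = a x ^ (t - s) * a x ^ s := ENNReal.rpow_add_of_nonneg _ _ hts hs.le
          _ ≤ _ := by
            gcongr
            exact hC a ha x
    _ = ((C * X) ^ (t - s) * X ^ s) ^ (1 / t) := by
        rw [lintegral_const_mul _ (ham.pow_const _), lpn_rpow_self hs]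
    _ = (C ^ (t - s)) ^ (1 / t) * (X ^ t) ^ (1 / t) := by
        rw [ENNReal.mul_rpow_of_nonneg _ _ hts, mul_assoc, ← ENNReal.rpow_add_of_nonneg _ _ hts hs.le,
          ENNReal.mul_rpow_of_nonneg _ _ (by positivity), sub_add_cancel]
    _ = _ := by
        rw [← ENNReal.rpow_mul, ← ENNReal.rpow_mul, mul_one_div_cancel ht.ne', ENNReal.rpow_one,
          ENNReal.coe_rpow_of_nonneg _ (by positivity), mul_one_div]

end

end IsSlow

/-! ### Convolutions -/

section conv

variable {V : Type*} [NormedAddCommGroup V] [NormedSpace ℝ V] [FiniteDimensional ℝ V]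
  [MeasureSpace V] [BorelSpace V] [(volume : Measure V).IsAddHaarMeasure]

/-- Young's inequality. -/
theorem lpn_conv_le {s₀ s₁ s₂ : ℝ} (h₀ : 0 < s₀) (h₁ : 1 ≤ s₁) (h₂ : 1 ≤ s₂)
    (h : 1 / s₁ + 1 / s₂ = 1 + 1 / s₀) {f g : V → ℝ≥0∞} (hf : Measurable f) (hg : Measurable g) :
    lpn s₀ (fun ξ => ∫⁻ η, f (ξ - η) * g η) ≤ lpn s₁ f * lpn s₂ g := by
  have h₁' : 0 < s₁ := by linarith
  have h₂' : 0 < s₂ := by linarith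
  have e1 : 1 / s₁ ≤ 1 := by rw [div_le_one h₁']; exact h₁
  have e2 : 1 / s₂ ≤ 1 := by rw [div_le_one h₂']; exact h₂
  have p0 : 0 ≤ 1 / s₀ := by positivity
  have p1 : 0 ≤ 1 / s₁ - 1 / s₀ := by linarith
  have p2 : 0 ≤ 1 / s₂ - 1 / s₀ := by linarith
  set X := lpn s₁ f
  set Y := lpn s₂ g
  have hX : ∫⁻ x, f x ^ s₁ = X ^ s₁ := (lpn_rpow_self h₁' f).symm
  have hY : ∫⁻ x, g x ^ s₂ = Y ^ s₂ := (lpn_rpow_self h₂' g).symm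
  have hfm : ∀ ξ, Measurable (fun η => f (ξ - η)) := fun ξ =>
    hf.comp (measurable_const.sub measurable_id)
  have m1 : ∀ ξ, Measurable (fun η => f (ξ - η) ^ s₁) := fun ξ => (hfm ξ).pow_const _
  have m2 : Measurable (fun η => g η ^ s₂) := hg.pow_const _
  have hXt : ∀ ξ, ∫⁻ η, f (ξ - η) ^ s₁ = X ^ s₁ := fun ξ => by
    rw [lintegral_sub_left_eq_self (fun η => f η ^ s₁) ξ, hX]
  -- Hölder with the three factors f^s₁ g^s₂, f^s₁, g^s₂. The hypothesis on the exponents says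
  -- exactly that the powers 1/s₀, 1/s₁ - 1/s₀, 1/s₂ - 1/s₀ sum to 1.
  have hpt : ∀ ξ, ∫⁻ η, f (ξ - η) * g η ≤ (∫⁻ η, f (ξ - η) ^ s₁ * g η ^ s₂) ^ (1 / s₀) *
      ((X ^ s₁) ^ (1 / s₁ - 1 / s₀) * (Y ^ s₂) ^ (1 / s₂ - 1 / s₀)) := by
    intro ξ
    have := ENNReal.lintegral_prod_norm_pow_le (μ := (volume : Measure V)) Finset.univ
      (f := ![fun η => f (ξ - η) ^ s₁ * g η ^ s₂, fun η => f (ξ - η) ^ s₁, fun η => g η ^ s₂])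
      (p := ![1 / s₀, 1 / s₁ - 1 / s₀, 1 / s₂ - 1 / s₀])
      (by
        intro i _
        fin_cases i
        · exact ((m1 ξ).mul m2).aemeasurable
        · exact (m1 ξ).aemeasurable
        · exact m2.aemeasurable)
      (by simp only [Fin.sum_univ_three, Matrix.cons_val]; linarith)
      (by
        intro i _
        fin_cases i
        · exact p0
        · exact p1
        · exact p2)
    simp only [Fin.prod_univ_three, Matrix.cons_val, hXt, hY] at this
    rw [mul_assoc] at this
    refine le_trans (le_of_eq (lintegral_congr fun η => ?_)) this
    rw [ENNReal.mul_rpow_of_nonneg _ _ p0, ← ENNReal.rpow_mul, ← ENNReal.rpow_mul,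
      ← ENNReal.rpow_mul, ← ENNReal.rpow_mul]
    have a1 : 1 = s₁ * (1 / s₀) + s₁ * (1 / s₁ - 1 / s₀) := by field_simp; ring
    have a2 : 1 = s₂ * (1 / s₀) + s₂ * (1 / s₂ - 1 / s₀) := by field_simp; ring
    calc f (ξ - η) * g η = f (ξ - η) ^ (1 : ℝ) * g η ^ (1 : ℝ) := by simp
      _ = (f (ξ - η) ^ (s₁ * (1 / s₀)) * f (ξ - η) ^ (s₁ * (1 / s₁ - 1 / s₀))) *
          (g η ^ (s₂ * (1 / s₀)) * g η ^ (s₂ * (1 / s₂ - 1 / s₀))) := by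
        rw [← ENNReal.rpow_add_of_nonneg _ _ (by positivity) (by positivity), ← a1,
          ← ENNReal.rpow_add_of_nonneg _ _ (by positivity) (by positivity), ← a2]
      _ = _ := by ring
  set D := (X ^ s₁) ^ (1 / s₁ - 1 / s₀) * (Y ^ s₂) ^ (1 / s₂ - 1 / s₀)
  have hm : Measurable (Function.uncurry fun ξ η : V => f (ξ - η) ^ s₁ * g η ^ s₂) :=
    ((hf.comp (measurable_fst.sub measurable_snd)).pow_const _).mul
      ((hg.comp measurable_snd).pow_const _)
  have hfub : ∫⁻ ξ, ∫⁻ η, f (ξ - η) ^ s₁ * g η ^ s₂ = X ^ s₁ * Y ^ s₂ := by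
    rw [lintegral_lintegral_swap hm.aemeasurable]
    calc ∫⁻ η, ∫⁻ ξ, f (ξ - η) ^ s₁ * g η ^ s₂ = ∫⁻ η, X ^ s₁ * g η ^ s₂ := by
          refine lintegral_congr fun η => ?_
          have hm' : Measurable (fun ξ => f (ξ - η) ^ s₁) :=
            (hf.comp (measurable_id.sub measurable_const)).pow_const _
          rw [lintegral_mul_const _ hm', lintegral_sub_right_eq_self (fun η => f η ^ s₁) η, hX]
      _ = _ := by rw [lintegral_const_mul _ m2, hY]
  have hm' : Measurable (fun ξ => ∫⁻ η, f (ξ - η) ^ s₁ * g η ^ s₂) := hm.lintegral_prod_right'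
  calc lpn s₀ (fun ξ => ∫⁻ η, f (ξ - η) * g η)
      ≤ (∫⁻ ξ, (∫⁻ η, f (ξ - η) ^ s₁ * g η ^ s₂) * D ^ s₀) ^ (1 / s₀) := by
        unfold lpn
        gcongr with ξ
        refine (ENNReal.rpow_le_rpow (hpt ξ) h₀.le).trans (le_of_eq ?_)
        rw [ENNReal.mul_rpow_of_nonneg _ _ h₀.le, ← ENNReal.rpow_mul, one_div_mul_cancel h₀.ne',
          ENNReal.rpow_one]
    _ = (X ^ s₁ * Y ^ s₂) ^ (1 / s₀) * D := by
        rw [lintegral_mul_const _ hm', hfub,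
          ENNReal.mul_rpow_of_nonneg _ _ p0, ← ENNReal.rpow_mul _ s₀, mul_one_div_cancel h₀.ne',
          ENNReal.rpow_one]
    _ = ((X ^ s₁) ^ (1 / s₀) * (X ^ s₁) ^ (1 / s₁ - 1 / s₀)) *
          ((Y ^ s₂) ^ (1 / s₀) * (Y ^ s₂) ^ (1 / s₂ - 1 / s₀)) := by
        rw [ENNReal.mul_rpow_of_nonneg _ _ p0]
        ring
    _ = _ := by
        rw [← ENNReal.rpow_add_of_nonneg _ _ p0 p1, ← ENNReal.rpow_add_of_nonneg _ _ p0 p2,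
          add_sub_cancel, add_sub_cancel, ← ENNReal.rpow_mul, ← ENNReal.rpow_mul,
          mul_one_div_cancel h₁'.ne', mul_one_div_cancel h₂'.ne', ENNReal.rpow_one,
          ENNReal.rpow_one]

end conv

/-! ### Mixed quasi-norms -/

/-- The mixed quasi-norm: first `L^p` in the first variable, then `L^q` in the second. -/
noncomputable def mlpn {E F : Type*} [MeasureSpace E] [MeasureSpace F] (p q : ℝ)
    (H : E × F → ℝ≥0∞) : ℝ≥0∞ :=
  lpn q (fun ξ => lpn p (fun x => H (x, ξ)))

section mlpn

variable {E F : Type*} [MeasureSpace E] [MeasureSpace F] {p q : ℝ}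

theorem mlpn_mono (hp : 0 < p) (hq : 0 < q) {H H' : E × F → ℝ≥0∞} (h : ∀ z, H z ≤ H' z) :
    mlpn p q H ≤ mlpn p q H' :=
  lpn_mono hq fun _ => lpn_mono hp fun _ => h _

theorem mlpn_const_mul (hp : 0 < p) (hq : 0 < q) {c : ℝ≥0∞} (hc : c ≠ ∞) (H : E × F → ℝ≥0∞) :
    mlpn p q (fun z => c * H z) = c * mlpn p q H := by
  unfold mlpn
  simp_rw [lpn_const_mul hp hc]
  exact lpn_const_mul hq hc _

theorem mlpn_rpow {r : ℝ} (hr : 0 < r) (H : E × F → ℝ≥0∞) :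
    mlpn p q (fun z => H z ^ r) = mlpn (r * p) (r * q) H ^ r := by
  unfold mlpn
  simp_rw [lpn_rpow hr]

theorem measurable_lpn_fst [SFinite (volume : Measure E)] {H : E × F → ℝ≥0∞} (hH : Measurable H) :
    Measurable (fun ξ => lpn p (fun x => H (x, ξ))) :=
  measurable_lpn_left (f := fun x ξ => H (x, ξ)) hH

theorem mlpn_add_le [SFinite (volume : Measure E)] (hp : 0 < p) (hq : 0 < q) :
    ∃ C : ℝ≥0, ∀ H H' : E × F → ℝ≥0∞, Measurable H →
      mlpn p q (fun z => H z + H' z) ≤ C * (mlpn p q H + mlpn p q H') := by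
  obtain ⟨C, hC⟩ := lpn_add_le (α := E) hp
  obtain ⟨D, hD⟩ := lpn_add_le (α := F) hq
  refine ⟨C * D, fun H H' hH => ?_⟩
  calc mlpn p q (fun z => H z + H' z)
      ≤ lpn q (fun ξ => C * (lpn p (fun x => H (x, ξ)) + lpn p (fun x => H' (x, ξ)))) :=
        lpn_mono hq fun ξ => hC _ _ (hH.comp measurable_prodMk_right)
    _ ≤ C * (D * (mlpn p q H + mlpn p q H')) := by
        rw [lpn_const_mul hq ENNReal.coe_ne_top]
        gcongr
        exact hD _ _ (measurable_lpn_fst hH)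
    _ = _ := by rw [ENNReal.coe_mul, mul_assoc]

end mlpn

/-! ### Mixed quasi-norms of slowly varying functions and of convolutions -/

section mixed

variable {E : Type*} [NormedAddCommGroup E] [NormedSpace ℝ E] [FiniteDimensional ℝ E]
  [MeasureSpace E] [BorelSpace E] [(volume : Measure E).IsAddHaarMeasure]

theorem IsSlow.exists_le_mlpn (K : ℝ≥0) {l p q : ℝ} (hl : 0 ≤ l) (hp : 0 < p) (hq : 0 < q) :
    ∃ C : ℝ≥0, ∀ H : E × E → ℝ≥0∞, IsSlow K l H → ∀ z, H z ≤ C * mlpn p q H := by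
  obtain ⟨C, hC⟩ := IsSlow.exists_le_lpn (V := E) K hl hp
  obtain ⟨D, hD⟩ := IsSlow.exists_le_lpn (V := E) K hl hq
  refine ⟨C * D, fun H hH z => ?_⟩
  calc H z ≤ C * lpn p (fun x => H (x, z.2)) := hC _ (hH.fst z.2) z.1
    _ ≤ C * (D * mlpn p q H) := by
        gcongr
        exact hD _ (IsSlow.lpn_apply hp (H := fun ξ x => H (x, ξ)) hH.snd) z.2
    _ = _ := by rw [ENNReal.coe_mul, mul_assoc]

/-- Minkowski in each of the two variables together with translation invariance. Quasi-norms are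
treated by applying this to r-th powers. -/
theorem mlpn_conv_le {P Q : ℝ} (hP : 1 ≤ P) (hQ : 1 ≤ Q) {B e : E × E → ℝ≥0∞}
    (hB : Measurable B) (he : Measurable e) :
    mlpn P Q (fun z => ∫⁻ u, B (z - u) * e u) ≤ mlpn P Q B * ∫⁻ u, e u := by
  have hP0 : 0 < P := by linarith
  have hQ0 : 0 < Q := by linarith
  have hb : Measurable (fun ξ => lpn P (fun x => B (x, ξ))) := measurable_lpn_fst hB
  have hpt : ∀ (s : ℝ) (hs : 0 < s) (f : E → ℝ≥0∞) (hf : Measurable f) (c : ℝ≥0∞) (a : E),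
      lpn s (fun x => f (x - a) * c) = lpn s f * c := by
    intro s hs f hf c a
    unfold lpn
    simp_rw [ENNReal.mul_rpow_of_nonneg _ _ hs.le]
    have hm : Measurable (fun x => f (x - a) ^ s) :=
      (hf.comp (measurable_id.sub measurable_const)).pow_const _
    rw [lintegral_mul_const _ hm, lintegral_sub_right_eq_self (fun x => f x ^ s) a,
      ENNReal.mul_rpow_of_nonneg _ _ (by positivity), ← ENNReal.rpow_mul _ s,
      mul_one_div_cancel hs.ne', ENNReal.rpow_one]
  calc mlpn P Q (fun z => ∫⁻ u, B (z - u) * e u)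
      ≤ lpn Q (fun ξ => ∫⁻ u : E × E, lpn P (fun x => B (x, ξ - u.2)) * e u) := by
        refine lpn_mono hQ0 fun ξ => ?_
        refine (lpn_lintegral_le hP (f := fun (x : E) (u : E × E) => B ((x, ξ) - u) * e u)
          (by
            refine Measurable.mul ?_ ?_
            · exact hB.comp ((measurable_fst.prodMk measurable_const).sub measurable_snd)
            · exact he.comp measurable_snd)).trans (le_of_eq ?_)
        refine lintegral_congr fun u => ?_
        exact hpt P hP0 (fun x => B (x, ξ - u.2)) (hB.comp measurable_prodMk_right) _ _
    _ ≤ ∫⁻ u : E × E, lpn Q (fun ξ => lpn P (fun x => B (x, ξ - u.2)) * e u) := by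
        refine lpn_lintegral_le hQ
          (f := fun (ξ : E) (u : E × E) => lpn P (fun x => B (x, ξ - u.2)) * e u) ?_
        exact (hb.comp (measurable_fst.sub (measurable_snd.comp measurable_snd))).mul
          (he.comp measurable_snd)
    _ = ∫⁻ u : E × E, mlpn P Q B * e u := by
        refine lintegral_congr fun u => ?_
        exact hpt Q hQ0 _ hb _ _
    _ = _ := lintegral_const_mul _ he

/-- The place where the conditions on the exponents enter. After passing to r-th powers, with 1/r
the maximum, only Minkowski, Hölder and Young with admissible exponents are needed; slow variation
absorbs every strict inequality between exponents. -/
theorem exists_mlpn_partialConv_le (K₁ K₂ : ℝ≥0) {l₁ l₂ : ℝ} (hl₁ : 0 ≤ l₁) (hl₂ : 0 ≤ l₂)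
    {p₀ p₁ p₂ q₀ q₁ q₂ : ℝ} (hp₀ : 0 < p₀) (hp₁ : 0 < p₁) (hp₂ : 0 < p₂) (hq₀ : 0 < q₀)
    (hq₁ : 0 < q₁) (hq₂ : 0 < q₂) (hp : 1 / p₀ ≤ 1 / p₁ + 1 / p₂)
    (hq : 1 / q₀ ≤ 1 / q₁ + 1 / q₂ - max 1 (max (1 / p₀) (max (1 / q₁) (1 / q₂)))) :
    ∃ C : ℝ≥0, ∀ H₁ H₂ : E × E → ℝ≥0∞, Measurable H₁ → Measurable H₂ → IsSlow K₁ l₁ H₁ →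
      IsSlow K₂ l₂ H₂ → mlpn p₀ q₀ (fun z => ∫⁻ η, H₁ (z.1, z.2 - η) * H₂ (z.1, η)) ≤
        C * (mlpn p₁ q₁ H₁ * mlpn p₂ q₂ H₂) := by
  set M := max 1 (max (1 / p₀) (max (1 / q₁) (1 / q₂))) with hM
  have hM1 : 1 ≤ M := le_max_left _ _
  have hMp : 1 / p₀ ≤ M := (le_max_left _ _).trans (le_max_right _ _)
  have hMq₁ : 1 / q₁ ≤ M :=
    ((le_max_left _ _).trans (le_max_right _ _)).trans (le_max_right _ _)
  have hMq₂ : 1 / q₂ ≤ M :=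
    ((le_max_right _ _).trans (le_max_right _ _)).trans (le_max_right _ _)
  clear_value M
  have hM0 : 0 < M := by linarith
  obtain ⟨r, hr, hMr⟩ : ∃ r : ℝ, 0 < r ∧ M = 1 / r := ⟨1 / M, by positivity, by simp⟩
  subst hMr
  have hr1 : r ≤ 1 := by rwa [le_div_iff₀ hr, one_mul] at hM1
  have hrp : 1 ≤ 1 / r * p₀ := by rw [div_le_iff₀ hp₀] at hMp; exact hMp
  have hrq₁ : 1 ≤ 1 / r * q₁ := by rw [div_le_iff₀ hq₁] at hMq₁; exact hMq₁
  have hrq₂ : 1 ≤ 1 / r * q₂ := by rw [div_le_iff₀ hq₂] at hMq₂; exact hMq₂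
  have hr' : 0 < 1 / r := by positivity
  -- exponents
  set p := 1 / (1 / p₁ + 1 / p₂) with hpdef
  have hpp : 0 < p := by positivity
  have hpp₀ : p ≤ p₀ := by
    rw [hpdef, div_le_iff₀ (by positivity)]
    rwa [div_le_iff₀ hp₀, mul_comm] at hp
  have hY0 : 0 < 1 / q₁ + 1 / q₂ - 1 / r := lt_of_lt_of_le (by positivity) hq
  -- The exact Young exponent belonging to q₁/r and q₂/r; the condition on q₀ says that t ≤ q₀/r.
  set t := (1 / r) / (1 / q₁ + 1 / q₂ - 1 / r) with ht
  have ht0 : 0 < t := by positivity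
  have hts : t ≤ 1 / r * q₀ := by
    rw [ht, div_le_iff₀ hY0, mul_assoc]
    rw [div_le_iff₀ hq₀, mul_comm] at hq
    exact le_mul_of_one_le_right hr'.le hq
  have hYoung : 1 / (1 / r * q₁) + 1 / (1 / r * q₂) = 1 + 1 / t := by
    rw [ht]
    field_simp
    ring
  obtain ⟨C₁, hC₁⟩ := IsSlow.exists_lpn_le_lpn (V := E) (K₁ * K₂) (add_nonneg hl₁ hl₂) hr hr1
  obtain ⟨C₂, hC₂⟩ := IsSlow.exists_lpn_le_lpn (V := E) (K₁ * K₂) (add_nonneg hl₁ hl₂) hpp hpp₀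
  obtain ⟨C₃, hC₃⟩ := IsSlow.exists_lpn_le_lpn (V := E) (K₁ ^ r) (mul_nonneg hl₁ hr.le) ht0 hts
  refine ⟨C₁ * C₂ * C₃ ^ (1 / r), fun H₁ H₂ m₁ m₂ s₁ s₂ => ?_⟩
  set a₁ : E → ℝ≥0∞ := fun ξ => lpn p₁ (fun x => H₁ (x, ξ)) with ha₁
  set a₂ : E → ℝ≥0∞ := fun ξ => lpn p₂ (fun x => H₂ (x, ξ)) with ha₂
  have ma₁ : Measurable a₁ := measurable_lpn_fst m₁
  have ma₂ : Measurable a₂ := measurable_lpn_fst m₂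
  have sa₁ : IsSlow K₁ l₁ a₁ := IsSlow.lpn_apply hp₁ (H := fun ξ x => H₁ (x, ξ)) s₁.snd
  have mH : Measurable (fun w : (E × E) × E => H₁ (w.1.1, w.1.2 - w.2) * H₂ (w.1.1, w.2)) := by
    refine (m₁.comp ?_).mul (m₂.comp ?_) <;> fun_prop
  -- The integrand is slowly varying in η, so its L¹ norm is controlled by its L^r quasi-norm.
  have h1 : ∀ x ξ, ∫⁻ η, H₁ (x, ξ - η) * H₂ (x, η) ≤
      C₁ * (∫⁻ η, (H₁ (x, ξ - η) * H₂ (x, η)) ^ r) ^ (1 / r) := fun x ξ => by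
    have := hC₁ (fun η => H₁ (x, ξ - η) * H₂ (x, η)) (mH.comp (measurable_prodMk_left (x := (x, ξ))))
      (((s₁.snd x).const_sub ξ).mul (s₂.snd x))
    simpa [lpn] using this
  -- Minkowski in L^{p₀/r} moves the quasi-norm in x inside the integral, where Hölder separates the
  -- factors.
  have h2 : ∀ ξ, lpn p₀ (fun x => ∫⁻ η, H₁ (x, ξ - η) * H₂ (x, η)) ≤
      C₁ * C₂ * (∫⁻ η, a₁ (ξ - η) ^ r * a₂ η ^ r) ^ (1 / r) := by
    intro ξ
    have mξ : Measurable (Function.uncurry fun x η : E => H₁ (x, ξ - η) * H₂ (x, η)) :=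
      mH.comp (f := fun w : E × E => ((w.1, ξ), w.2)) (by fun_prop)
    have h3 : ∀ η, lpn p₀ (fun x => H₁ (x, ξ - η) * H₂ (x, η)) ≤ C₂ * (a₁ (ξ - η) * a₂ η) := by
      intro η
      refine (hC₂ (fun x => H₁ (x, ξ - η) * H₂ (x, η)) (mξ.comp measurable_prodMk_right)
        ((s₁.fst _).mul (s₂.fst _))).trans ?_
      gcongr
      exact lpn_mul_le hpp hp₁ hp₂ (by rw [hpdef, one_div_one_div])
        (m₁.comp measurable_prodMk_right) (m₂.comp measurable_prodMk_right)
    calc lpn p₀ (fun x => ∫⁻ η, H₁ (x, ξ - η) * H₂ (x, η))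
        ≤ lpn p₀ (fun x => C₁ * (∫⁻ η, (H₁ (x, ξ - η) * H₂ (x, η)) ^ r) ^ (1 / r)) :=
          lpn_mono hp₀ fun x => h1 x ξ
      _ = C₁ * lpn (1 / r * p₀) (fun x => ∫⁻ η, (H₁ (x, ξ - η) * H₂ (x, η)) ^ r) ^ (1 / r) := by
          rw [lpn_const_mul hp₀ ENNReal.coe_ne_top, lpn_rpow hr']
      _ ≤ C₁ * (∫⁻ η, lpn (1 / r * p₀) (fun x => (H₁ (x, ξ - η) * H₂ (x, η)) ^ r)) ^ (1 / r) := by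
          gcongr
          exact lpn_lintegral_le hrp (mξ.pow_const r)
      _ = C₁ * (∫⁻ η, lpn p₀ (fun x => H₁ (x, ξ - η) * H₂ (x, η)) ^ r) ^ (1 / r) := by
          simp_rw [lpn_rpow hr, ← mul_assoc, mul_one_div_cancel hr.ne', one_mul]
      _ ≤ C₁ * (∫⁻ η, (C₂ * (a₁ (ξ - η) * a₂ η)) ^ r) ^ (1 / r) := by
          gcongr with η
          exact h3 η
      _ = _ := by
          simp_rw [ENNReal.mul_rpow_of_nonneg _ _ hr.le]
          rw [lintegral_const_mul' _ _ (ENNReal.rpow_ne_top_of_nonneg hr.le ENNReal.coe_ne_top),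
            ENNReal.mul_rpow_of_nonneg _ _ hr'.le, ← ENNReal.rpow_mul, mul_one_div_cancel hr.ne',
            ENNReal.rpow_one, mul_assoc]
  have mconv : Measurable (fun ξ => ∫⁻ η, a₁ (ξ - η) ^ r * a₂ η ^ r) := by
    refine Measurable.lintegral_prod_right' (f := fun w : E × E => a₁ (w.1 - w.2) ^ r * a₂ w.2 ^ r) ?_
    exact ((ma₁.comp (measurable_fst.sub measurable_snd)).pow_const _).mul
      ((ma₂.comp measurable_snd).pow_const _)
  -- A convolution inherits slow variation from its first factor alone.
  have sconv : IsSlow (K₁ ^ r) (l₁ * r) (fun ξ => ∫⁻ η, a₁ (ξ - η) ^ r * a₂ η ^ r) := by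
    refine IsSlow.lintegral_apply (H := fun ξ η => a₁ (ξ - η) ^ r * a₂ η ^ r) fun η ξ ζ => ?_
    have := sa₁.rpow hr (ξ - η) ζ
    simp only [sub_add_eq_add_sub] at this
    simp only
    rw [← mul_assoc]
    gcongr
  calc mlpn p₀ q₀ (fun z => ∫⁻ η, H₁ (z.1, z.2 - η) * H₂ (z.1, η))
      ≤ lpn q₀ (fun ξ => C₁ * C₂ * (∫⁻ η, a₁ (ξ - η) ^ r * a₂ η ^ r) ^ (1 / r)) :=
        lpn_mono hq₀ h2
    _ = C₁ * C₂ * lpn (1 / r * q₀) (fun ξ => ∫⁻ η, a₁ (ξ - η) ^ r * a₂ η ^ r) ^ (1 / r) := by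
        rw [lpn_const_mul hq₀ (ENNReal.mul_ne_top ENNReal.coe_ne_top ENNReal.coe_ne_top),
          lpn_rpow hr']
    _ ≤ C₁ * C₂ * (C₃ * (lpn (1 / r * q₁) (fun ξ => a₁ ξ ^ r) *
          lpn (1 / r * q₂) (fun ξ => a₂ ξ ^ r))) ^ (1 / r) := by
        gcongr
        refine (hC₃ _ mconv sconv).trans ?_
        gcongr
        exact lpn_conv_le ht0 hrq₁ hrq₂ hYoung (ma₁.pow_const _) (ma₂.pow_const _)
    _ = C₁ * C₂ * (C₃ ^ (1 / r) * (lpn q₁ a₁ * lpn q₂ a₂)) := by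
        simp_rw [lpn_rpow hr, ← mul_assoc, mul_one_div_cancel hr.ne', one_mul]
        rw [ENNReal.mul_rpow_of_nonneg _ _ hr'.le, ENNReal.mul_rpow_of_nonneg _ _ hr'.le,
          ← ENNReal.rpow_mul, ← ENNReal.rpow_mul, mul_one_div_cancel hr.ne', ENNReal.rpow_one,
          ENNReal.rpow_one]
        ring
    _ = _ := by
        rw [ENNReal.coe_mul, ENNReal.coe_mul, ENNReal.coe_rpow_of_nonneg _ hr'.le, mlpn, mlpn]
        ring

end mixed

/-! ### Local averages -/

/-- The local `L^r` average with the exponential weight `exp (-l ‖·‖)`. -/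
noncomputable def expAvg {V : Type*} [NormedAddCommGroup V] [MeasureSpace V] (r l : ℝ)
    (F : V → ℝ≥0∞) (z : V) : ℝ≥0∞ :=
  (∫⁻ w, F w ^ r * wexp (-(l * r)) (z - w)) ^ (1 / r)

section average

variable {V : Type*} [NormedAddCommGroup V] [MeasureSpace V]

/-- The averaging kernel is slowly varying with rate lr, and the root 1/r turns this into l. Nothing
is required of F. -/
theorem isSlow_expAvg {r l : ℝ} (hr : 0 < r) (hl : 0 ≤ l) (F : V → ℝ≥0∞) :
    IsSlow 1 l (expAvg r l F) := by
  have hlr : 0 ≤ l * r := by positivity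
  have h : IsSlow 1 (l * r) (fun z => ∫⁻ w, F w ^ r * wexp (-(l * r)) (z - w)) := by
    refine IsSlow.lintegral_apply (H := fun z w => F w ^ r * wexp (-(l * r)) (z - w)) fun w x y => ?_
    simp only [ENNReal.coe_one, one_mul]
    rw [mul_left_comm]
    gcongr
    have := wexp_neg_le hlr (x + y - w) (-y)
    rwa [wexp_neg_right, show x + y - w + -y = x - w by abel] at this
  have := h.rpow (s := 1 / r) (by positivity)
  rwa [NNReal.one_rpow, mul_assoc, mul_one_div_cancel hr.ne', mul_one] at this

/-- A function that is dominated by its averages with arbitrarily fast exponential decay is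
dominated by its `L^r` averages for `0 < r ≤ 1`. -/
theorem rpow_le_of_le_lintegral {F : V → ℝ≥0∞} {r : ℝ} (hr : 0 < r) (hr1 : r ≤ 1) {C : ℝ → ℝ≥0}
    (hC : ∀ l, 0 < l → ∀ z, F z ≤ C l * ∫⁻ w, F w * wexp (-l) (z - w))
    (hF : ∃ (m : ℝ) (A : ℝ≥0), ∀ w, F w ≤ A * wexp m w) {l : ℝ} (hl : 0 < l) (z : V) :
    F z ^ r ≤ C l * ∫⁻ w, F w ^ r * wexp (-(l * r)) (z - w) := by
  set S : ℝ → V → ℝ≥0∞ := fun l z => ⨆ w, F w * wexp (-l) (z - w) with hS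
  set A : ℝ → V → ℝ≥0∞ := fun l z => ∫⁻ w, F w ^ r * wexp (-(l * r)) (z - w) with hA
  have hwS : ∀ l z w, F w * wexp (-l) (z - w) ≤ S l z := fun l z w =>
    le_iSup (fun w => F w * wexp (-l) (z - w)) w
  have hFS : ∀ l z, F z ≤ S l z := fun l z => by simpa using hwS l z z
  have hr1' : 0 ≤ 1 - r := by linarith
  -- Splitting X = X^r X^(1-r) and bounding the second factor by the weighted supremum gives S ≤ C A
  -- S^(1-r). Finiteness of S is needed to cancel S^(1-r).
  have key : ∀ l, 0 < l → ∀ z, S l z ≠ ∞ → S l z ^ r ≤ C l * A l z := by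
    intro l hl z hfin
    rcases eq_or_ne (S l z) 0 with h0 | h0
    · rw [h0, ENNReal.zero_rpow_of_pos hr]
      exact zero_le
    have h2 : S l z ^ (1 - r) ≠ 0 := (ENNReal.rpow_pos (pos_iff_ne_zero.2 h0) hfin).ne'
    have h3 : S l z ^ (1 - r) ≠ ∞ := ENNReal.rpow_ne_top_of_nonneg hr1' hfin
    have h1 : S l z ≤ C l * A l z * S l z ^ (1 - r) := by
      refine iSup_le fun w => ?_
      calc F w * wexp (-l) (z - w) ≤ C l * (∫⁻ u, F u * wexp (-l) (w - u)) * wexp (-l) (z - w) := by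
            gcongr
            exact hC l hl w
        _ = C l * ∫⁻ u, F u * wexp (-l) (w - u) * wexp (-l) (z - w) := by
            rw [lintegral_mul_const' _ _ (wexp_ne_top _ _), mul_assoc]
        _ ≤ C l * ∫⁻ u, F u ^ r * wexp (-(l * r)) (z - u) * S l z ^ (1 - r) := by
            refine mul_le_mul_right (lintegral_mono fun u => ?_) _
            have e1 : wexp (-l) (w - u) * wexp (-l) (z - w) ≤ wexp (-l) (z - u) := by
              have h4 := wexp_neg_le hl.le (w - u) (z - w)
              rw [add_comm, sub_add_sub_cancel] at h4
              calc wexp (-l) (w - u) * wexp (-l) (z - w)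
                  ≤ wexp l (z - w) * wexp (-l) (z - u) * wexp (-l) (z - w) := by gcongr
                _ = wexp (-l) (z - u) * (wexp (-l) (z - w) * wexp l (z - w)) := by ring
                _ = _ := by rw [wexp_neg_mul_wexp, mul_one]
            set X := F u * wexp (-l) (z - u) with hX
            calc F u * wexp (-l) (w - u) * wexp (-l) (z - w) ≤ X := by
                  rw [mul_assoc]
                  exact mul_le_mul_right e1 _
              _ = X ^ r * X ^ (1 - r) := by
                  rw [← ENNReal.rpow_add_of_nonneg _ _ hr.le hr1', add_sub_cancel, ENNReal.rpow_one]
              _ ≤ X ^ r * S l z ^ (1 - r) := by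
                  gcongr
                  exact hwS l z u
              _ = _ := by
                  rw [hX, ENNReal.mul_rpow_of_nonneg _ _ hr.le, wexp_rpow, neg_mul]
        _ = _ := by rw [lintegral_mul_const' _ _ h3, mul_assoc]
    rw [← ENNReal.mul_le_mul_iff_left h2 h3, ← ENNReal.rpow_add_of_nonneg _ _ hr.le hr1',
      add_sub_cancel, ENNReal.rpow_one]
    exact h1
  by_cases hAz : A l z = ∞
  · change F z ^ r ≤ C l * A l z
    rcases eq_or_ne (C l) 0 with h0 | h0
    · have := hC l hl z
      rw [h0, ENNReal.coe_zero, zero_mul, nonpos_iff_eq_zero] at this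
      rw [this, ENNReal.zero_rpow_of_pos hr]
      exact zero_le
    · rw [hAz, ENNReal.mul_top (by simpa using h0)]
      exact le_top
  -- The growth of F makes S finite only at the possibly larger rate m'. That rate is used just to
  -- prove S finite at rate l, so the final constant C l does not depend on the growth of F.
  obtain ⟨m, B, hB⟩ := hF
  set m' := max m l with hm'
  have hm0 : 0 < m' := lt_max_of_lt_right hl
  have hSfin : ∀ y, S m' y ≠ ∞ := fun y => by
    refine ne_top_of_le_ne_top (b := B * wexp m' y) (ENNReal.mul_ne_top ENNReal.coe_ne_top
      (wexp_ne_top _ _)) (iSup_le fun w => ?_)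
    calc F w * wexp (-m') (y - w) ≤ B * wexp m' w * wexp (-m') (y - w) := by
          gcongr
          exact (hB w).trans (by gcongr; exact wexp_mono (le_max_left _ _) _)
      _ ≤ B * (wexp m' (w - y) * wexp m' y) * wexp (-m') (y - w) := by
          gcongr
          simpa using wexp_add_le hm0.le (w - y) y
      _ = B * wexp m' y * (wexp (-m') (y - w) * wexp m' (y - w)) := by
          rw [wexp_sub_comm m' w y]
          ring
      _ = _ := by rw [wexp_neg_mul_wexp, mul_one]
  have hFA : ∀ y, F y ^ r ≤ C m' * A l y := fun y => by
    calc F y ^ r ≤ S m' y ^ r := by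
          gcongr
          exact hFS m' y
      _ ≤ C m' * A m' y := key m' hm0 y (hSfin y)
      _ ≤ C m' * A l y := by
          simp only [hA]
          gcongr with w
          refine wexp_mono ?_ _
          have : l ≤ m' := le_max_right _ _
          nlinarith
  -- F^r is bounded by an average of rate l, which is slowly varying, so the weighted supremum at
  -- rate l is finite when A l z is.
  have hSl : S l z ≠ ∞ := by
    have hb : (C m' * A l z) ^ (1 / r) ≠ ∞ := ENNReal.rpow_ne_top_of_nonneg (by positivity)
      (ENNReal.mul_ne_top ENNReal.coe_ne_top hAz)
    refine ne_top_of_le_ne_top hb (iSup_le fun w => ?_)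
    have h5 : (F w * wexp (-l) (z - w)) ^ r ≤ C m' * A l z := by
      rw [ENNReal.mul_rpow_of_nonneg _ _ hr.le, wexp_rpow]
      calc F w ^ r * wexp (-l * r) (z - w) ≤ C m' * A l w * wexp (-l * r) (z - w) := by
            gcongr
            exact hFA w
        _ = C m' * ∫⁻ u, F u ^ r * wexp (-(l * r)) (w - u) * wexp (-l * r) (z - w) := by
            rw [lintegral_mul_const' _ _ (wexp_ne_top _ _), mul_assoc]
        _ ≤ _ := by
            simp only [hA]
            refine mul_le_mul_right (lintegral_mono fun u => ?_) _
            have hlr : 0 ≤ l * r := by positivity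
            have h4 := wexp_neg_le hlr (w - u) (z - w)
            rw [add_comm, sub_add_sub_cancel] at h4
            rw [mul_assoc]
            gcongr
            calc wexp (-(l * r)) (w - u) * wexp (-l * r) (z - w)
                ≤ wexp (l * r) (z - w) * wexp (-(l * r)) (z - u) * wexp (-l * r) (z - w) := by gcongr
              _ = wexp (-(l * r)) (z - u) * (wexp (-(l * r)) (z - w) * wexp (l * r) (z - w)) := by
                rw [neg_mul]; ring
              _ = _ := by rw [wexp_neg_mul_wexp, mul_one]
    calc F w * wexp (-l) (z - w) = ((F w * wexp (-l) (z - w)) ^ r) ^ (1 / r) := by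
          rw [← ENNReal.rpow_mul, mul_one_div_cancel hr.ne', ENNReal.rpow_one]
      _ ≤ _ := by gcongr
  calc F z ^ r ≤ S l z ^ r := by
        gcongr
        exact hFS l z
    _ ≤ _ := key l hl z hSl

variable [NormedSpace ℝ V] [FiniteDimensional ℝ V]
  [BorelSpace V] [(volume : Measure V).IsAddHaarMeasure]

theorem measurable_expAvg {r l : ℝ} {F : V → ℝ≥0∞} (hF : Measurable F) :
    Measurable (expAvg r l F) := by
  refine Measurable.pow_const ?_ _
  refine Measurable.lintegral_prod_right'
    (f := fun w : V × V => F w.2 ^ r * wexp (-(l * r)) (w.1 - w.2)) ?_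
  exact ((hF.comp measurable_snd).pow_const _).mul
    ((measurable_wexp _).comp (measurable_fst.sub measurable_snd))

/-- Averaging a slowly varying function reproduces it up to a constant: part l of the decay pays for
the variation, part m for integrability. -/
theorem IsSlow.lintegral_mul_wexp_le {K : ℝ≥0} {l m : ℝ} {H : V → ℝ≥0∞} (hH : IsSlow K l H)
    (z : V) : ∫⁻ w, H w * wexp (-(l + m)) (z - w) ≤ K * (∫⁻ w : V, wexp (-m) w) * H z := by
  calc ∫⁻ w, H w * wexp (-(l + m)) (z - w)
      ≤ ∫⁻ w, K * H z * wexp (-m) (z - w) := by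
        refine lintegral_mono fun w => ?_
        calc H w * wexp (-(l + m)) (z - w)
            ≤ K * wexp l (z - w) * H z * wexp (-(l + m)) (z - w) := by
              gcongr
              exact hH.le_sub z w
          _ = K * H z * (wexp l (z - w) * wexp (-(l + m)) (z - w)) := by ring
          _ = _ := by rw [wexp_mul_wexp]; ring_nf
    _ = _ := by
        have hm : Measurable (fun w : V => wexp (-m) (z - w)) :=
          (measurable_wexp _).comp (measurable_const.sub measurable_id)
        rw [lintegral_const_mul _ hm, lintegral_sub_left_eq_self (fun w => wexp (-m) w) z]
        ring

end average

/-! ### Weighted quasi-norms of local averages -/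

section

variable {E : Type*} [NormedAddCommGroup E] [NormedSpace ℝ E] [FiniteDimensional ℝ E]
  [MeasureSpace E] [BorelSpace E] [(volume : Measure E).IsAddHaarMeasure]
  [(volume : Measure (E × E)).IsAddHaarMeasure]

/-- The weight can be moved inside the average at the price of the rate R < l. The r-th power is
then a convolution with an integrable exponential, bounded on L^{p/r,q/r} because both exponents are
at least 1. -/
theorem exists_mlpn_expAvg_mul_le (K : ℝ≥0) {R l r p q : ℝ} (hl : R < l) (hr : 0 < r)
    (hrp : r ≤ p) (hrq : r ≤ q) :
    ∃ C : ℝ≥0, ∀ F W : E × E → ℝ≥0∞, Measurable F → Measurable W → IsSlow K R W →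
      mlpn p q (fun z => expAvg r l F z * W z) ≤ C * mlpn p q (fun z => F z * W z) := by
  have hr' : 0 < 1 / r := by positivity
  have hP : 1 ≤ 1 / r * p := by rwa [one_div, ← div_eq_inv_mul, one_le_div hr]
  have hQ : 1 ≤ 1 / r * q := by rwa [one_div, ← div_eq_inv_mul, one_le_div hr]
  set c := (l - R) * r
  have hc : 0 < c := mul_pos (sub_pos.2 hl) hr
  set I := ∫⁻ u : E × E, wexp (-c) u
  have hI : I ≠ ∞ := (lintegral_wexp_neg_lt_top hc).ne
  have hp : 0 < p := by linarith
  have hq : 0 < q := by linarith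
  refine ⟨K * I.toNNReal ^ (1 / r), fun F W mF mW sW => ?_⟩
  have mB : Measurable (fun z => (F z * W z) ^ r) := (mF.mul mW).pow_const _
  have h1 : ∀ z, expAvg r l F z * W z ≤
      K * (∫⁻ u, (F (z - u) * W (z - u)) ^ r * wexp (-c) u) ^ (1 / r) := by
    intro z
    have h2 : (∫⁻ w, F w ^ r * wexp (-(l * r)) (z - w)) * W z ^ r ≤
        K ^ r * ∫⁻ u, (F (z - u) * W (z - u)) ^ r * wexp (-c) u := by
      rw [← lintegral_const_mul' _ _ (ENNReal.rpow_ne_top_of_nonneg hr.le ENNReal.coe_ne_top),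
        ← lintegral_sub_left_eq_self (fun u => F u ^ r * wexp (-(l * r)) (z - u)) z]
      refine (lintegral_mul_const_le _ _).trans ?_
      refine lintegral_mono fun u => ?_
      have h3 : W z ^ r ≤ K ^ r * wexp (R * r) u * W (z - u) ^ r := by
        have := sW.rpow hr (z - u) u
        simpa [ENNReal.coe_rpow_of_nonneg _ hr.le] using this
      calc F (z - u) ^ r * wexp (-(l * r)) (z - (z - u)) * W z ^ r
          ≤ F (z - u) ^ r * wexp (-(l * r)) (z - (z - u)) *
              (K ^ r * wexp (R * r) u * W (z - u) ^ r) := by gcongr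
        _ = K ^ r * (F (z - u) ^ r * W (z - u) ^ r * (wexp (-(l * r)) u * wexp (R * r) u)) := by
            rw [sub_sub_cancel]
            ring
        _ = _ := by
            rw [wexp_mul_wexp, ENNReal.mul_rpow_of_nonneg _ _ hr.le]
            congr 3
            simp only [c]
            ring
    calc expAvg r l F z * W z
        = ((∫⁻ w, F w ^ r * wexp (-(l * r)) (z - w)) * W z ^ r) ^ (1 / r) := by
          rw [ENNReal.mul_rpow_of_nonneg _ _ hr'.le, ← ENNReal.rpow_mul (W z),
            mul_one_div_cancel hr.ne', ENNReal.rpow_one, expAvg]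
      _ ≤ (K ^ r * ∫⁻ u, (F (z - u) * W (z - u)) ^ r * wexp (-c) u) ^ (1 / r) := by gcongr
      _ = _ := by
          rw [ENNReal.mul_rpow_of_nonneg _ _ hr'.le, ← ENNReal.rpow_mul,
            mul_one_div_cancel hr.ne', ENNReal.rpow_one]
  calc mlpn p q (fun z => expAvg r l F z * W z)
      ≤ mlpn p q (fun z => K * (∫⁻ u, (F (z - u) * W (z - u)) ^ r * wexp (-c) u) ^ (1 / r)) :=
        mlpn_mono hp hq h1
    _ = K * mlpn (1 / r * p) (1 / r * q)
          (fun z => ∫⁻ u, (F (z - u) * W (z - u)) ^ r * wexp (-c) u) ^ (1 / r) := by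
        rw [mlpn_const_mul hp hq ENNReal.coe_ne_top, mlpn_rpow hr']
    _ ≤ K * (mlpn (1 / r * p) (1 / r * q) (fun z => (F z * W z) ^ r) * I) ^ (1 / r) := by
        gcongr
        exact mlpn_conv_le hP hQ mB (measurable_wexp _)
    _ = _ := by
        rw [mlpn_rpow hr, ENNReal.mul_rpow_of_nonneg _ _ hr'.le, ← ENNReal.rpow_mul,
          mul_one_div_cancel hr.ne', ENNReal.rpow_one, ENNReal.coe_mul,
          ENNReal.coe_rpow_of_nonneg _ hr'.le, ENNReal.coe_toNNReal hI, ← mul_assoc r,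
          ← mul_assoc r, mul_one_div_cancel hr.ne', one_mul, one_mul]
        ring

end

/-! ### Regularity of moderate weights -/

/-- The supremum of H(w) exp(-R‖z - w‖) over w is lower semicontinuous in z, hence measurable
whatever H is; slow variation of H keeps it comparable to H. -/
theorem IsSlow.exists_measurable_majorant {V : Type*} [NormedAddCommGroup V] [MeasurableSpace V]
    [BorelSpace V] {K : ℝ≥0} {R : ℝ} (hR : 0 ≤ R) {H : V → ℝ≥0∞} (hH : IsSlow K R H) :
    ∃ W : V → ℝ≥0∞, Measurable W ∧ IsSlow 1 R W ∧ (∀ x, H x ≤ W x) ∧ ∀ x, W x ≤ K * H x := by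
  refine ⟨fun z => ⨆ w, H w * wexp (-R) (z - w), ?_, fun x y => ?_, fun x => ?_, fun x => ?_⟩
  · refine LowerSemicontinuous.measurable (lowerSemicontinuous_iSup fun w => ?_)
    by_cases hw : H w = ∞
    · simp_rw [hw, ENNReal.top_mul (wexp_ne_zero _ _)]
      exact lowerSemicontinuous_const
    · refine Continuous.lowerSemicontinuous ?_
      exact (ENNReal.continuous_const_mul hw).comp
        ((continuous_wexp _).comp (continuous_id.sub continuous_const))
  · refine iSup_le fun w => ?_
    rw [ENNReal.coe_one, one_mul]
    calc H w * wexp (-R) (x + y - w) ≤ H w * (wexp R y * wexp (-R) (x - w)) := by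
          gcongr
          have := wexp_neg_le hR (x + y - w) (-y)
          rwa [wexp_neg_right, show x + y - w + -y = x - w by abel] at this
      _ = wexp R y * (H w * wexp (-R) (x - w)) := by ring
      _ ≤ _ := by
          gcongr
          exact le_iSup (fun w => H w * wexp (-R) (x - w)) w
  · have := le_iSup (fun w => H w * wexp (-R) (x - w)) x
    simpa using this
  · refine iSup_le fun w => ?_
    calc H w * wexp (-R) (x - w) ≤ K * wexp R (x - w) * H x * wexp (-R) (x - w) := by
          gcongr
          exact hH.le_sub x w
      _ = K * H x * (wexp (-R) (x - w) * wexp R (x - w)) := by ring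
      _ = _ := by rw [wexp_neg_mul_wexp, mul_one]

section weights

variable {V : Type*} [NormedAddCommGroup V] [NormedSpace ℝ V] [FiniteDimensional ℝ V]
  [MeasureSpace V] [BorelSpace V] [(volume : Measure V).IsAddHaarMeasure]

/-- The function v is only essentially bounded on the ball, so v(y) itself may be uncontrolled.
Writing y = z + (y - z) with both parts outside the exceptional null set and applying moderateness
twice avoids this. -/
theorem IsModerateWeight.exists_le_of_norm_le_one {ω : V → ℝ} (hω : IsModerateWeight ω) :
    ∃ D : ℝ, 1 ≤ D ∧ ∀ x y, ‖y‖ ≤ 1 → ω (x + y) ≤ D * ω x := by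
  obtain ⟨⟨hpos, -⟩, v, ⟨hv, hvK⟩, C, hC, hmod⟩ := hω
  set B := Metric.closedBall (0 : V) 1 with hB
  obtain ⟨M, hM⟩ : ∃ M : ℝ, ∀ᵐ y, y ∈ B → v y ≤ M := by
    have h1 := (hvK B (isCompact_closedBall 0 1)).1.2
    rw [eLpNorm_exponent_top] at h1
    refine ⟨(eLpNormEssSup v (volume.restrict B)).toReal, ?_⟩
    rw [← ae_restrict_iff' Metric.isClosed_closedBall.measurableSet]
    filter_upwards [ae_le_eLpNormEssSup (f := v) (μ := volume.restrict B)] with y hy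
    have := (ENNReal.toReal_le_toReal (by simp) h1.ne).2 hy
    rw [toReal_enorm, Real.norm_eq_abs] at this
    exact (le_abs_self _).trans this
  have hM' : ∀ y, ‖y‖ ≤ 1 → ∀ x, ω (x + y) ≤ C * M * (C * M) * ω x := by
    intro y hy x
    have h2 : ∀ᵐ z, y - z ∈ B → v (y - z) ≤ M :=
      (Measure.measurePreserving_sub_left (volume : Measure V) y).quasiMeasurePreserving.ae hM
    -- For z in the ball around y/2 of radius 1/2, both z and y - z have norm at most 1. This ball
    -- has positive measure, so it is not exhausted by the exceptional points.
    obtain ⟨z, hz, hz1, hz2⟩ : ∃ z ∈ Metric.ball ((1 / 2 : ℝ) • y) (1 / 2),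
        (z ∈ B → v z ≤ M) ∧ (y - z ∈ B → v (y - z) ≤ M) := by
      by_contra! hcon
      have h3 : volume (Metric.ball ((1 / 2 : ℝ) • y) (1 / 2)) = 0 := by
        refine measure_mono_null (fun z hz => ?_) (ae_iff.1 (hM.and h2))
        simp only [Set.mem_ofPred_eq, not_and]
        intro h4 h5
        obtain ⟨h6, h7⟩ := hcon z hz h4
        exact absurd (h5 h6) (not_le.2 h7)
      exact (Metric.measure_ball_pos volume _ (by norm_num)).ne' h3
    rw [Metric.mem_ball, dist_eq_norm] at hz
    have hy2 : ‖(1 / 2 : ℝ) • y‖ ≤ 1 / 2 := by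
      rw [norm_smul]
      norm_num
      linarith
    have hzB : z ∈ B := by
      rw [hB, mem_closedBall_zero_iff]
      calc ‖z‖ = ‖(z - (1 / 2 : ℝ) • y) + (1 / 2 : ℝ) • y‖ := by rw [sub_add_cancel]
        _ ≤ _ := norm_add_le _ _
        _ ≤ 1 := by linarith
    have hyzB : y - z ∈ B := by
      rw [hB, mem_closedBall_zero_iff]
      have h8 : y - z = (1 / 2 : ℝ) • y - (z - (1 / 2 : ℝ) • y) := by
        rw [sub_sub_eq_add_sub, ← add_smul]
        norm_num
      rw [h8]
      exact (norm_sub_le _ _).trans (by linarith)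
    have e1 : ω (x + y) ≤ C * ω (x + z) * v (y - z) := by
      have := hmod (x + z) (y - z)
      rwa [show x + z + (y - z) = x + y by abel] at this
    have e2 := hmod x z
    have hvz := hz1 hzB
    have hvyz := hz2 hyzB
    have hC0 : 0 < C := by linarith
    have := hpos x
    have := hpos (x + z)
    have hM0 : 0 < M := (hv z).trans_le hvz
    calc ω (x + y) ≤ C * ω (x + z) * v (y - z) := e1
      _ ≤ C * (C * ω x * v z) * v (y - z) := by
          have := hv (y - z)
          gcongr
      _ ≤ C * (C * ω x * M) * M := by
          have := hv (y - z)
          gcongr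
      _ = _ := by ring
  refine ⟨max 1 (C * M * (C * M)), le_max_left _ _, fun x y hy => (hM' y hy x).trans ?_⟩
  have := hpos x
  gcongr
  exact le_max_right _ _

/-- A translation by y is made of ⌊‖y‖⌋ + 1 equal steps of length at most 1, each costing a factor
D; this gives the rate log D. -/
theorem IsModerateWeight.exists_isSlow {ω : V → ℝ} (hω : IsModerateWeight ω) :
    ∃ (K : ℝ≥0) (R : ℝ), 0 ≤ R ∧ IsSlow K R (fun x => ENNReal.ofReal (ω x)) := by
  obtain ⟨D, hD, h⟩ := hω.exists_le_of_norm_le_one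
  have hpos := hω.1.1
  have hD0 : 0 < D := by linarith
  have hiter : ∀ (n : ℕ) (x y : V), ‖y‖ ≤ 1 → ω (x + n • y) ≤ D ^ n * ω x := by
    intro n
    induction n with
    | zero => intro x y _; simp
    | succ n ih =>
      intro x y hy
      have := ih (x + y) y hy
      rw [add_assoc, ← succ_nsmul'] at this
      refine this.trans ?_
      rw [pow_succ, mul_assoc]
      have := h x y hy
      gcongr
  refine ⟨⟨D, hD0.le⟩, Real.log D, Real.log_nonneg hD, fun x y => ?_⟩
  set n := ⌊‖y‖⌋₊ + 1
  have hn : (0 : ℝ) < n := by positivity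
  have hyn : ‖y‖ ≤ n := by
    simp only [n, Nat.cast_add, Nat.cast_one]
    exact (Nat.lt_floor_add_one _).le
  have h1 := hiter n x ((n : ℝ)⁻¹ • y) (by
    rw [norm_smul, norm_inv, Real.norm_natCast, inv_mul_le_iff₀ hn]
    linarith)
  rw [← Nat.cast_smul_eq_nsmul ℝ, smul_smul, mul_inv_cancel₀ hn.ne', one_smul] at h1
  have h2 : D ^ n ≤ D * Real.exp (Real.log D * ‖y‖) := by
    rw [Real.exp_mul, Real.exp_log hD0, ← Real.rpow_natCast]
    calc D ^ (n : ℝ) ≤ D ^ (1 + ‖y‖) := by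
          refine Real.rpow_le_rpow_of_exponent_le hD ?_
          simp only [n, Nat.cast_add, Nat.cast_one]
          have := Nat.floor_le (norm_nonneg y)
          linarith
      _ = _ := by rw [Real.rpow_add hD0, Real.rpow_one]
  have h3 : ω (x + y) ≤ D * Real.exp (Real.log D * ‖y‖) * ω x :=
    h1.trans (mul_le_mul_of_nonneg_right h2 (hpos x).le)
  calc ENNReal.ofReal (ω (x + y)) ≤ ENNReal.ofReal (D * Real.exp (Real.log D * ‖y‖) * ω x) :=
        ENNReal.ofReal_le_ofReal h3
    _ = _ := by
        rw [ENNReal.ofReal_mul (by positivity), ENNReal.ofReal_mul hD0.le, wexp,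
          ENNReal.ofReal_eq_coe_nnreal hD0.le]
        rfl

/-- A moderate weight is equivalent to a measurable, slowly varying function. -/
theorem IsModerateWeight.exists_equiv {ω : V → ℝ} (hω : IsModerateWeight ω) :
    ∃ (K : ℝ≥0) (R : ℝ) (W : V → ℝ≥0∞), 0 ≤ R ∧ Measurable W ∧ IsSlow 1 R W ∧
      (∀ x, ENNReal.ofReal (ω x) ≤ W x) ∧ ∀ x, W x ≤ K * ENNReal.ofReal (ω x) := by
  obtain ⟨K, R, hR, hs⟩ := hω.exists_isSlow
  obtain ⟨W, h1, h2, h3, h4⟩ := hs.exists_measurable_majorant hR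
  exact ⟨K, R, W, hR, h1, h2, h3, h4⟩

end weights

/-! ### The seminorms of `Σ₁` -/

section gsNorm

namespace GSSpace

variable {d : ℕ} {h : ℝ}

theorem contDiffAt (f : GSSpace d) (n : ℕ) (x : Rd d) : ContDiffAt ℝ n f.1 x :=
  (f.2.1.of_le (mod_cast le_top)).contDiffAt

theorem gsNorm_ne_top (hh : 0 < h) (f : GSSpace d) : gsNorm h f.1 ≠ ∞ := (f.2.2 h hh).ne

theorem pow_mul_norm_iteratedFDeriv_le (hh : 0 < h) (f : GSSpace d) (k n : ℕ) (x : Rd d) :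
    ‖x‖ ^ k * ‖iteratedFDeriv ℝ n f.1 x‖ ≤
      (gsNorm h f.1).toReal * (h ^ (k + n) * (k.factorial * n.factorial)) := by
  refine (gsNorm_le_iff hh f.1 ENNReal.toReal_nonneg).1 ?_ k n x
  rw [ENNReal.ofReal_toReal (gsNorm_ne_top hh f)]

theorem norm_iteratedFDeriv_le (hh : 0 < h) (f : GSSpace d) (n : ℕ) (x : Rd d) :
    ‖iteratedFDeriv ℝ n f.1 x‖ ≤ (gsNorm h f.1).toReal * (h ^ n * n.factorial) := by
  simpa using pow_mul_norm_iteratedFDeriv_le hh f 0 n x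

theorem gsNorm_le {A : ℝ} (hh : 0 < h) (hA : 0 ≤ A) {f : Rd d → ℂ}
    (H : ∀ k n x, ‖x‖ ^ k * ‖iteratedFDeriv ℝ n f x‖ ≤ A * (h ^ (k + n) * (k.factorial * n.factorial))) :
    gsNorm h f ≤ ENNReal.ofReal A :=
  (gsNorm_le_iff hh f hA).2 H

theorem gsNorm_add_le (hh : 0 < h) (f g : GSSpace d) :
    gsNorm h (f + g).1 ≤ gsNorm h f.1 + gsNorm h g.1 := by
  rw [← ENNReal.ofReal_toReal (gsNorm_ne_top hh f), ← ENNReal.ofReal_toReal (gsNorm_ne_top hh g),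
    ← ENNReal.ofReal_add ENNReal.toReal_nonneg ENNReal.toReal_nonneg]
  refine gsNorm_le hh (by positivity) fun k n x => ?_
  rw [Submodule.coe_add, iteratedFDeriv_add_apply (contDiffAt f n x) (contDiffAt g n x), add_mul]
  calc _ ≤ ‖x‖ ^ k * (‖iteratedFDeriv ℝ n f.1 x‖ + ‖iteratedFDeriv ℝ n g.1 x‖) := by
        gcongr
        exact norm_add_le _ _
    _ ≤ _ := by
        rw [mul_add]
        exact add_le_add (pow_mul_norm_iteratedFDeriv_le hh f k n x)
          (pow_mul_norm_iteratedFDeriv_le hh g k n x)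

/-- The complex conjugate of an element of `Σ₁`. -/
noncomputable def conj (f : GSSpace d) : GSSpace d :=
  ⟨fun y => starRingEnd ℂ (f.1 y), by simpa using atom_mem f.2 0 0⟩

/-- The translation of an element of `Σ₁`. -/
noncomputable def shift (f : GSSpace d) (x : Rd d) : GSSpace d :=
  ⟨fun y => f.1 (y - x), by simpa [conj] using atom_mem (conj f).2 x 0⟩

/-- The modulation of an element of `Σ₁`. -/
noncomputable def modul (f : GSSpace d) (ξ : Rd d) : GSSpace d :=
  ⟨fun y => f.1 y * Complex.exp (-((inner ℝ ξ y : ℝ) * Complex.I)),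
    by simpa [conj] using atom_mem (conj f).2 0 ξ⟩

theorem atom_eq (f : GSSpace d) (x ξ : Rd d) :
    GSSpace.atom f x ξ = modul (shift (conj f) x) ξ := rfl

theorem gsNorm_conj (f : GSSpace d) : gsNorm h (conj f).1 = gsNorm h f.1 := by
  unfold gsNorm
  congr! 9 with k n x
  exact Complex.conjLIE.norm_iteratedFDeriv_comp_left (𝕜 := ℝ) f.1 x n

theorem pow_le_exp_mul_factorial (hh : 0 < h) {t : ℝ} (ht : 0 ≤ t) (k : ℕ) :
    t ^ k ≤ Real.exp (t / h) * (h ^ k * k.factorial) := by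
  have := Real.pow_div_factorial_le_exp (x := t / h) (by positivity) k
  rwa [div_pow, div_div, div_le_iff₀ (by positivity)] at this

/-- From ‖y‖^k ≤ 2^k(‖y - x‖^k + ‖x‖^k): halving h absorbs 2^k, and ‖x‖^k is bounded by a term of an
exponential series. -/
theorem gsNorm_shift_le (hh : 0 < h) (f : GSSpace d) (x : Rd d) :
    gsNorm h (shift f x).1 ≤
      ENNReal.ofReal (2 * Real.exp (‖x‖ / (h / 2))) * gsNorm (h / 2) f.1 := by
  have hh2 := half_pos hh
  rw [← ENNReal.ofReal_toReal (gsNorm_ne_top hh2 f), ← ENNReal.ofReal_mul (by positivity)]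
  set A := (gsNorm (h / 2) f.1).toReal
  have hA : 0 ≤ A := ENNReal.toReal_nonneg
  set a := Real.exp (‖x‖ / (h / 2)) with ha
  have ha1 : 1 ≤ a := Real.one_le_exp (by positivity)
  refine gsNorm_le hh (by positivity) fun k n y => ?_
  have e : iteratedFDeriv ℝ n (shift f x).1 y = iteratedFDeriv ℝ n f.1 (y - x) :=
    iteratedFDeriv_comp_sub (f := f.1) n x y
  rw [e]
  have h1 := pow_mul_norm_iteratedFDeriv_le hh2 f k n (y - x)
  have h2 := norm_iteratedFDeriv_le hh2 f n (y - x)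
  have h3 : ‖y‖ ^ k ≤ 2 ^ k * (‖y - x‖ ^ k + ‖x‖ ^ k) := by
    have hy : ‖y‖ ≤ ‖y - x‖ + ‖x‖ := by
      simpa using norm_add_le (y - x) x
    calc ‖y‖ ^ k ≤ (‖y - x‖ + ‖x‖) ^ k := by gcongr
      _ ≤ 2 ^ (k - 1) * (‖y - x‖ ^ k + ‖x‖ ^ k) :=
          add_pow_le (norm_nonneg _) (norm_nonneg _) k
      _ ≤ _ := by
          gcongr
          · exact one_le_two
          · omega
  calc _ ≤ 2 ^ k * (‖y - x‖ ^ k + ‖x‖ ^ k) * ‖iteratedFDeriv ℝ n f.1 (y - x)‖ := by gcongr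
    _ = 2 ^ k * (‖y - x‖ ^ k * ‖iteratedFDeriv ℝ n f.1 (y - x)‖ +
          ‖x‖ ^ k * ‖iteratedFDeriv ℝ n f.1 (y - x)‖) := by ring
    _ ≤ 2 ^ k * (A * ((h / 2) ^ (k + n) * (k.factorial * n.factorial)) +
          (a * ((h / 2) ^ k * k.factorial)) * (A * ((h / 2) ^ n * n.factorial))) := by
        gcongr
        exact pow_le_exp_mul_factorial hh2 (norm_nonneg x) k
    _ = (1 + a) * A * ((2 ^ k * (h / 2) ^ k) * (h / 2) ^ n * (k.factorial * n.factorial)) := by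
        rw [pow_add]; ring
    _ ≤ (2 * a) * A * (h ^ k * h ^ n * (k.factorial * n.factorial)) := by
        rw [← mul_pow, mul_div_cancel₀ h two_ne_zero]
        gcongr <;> linarith
    _ = _ := by rw [pow_add]

theorem contDiff_character (ξ : Rd d) :
    ContDiff ℝ (⊤ : ℕ∞) (fun y : Rd d => Complex.exp (-((inner ℝ ξ y : ℝ) * Complex.I))) := by
  have h1 : ContDiff ℝ (⊤ : ℕ∞) (fun y : Rd d => ((inner ℝ ξ y : ℝ) : ℂ)) :=
    Complex.ofRealCLM.contDiff.comp (innerSL ℝ ξ).contDiff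
  exact ((h1.mul contDiff_const).neg).cexp

theorem add_one_le_two_pow (n : ℕ) : ((n : ℝ) + 1) ≤ 2 ^ n := by
  exact_mod_cast Nat.lt_two_pow_self (n := n)

theorem choose_mul_factorials {n i : ℕ} (hi : i ≤ n) :
    (n.choose i : ℝ) * (i.factorial * (n - i).factorial) = n.factorial := by
  rw [← mul_assoc]
  exact_mod_cast Nat.choose_mul_factorial_mul_factorial hi

/-- In Leibniz' rule the binomial coefficients recombine the factorials exactly, and the number n +
1 ≤ 2^n of terms is absorbed by halving h. -/
theorem gsNorm_modul_le (hh : 0 < h) (f : GSSpace d) (ξ : Rd d) :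
    gsNorm h (modul f ξ).1 ≤
      ENNReal.ofReal (Real.exp (‖ξ‖ / (h / 2))) * gsNorm (h / 2) f.1 := by
  have hh2 := half_pos hh
  rw [← ENNReal.ofReal_toReal (gsNorm_ne_top hh2 f), ← ENNReal.ofReal_mul (by positivity)]
  set A := (gsNorm (h / 2) f.1).toReal
  have hA : 0 ≤ A := ENNReal.toReal_nonneg
  set b := Real.exp (‖ξ‖ / (h / 2)) with hb
  refine gsNorm_le hh (by positivity) fun k n y => ?_
  have key := norm_iteratedFDeriv_mul_le f.2.1 (contDiff_character ξ) y (n := n) (mod_cast le_top)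
  calc _ ≤ ‖y‖ ^ k * ∑ i ∈ Finset.range (n + 1), (n.choose i : ℝ) *
          ‖iteratedFDeriv ℝ i f.1 y‖ * ‖iteratedFDeriv ℝ (n - i)
            (fun y : Rd d => Complex.exp (-((inner ℝ ξ y : ℝ) * Complex.I))) y‖ := by
        gcongr
        exact key
    _ ≤ ‖y‖ ^ k * ∑ i ∈ Finset.range (n + 1), (n.choose i : ℝ) *
          ‖iteratedFDeriv ℝ i f.1 y‖ * (b * ((h / 2) ^ (n - i) * (n - i).factorial)) := by
        gcongr with i hi
        exact (norm_iteratedFDeriv_character_le ξ _ y).trans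
          (pow_le_exp_mul_factorial hh2 (norm_nonneg _) _)
    _ = ∑ i ∈ Finset.range (n + 1), (n.choose i : ℝ) *
          (‖y‖ ^ k * ‖iteratedFDeriv ℝ i f.1 y‖) * (b * ((h / 2) ^ (n - i) * (n - i).factorial)) := by
        rw [Finset.mul_sum]; exact Finset.sum_congr rfl fun i _ => by ring
    _ ≤ ∑ i ∈ Finset.range (n + 1), b * A * ((h / 2) ^ (k + n) * (k.factorial * n.factorial)) := by
        refine Finset.sum_le_sum fun i hi => ?_
        have hi' : i ≤ n := Nat.lt_succ_iff.1 (Finset.mem_range.1 hi)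
        have h1 := pow_mul_norm_iteratedFDeriv_le hh2 f k i y
        calc _ ≤ (n.choose i : ℝ) * (A * ((h / 2) ^ (k + i) * (k.factorial * i.factorial))) *
              (b * ((h / 2) ^ (n - i) * (n - i).factorial)) := by gcongr
          _ = b * A * ((h / 2) ^ (k + i) * (h / 2) ^ (n - i) * (k.factorial *
                ((n.choose i : ℝ) * (i.factorial * (n - i).factorial)))) := by ring
          _ = _ := by
              rw [choose_mul_factorials hi', ← pow_add, show k + i + (n - i) = k + n by omega]
    _ = b * A * (((n : ℝ) + 1) * (h / 2) ^ (k + n) * (k.factorial * n.factorial)) := by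
        rw [Finset.sum_const, Finset.card_range, nsmul_eq_mul]; push_cast; ring
    _ ≤ b * A * (2 ^ (k + n) * (h / 2) ^ (k + n) * (k.factorial * n.factorial)) := by
        gcongr
        exact (add_one_le_two_pow n).trans (pow_le_pow_right₀ one_le_two (by omega))
    _ = _ := by rw [← mul_pow, mul_div_cancel₀ h two_ne_zero]

/-- Mean value inequality for the n-th derivative on the segment from y to y - x. The extra
derivative costs n + 1 ≤ 2^n and the translation another power of two, whence the quarter of h. -/
theorem exists_gsNorm_shift_sub_le (hh : 0 < h) (f : GSSpace d) :
    ∃ C : ℝ≥0, ∀ x : Rd d, ‖x‖ ≤ 1 → gsNorm h (shift f x - f).1 ≤ C * ENNReal.ofReal ‖x‖ := by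
  have hh2 := half_pos hh
  have hh4 := half_pos hh2
  set A := (gsNorm (h / 2 / 2) f.1).toReal
  have hA : 0 ≤ A := ENNReal.toReal_nonneg
  set B := 2 * Real.exp (1 / (h / 2 / 2)) * A with hB
  have hB0 : 0 ≤ B := by positivity
  refine ⟨(h / 2 * B).toNNReal, fun x hx => ?_⟩
  change _ ≤ ENNReal.ofReal _ * _
  rw [← ENNReal.ofReal_mul (by positivity)]
  refine gsNorm_le hh (by positivity) fun k n y => ?_
  have hsh : ∀ t ∈ Set.Icc (0 : ℝ) 1, ‖y‖ ^ k * ‖iteratedFDeriv ℝ (n + 1) f.1 (y - t • x)‖ ≤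
      B * ((h / 2) ^ (k + (n + 1)) * (k.factorial * (n + 1).factorial)) := by
    intro t ht
    have e : iteratedFDeriv ℝ (n + 1) (shift f (t • x)).1 y =
        iteratedFDeriv ℝ (n + 1) f.1 (y - t • x) :=
      iteratedFDeriv_comp_sub (f := f.1) (n + 1) (t • x) y
    rw [← e]
    refine (gsNorm_le_iff hh2 _ hB0).1 ?_ k (n + 1) y
    refine (gsNorm_shift_le hh2 f _).trans ?_
    rw [← ENNReal.ofReal_toReal (gsNorm_ne_top hh4 f), ← ENNReal.ofReal_mul (by positivity)]
    refine ENNReal.ofReal_le_ofReal ?_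
    rw [hB]
    gcongr
    rw [norm_smul, Real.norm_of_nonneg ht.1]
    exact mul_le_one₀ ht.2 (norm_nonneg _) hx
  have hsub : iteratedFDeriv ℝ n (shift f x - f).1 y =
      iteratedFDeriv ℝ n f.1 (y - x) - iteratedFDeriv ℝ n f.1 y := by
    have := iteratedFDeriv_sub_apply (i := n) (contDiffAt (shift f x) n y) (contDiffAt f n y)
    rw [Submodule.coe_sub, this]
    congr 1
    exact iteratedFDeriv_comp_sub (f := f.1) n x y
  set D := B * ((h / 2) ^ (k + (n + 1)) * (k.factorial * (n + 1).factorial)) with hD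
  have hdiff : ∀ z, HasFDerivAt (iteratedFDeriv ℝ n f.1) (fderiv ℝ (iteratedFDeriv ℝ n f.1) z) z :=
    fun z => ((f.2.1.differentiable_iteratedFDeriv (m := n) (mod_cast (WithTop.coe_lt_top _))) z).hasFDerivAt
  have hmv : ‖y‖ ^ k * ‖iteratedFDeriv ℝ n f.1 (y - x) - iteratedFDeriv ℝ n f.1 y‖ ≤ D * ‖x‖ := by
    have hpath : ∀ t ∈ Set.Icc (0 : ℝ) 1, HasDerivWithinAt
        (fun t : ℝ => (‖y‖ ^ k : ℝ) • iteratedFDeriv ℝ n f.1 (y - t • x))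
        ((‖y‖ ^ k : ℝ) • (fderiv ℝ (iteratedFDeriv ℝ n f.1) (y - t • x)) (-x)) (Set.Icc 0 1) t := by
      intro t _
      have h1 : HasDerivAt (fun t : ℝ => y - t • x) (-x) t := by
        simpa using ((hasDerivAt_id t).smul_const x).const_sub y
      exact (((hdiff (y - t • x)).comp_hasDerivAt t h1).const_smul (‖y‖ ^ k)).hasDerivWithinAt
    have hbd : ∀ t ∈ Set.Ico (0 : ℝ) 1,
        ‖(‖y‖ ^ k : ℝ) • (fderiv ℝ (iteratedFDeriv ℝ n f.1) (y - t • x)) (-x)‖ ≤ D * ‖x‖ := by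
      intro t ht
      rw [norm_smul, Real.norm_of_nonneg (by positivity)]
      calc _ ≤ ‖y‖ ^ k * (‖iteratedFDeriv ℝ (n + 1) f.1 (y - t • x)‖ * ‖x‖) := by
            gcongr
            refine (ContinuousLinearMap.le_opNorm _ _).trans ?_
            rw [norm_fderiv_iteratedFDeriv, norm_neg]
        _ ≤ _ := by
            rw [← mul_assoc]
            gcongr
            exact hsh t (Set.Ico_subset_Icc_self ht)
    have := norm_image_sub_le_of_norm_deriv_le_segment_01' hpath hbd
    simp only [one_smul, zero_smul, sub_zero] at this
    rwa [← smul_sub, norm_smul, Real.norm_of_nonneg (by positivity)] at this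
  rw [hsub]
  refine hmv.trans ?_
  rw [hD]
  calc B * ((h / 2) ^ (k + (n + 1)) * (k.factorial * (n + 1).factorial)) * ‖x‖
      = h / 2 * B * ‖x‖ * ((((n : ℝ) + 1) * (h / 2) ^ (k + n)) * (k.factorial * n.factorial)) := by
        rw [Nat.factorial_succ, ← add_assoc, pow_succ]
        push_cast
        ring
    _ ≤ h / 2 * B * ‖x‖ * ((2 ^ (k + n) * (h / 2) ^ (k + n)) * (k.factorial * n.factorial)) := by
        gcongr
        exact (add_one_le_two_pow n).trans (pow_le_pow_right₀ one_le_two (by omega))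
    _ = _ := by rw [← mul_pow, mul_div_cancel₀ h two_ne_zero]

/-- For i = 0 this is |e^{is} - 1| ≤ |s|; for i ≥ 1 the constant drops out and ‖ξ‖^i ≤ ‖ξ‖. -/
theorem norm_iteratedFDeriv_character_sub_one_le {ξ : Rd d} (hξ : ‖ξ‖ ≤ 1) (i : ℕ) (y : Rd d) :
    ‖iteratedFDeriv ℝ i (fun y : Rd d => Complex.exp (-((inner ℝ ξ y : ℝ) * Complex.I)) - 1) y‖ ≤
      ‖ξ‖ * (1 + ‖y‖) := by
  rcases Nat.eq_zero_or_pos i with rfl | hi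
  · rw [norm_iteratedFDeriv_zero]
    have h1 := Real.norm_exp_I_mul_ofReal_sub_one_le (x := -(inner ℝ ξ y : ℝ))
    rw [Complex.ofReal_neg, mul_neg, mul_comm] at h1
    refine h1.trans ?_
    rw [norm_neg]
    refine (norm_inner_le_norm ξ y).trans ?_
    gcongr
    linarith
  · have h1 : iteratedFDeriv ℝ i
        (fun y : Rd d => Complex.exp (-((inner ℝ ξ y : ℝ) * Complex.I)) - 1) y =
        iteratedFDeriv ℝ i (fun y : Rd d => Complex.exp (-((inner ℝ ξ y : ℝ) * Complex.I))) y := by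
      have := iteratedFDeriv_sub_apply (i := i) (x := y)
        ((contDiff_character ξ).of_le (mod_cast le_top)).contDiffAt
        (contDiff_const (𝕜 := ℝ) (E := Rd d) (c := (1 : ℂ))).contDiffAt
      rw [iteratedFDeriv_const_of_ne (by omega), Pi.zero_apply, sub_zero] at this
      exact this
    rw [h1]
    refine (norm_iteratedFDeriv_character_le ξ i y).trans ?_
    calc ‖ξ‖ ^ i ≤ ‖ξ‖ ^ 1 := pow_le_pow_of_le_one (norm_nonneg _) hξ hi
      _ ≤ _ := by
        rw [pow_one]
        exact le_mul_of_one_le_right (norm_nonneg _) (by linarith [norm_nonneg y])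

theorem exists_gsNorm_modul_sub_le (hh : 0 < h) (f : GSSpace d) :
    ∃ C : ℝ≥0, ∀ ξ : Rd d, ‖ξ‖ ≤ 1 → gsNorm h (modul f ξ - f).1 ≤ C * ENNReal.ofReal ‖ξ‖ := by
  have hh2 := half_pos hh
  have hh4 := half_pos hh2
  set r := h / 2 / 2 with hr
  set A := (gsNorm r f.1).toReal
  have hA : 0 ≤ A := ENNReal.toReal_nonneg
  set b := Real.exp (1 / r)
  refine ⟨((1 + r) * A * b).toNNReal, fun ξ hξ => ?_⟩
  change _ ≤ ENNReal.ofReal _ * _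
  rw [← ENNReal.ofReal_mul (by positivity)]
  refine gsNorm_le hh (by positivity) fun k n y => ?_
  have e : (modul f ξ - f).1 = fun y => f.1 y *
      (Complex.exp (-((inner ℝ ξ y : ℝ) * Complex.I)) - 1) := by
    funext y
    simp only [Submodule.coe_sub, Pi.sub_apply, modul]
    ring
  have hsm := (contDiff_character ξ).sub (contDiff_const (c := (1 : ℂ)))
  have key := norm_iteratedFDeriv_mul_le f.2.1 hsm y (n := n) (mod_cast le_top)
  rw [e]
  -- The factor ‖y‖ raises k by one; the resulting k + 1 ≤ 2^k is why (2r)^k appears in place of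
  -- r^k.
  have hterm : ∀ i ≤ n, ‖y‖ ^ k * (‖iteratedFDeriv ℝ i f.1 y‖ * (1 + ‖y‖)) ≤
      (1 + r) * A * ((2 * r) ^ k * r ^ i * (k.factorial * i.factorial)) := by
    intro i _
    have h1 := pow_mul_norm_iteratedFDeriv_le hh4 f k i y
    have h2 := pow_mul_norm_iteratedFDeriv_le hh4 f (k + 1) i y
    have hk : (1 : ℝ) ≤ 2 ^ k := one_le_pow₀ one_le_two
    calc ‖y‖ ^ k * (‖iteratedFDeriv ℝ i f.1 y‖ * (1 + ‖y‖))
        = ‖y‖ ^ k * ‖iteratedFDeriv ℝ i f.1 y‖ + ‖y‖ ^ (k + 1) * ‖iteratedFDeriv ℝ i f.1 y‖ := by ring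
      _ ≤ A * (r ^ (k + i) * (k.factorial * i.factorial)) +
          A * (r ^ (k + 1 + i) * ((k + 1).factorial * i.factorial)) := add_le_add h1 h2
      _ = A * r ^ (k + i) * (k.factorial * i.factorial) * (1 + r * (k + 1)) := by
          rw [Nat.factorial_succ]
          push_cast
          ring
      _ ≤ A * r ^ (k + i) * (k.factorial * i.factorial) * (2 ^ k + r * 2 ^ k) := by
          gcongr
          exact add_one_le_two_pow k
      _ = _ := by ring_nf
  calc _ ≤ ‖y‖ ^ k * ∑ i ∈ Finset.range (n + 1), (n.choose i : ℝ) *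
          ‖iteratedFDeriv ℝ i f.1 y‖ * ‖iteratedFDeriv ℝ (n - i)
            (fun y : Rd d => Complex.exp (-((inner ℝ ξ y : ℝ) * Complex.I)) - 1) y‖ := by
        exact mul_le_mul_of_nonneg_left key (by positivity)
    _ ≤ ‖y‖ ^ k * ∑ i ∈ Finset.range (n + 1), (n.choose i : ℝ) *
          ‖iteratedFDeriv ℝ i f.1 y‖ * (‖ξ‖ * (1 + ‖y‖)) := by
        gcongr with i hi
        exact norm_iteratedFDeriv_character_sub_one_le hξ _ y
    _ = ∑ i ∈ Finset.range (n + 1), ‖ξ‖ * (n.choose i : ℝ) *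
          (‖y‖ ^ k * (‖iteratedFDeriv ℝ i f.1 y‖ * (1 + ‖y‖))) := by
        rw [Finset.mul_sum]; exact Finset.sum_congr rfl fun i _ => by ring
    _ ≤ ∑ i ∈ Finset.range (n + 1), (1 + r) * A * b * ‖ξ‖ *
          ((2 * r) ^ k * r ^ n * (k.factorial * n.factorial)) := by
        refine Finset.sum_le_sum fun i hi => ?_
        have hi' : i ≤ n := Nat.lt_succ_iff.1 (Finset.mem_range.1 hi)
        -- The derivatives of the character supply no power of r or factorial, so both are inserted
        -- at the cost of exp(1/r).
        have h1 : (1 : ℝ) ≤ b * (r ^ (n - i) * (n - i).factorial) := by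
          have := pow_le_exp_mul_factorial hh4 zero_le_one (n - i)
          rwa [one_pow] at this
        calc _ ≤ ‖ξ‖ * (n.choose i : ℝ) *
                ((1 + r) * A * ((2 * r) ^ k * r ^ i * (k.factorial * i.factorial))) * 1 := by
              rw [mul_one]
              exact mul_le_mul_of_nonneg_left (hterm i hi') (by positivity)
          _ ≤ ‖ξ‖ * (n.choose i : ℝ) *
                ((1 + r) * A * ((2 * r) ^ k * r ^ i * (k.factorial * i.factorial))) *
                (b * (r ^ (n - i) * (n - i).factorial)) := by gcongr
          _ = (1 + r) * A * b * ‖ξ‖ * ((2 * r) ^ k * (r ^ i * r ^ (n - i)) * (k.factorial *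
                ((n.choose i : ℝ) * (i.factorial * (n - i).factorial)))) := by ring
          _ = _ := by rw [choose_mul_factorials hi', ← pow_add, Nat.add_sub_cancel' hi']
    _ = (1 + r) * A * b * ‖ξ‖ * ((2 * r) ^ k * (((n : ℝ) + 1) * r ^ n) *
          (k.factorial * n.factorial)) := by
        rw [Finset.sum_const, Finset.card_range, nsmul_eq_mul]; push_cast; ring
    _ ≤ (1 + r) * A * b * ‖ξ‖ * (h ^ k * (2 ^ n * r ^ n) * (k.factorial * n.factorial)) := by
        gcongr
        · rw [hr]; linarith
        · exact add_one_le_two_pow n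
    _ ≤ (1 + r) * A * b * ‖ξ‖ * (h ^ k * h ^ n * (k.factorial * n.factorial)) := by
        rw [← mul_pow]
        gcongr
        rw [hr]; linarith
    _ = _ := by rw [pow_add]

end GSSpace

end gsNorm

/-! ### Growth and continuity of time-frequency shifts in Σ₁ -/

namespace GSSpace

variable {d : ℕ} {h : ℝ}

theorem exists_gsNorm_atom_le (hh : 0 < h) (f : GSSpace d) :
    ∃ (m : ℝ) (A : ℝ≥0), 0 ≤ m ∧ ∀ w : Rd d × Rd d, gsNorm h (atom f w.1 w.2).1 ≤ A * wexp m w := by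
  have hh2 := half_pos hh
  have hh4 := half_pos hh2
  set N := (gsNorm (h / 2 / 2) f.1).toReal with hN
  refine ⟨1 / (h / 2) + 1 / (h / 2 / 2), (2 * N).toNNReal, by positivity, fun w => ?_⟩
  have e : gsNorm (h / 2 / 2) (conj f).1 = ENNReal.ofReal N := by
    rw [gsNorm_conj, hN, ENNReal.ofReal_toReal (gsNorm_ne_top hh4 f)]
  have hN0 : 0 ≤ N := ENNReal.toReal_nonneg
  rw [atom_eq]
  calc _ ≤ ENNReal.ofReal (Real.exp (‖w.2‖ / (h / 2))) *
        (ENNReal.ofReal (2 * Real.exp (‖w.1‖ / (h / 2 / 2))) * gsNorm (h / 2 / 2) (conj f).1) :=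
        (gsNorm_modul_le hh _ _).trans (by gcongr; exact gsNorm_shift_le hh2 _ _)
    _ ≤ ENNReal.ofReal (Real.exp (1 / (h / 2) * ‖w‖)) *
        (ENNReal.ofReal (2 * Real.exp (1 / (h / 2 / 2) * ‖w‖)) * ENNReal.ofReal N) := by
        rw [e]
        have h1 : ‖w.1‖ ≤ ‖w‖ := norm_fst_le w
        have h2 : ‖w.2‖ ≤ ‖w‖ := norm_snd_le w
        gcongr
        · rw [div_eq_inv_mul, one_div]; gcongr
        · rw [div_eq_inv_mul _ (h / 2 / 2), one_div]; gcongr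
    _ = _ := by
        change _ = ENNReal.ofReal _ * ENNReal.ofReal _
        rw [← ENNReal.ofReal_mul (by positivity), ← ENNReal.ofReal_mul (by positivity),
          ← ENNReal.ofReal_mul (by positivity), add_mul, Real.exp_add]
        ring_nf

theorem exists_gsNorm_atom_sub_le (hh : 0 < h) (f : GSSpace d) (w : Rd d × Rd d) :
    ∃ D : ℝ≥0, ∀ w' : Rd d × Rd d, ‖w' - w‖ ≤ 1 →
      gsNorm h (atom f w'.1 w'.2 - atom f w.1 w.2).1 ≤ D * ENNReal.ofReal ‖w' - w‖ := by
  have hh2 := half_pos hh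
  have hh4 := half_pos hh2
  obtain ⟨C₁, hC₁⟩ := exists_gsNorm_shift_sub_le hh4 (conj f)
  obtain ⟨C₂, hC₂⟩ := exists_gsNorm_modul_sub_le hh2 (shift (conj f) w.1)
  refine ⟨(Real.exp ((‖w.2‖ + 1) / (h / 2))).toNNReal *
    ((2 * Real.exp (‖w.1‖ / (h / 2 / 2))).toNNReal * C₁) +
    (Real.exp (‖w.2‖ / (h / 2))).toNNReal * C₂, fun w' hw' => ?_⟩
  have h1 : ‖w'.1 - w.1‖ ≤ ‖w' - w‖ := norm_fst_le (w' - w)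
  have h2 : ‖w'.2 - w.2‖ ≤ ‖w' - w‖ := norm_snd_le (w' - w)
  set g := conj f
  -- Position is changed first and frequency second, so each summand contains a difference with a
  -- small shift or a small modulation.
  have e : atom f w'.1 w'.2 - atom f w.1 w.2 =
      modul (shift (shift g (w'.1 - w.1) - g) w.1) w'.2 +
        modul (modul (shift g w.1) (w'.2 - w.2) - shift g w.1) w.2 := by
    ext y
    simp only [atom_eq, modul, shift, Submodule.coe_sub, Submodule.coe_add, Pi.add_apply,
      Pi.sub_apply]
    rw [show y - w.1 - (w'.1 - w.1) = y - w'.1 by abel,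
      show g.1 (y - w.1) * Complex.exp (-((inner ℝ (w'.2 - w.2) y : ℝ) * Complex.I)) =
        g.1 (y - w.1) * (Complex.exp (-((inner ℝ w'.2 y : ℝ) * Complex.I)) *
          Complex.exp ((inner ℝ w.2 y : ℝ) * Complex.I)) by
        rw [← Complex.exp_add, inner_sub_left]; congr 2; push_cast; ring]
    have h3 : Complex.exp ((inner ℝ w.2 y : ℝ) * Complex.I) *
        Complex.exp (-((inner ℝ w.2 y : ℝ) * Complex.I)) = 1 := by
      rw [← Complex.exp_add, add_neg_cancel, Complex.exp_zero]
    linear_combination -(g.1 (y - w.1) *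
      Complex.exp (-((inner ℝ w'.2 y : ℝ) * Complex.I))) * h3
  rw [e]
  refine (gsNorm_add_le hh _ _).trans ?_
  rw [ENNReal.coe_add, add_mul]
  have hw2 : ‖w'.2‖ ≤ ‖w.2‖ + 1 := by
    calc ‖w'.2‖ = ‖w.2 + (w'.2 - w.2)‖ := by rw [add_sub_cancel]
      _ ≤ _ := (norm_add_le _ _).trans (by linarith)
  gcongr
  · calc _ ≤ ENNReal.ofReal (Real.exp (‖w'.2‖ / (h / 2))) *
          (ENNReal.ofReal (2 * Real.exp (‖w.1‖ / (h / 2 / 2))) *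
            gsNorm (h / 2 / 2) (shift g (w'.1 - w.1) - g).1) :=
          (gsNorm_modul_le hh _ _).trans (by gcongr; exact gsNorm_shift_le hh2 _ _)
      _ ≤ ENNReal.ofReal (Real.exp ((‖w.2‖ + 1) / (h / 2))) *
          (ENNReal.ofReal (2 * Real.exp (‖w.1‖ / (h / 2 / 2))) *
            (C₁ * ENNReal.ofReal ‖w' - w‖)) := by
          gcongr
          exact (hC₁ _ (h1.trans hw')).trans (by gcongr)
      _ = _ := by
          rw [ENNReal.coe_mul, ENNReal.coe_mul, mul_assoc, mul_assoc]
          rfl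
  · calc _ ≤ ENNReal.ofReal (Real.exp (‖w.2‖ / (h / 2))) * (C₂ * ENNReal.ofReal ‖w' - w‖) := by
          refine (gsNorm_modul_le hh _ _).trans ?_
          gcongr
          exact (hC₂ _ (h2.trans hw')).trans (by gcongr)
      _ = _ := by
          rw [ENNReal.coe_mul, mul_assoc]
          rfl

/-- Continuity of a family of elements of `Σ₁` with respect to all seminorms. -/
def ContinuousFamily {W : Type*} [TopologicalSpace W] (a : W → GSSpace d) : Prop :=
  ∀ h : ℝ, 0 < h → ∀ w, Tendsto (fun w' => gsNorm h (a w' - a w).1) (𝓝 w) (𝓝 0)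

theorem continuousFamily_atom (f : GSSpace d) :
    ContinuousFamily (fun w : Rd d × Rd d => atom f w.1 w.2) := by
  intro h hh w
  obtain ⟨D, hD⟩ := exists_gsNorm_atom_sub_le hh f w
  have h1 : Tendsto (fun w' : Rd d × Rd d => (D : ℝ≥0∞) * ENNReal.ofReal ‖w' - w‖) (𝓝 w) (𝓝 0) := by
    have : Continuous fun w' : Rd d × Rd d => (D : ℝ≥0∞) * ENNReal.ofReal ‖w' - w‖ :=
      (ENNReal.continuous_const_mul ENNReal.coe_ne_top).comp
        (ENNReal.continuous_ofReal.comp (by fun_prop))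
    simpa using this.tendsto w
  refine tendsto_of_tendsto_of_tendsto_of_le_of_le' tendsto_const_nhds h1
    (Eventually.of_forall fun _ => zero_le) ?_
  filter_upwards [Metric.ball_mem_nhds w one_pos] with w' hw'
  exact hD w' (by rw [← dist_eq_norm]; exact (Metric.mem_ball.1 hw').le)

theorem ContinuousFamily.comp {W W' : Type*} [TopologicalSpace W] [TopologicalSpace W']
    {a : W → GSSpace d} (ha : ContinuousFamily a) {φ : W' → W} (hφ : Continuous φ) :
    ContinuousFamily (fun w => a (φ w)) :=
  fun h hh w => (ha h hh (φ w)).comp (hφ.tendsto w)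

theorem ContinuousFamily.continuous_apply {W : Type*} [TopologicalSpace W]
    {a : W → GSSpace d} (ha : ContinuousFamily a) (u : GSDual d) : Continuous fun w => u.1 (a w) := by
  obtain ⟨h, hh, C, hu⟩ := u.2
  refine continuous_iff_continuousAt.2 fun w => ?_
  rw [ContinuousAt, tendsto_iff_edist_tendsto_0]
  have h1 : Tendsto (fun w' => (C : ℝ≥0∞) * gsNorm h (a w' - a w).1) (𝓝 w) (𝓝 0) := by
    simpa using ENNReal.Tendsto.const_mul (ha h hh w) (.inr ENNReal.coe_ne_top)
  refine tendsto_of_tendsto_of_tendsto_of_le_of_le tendsto_const_nhds h1 (fun _ => zero_le)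
    fun w' => ?_
  simp only
  rw [edist_eq_enorm_sub, ← map_sub]
  exact hu _

/-! ### Superpositions of elements of `Σ₁` -/

/-- The Banach space of bounded families of multilinear forms in which `Σ₁` with the seminorm
`gsNorm h` embeds isometrically. -/
abbrev JetSpace (d : ℕ) : Type :=
  lp (fun i : ℕ × ℕ × Rd d => ContinuousMultilinearMap ℝ (fun _ : Fin i.2.1 => Rd d) ℂ) ∞

/-- The weighted derivatives of an element of `Σ₁`. -/
noncomputable def jetFun (h : ℝ) (f : GSSpace d) (i : ℕ × ℕ × Rd d) :
    ContinuousMultilinearMap ℝ (fun _ : Fin i.2.1 => Rd d) ℂ :=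
  ((‖i.2.2‖ ^ i.1 / (h ^ (i.1 + i.2.1) * (i.1.factorial * i.2.1.factorial)) : ℝ) : ℂ) •
    iteratedFDeriv ℝ i.2.1 f.1 i.2.2

theorem norm_jetFun (hh : 0 < h) (f : GSSpace d) (i : ℕ × ℕ × Rd d) :
    ‖jetFun h f i‖ = ‖i.2.2‖ ^ i.1 * ‖iteratedFDeriv ℝ i.2.1 f.1 i.2.2‖ /
      (h ^ (i.1 + i.2.1) * (i.1.factorial * i.2.1.factorial)) := by
  rw [jetFun, norm_smul, Complex.norm_real, Real.norm_of_nonneg (by positivity)]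
  ring

theorem norm_jetFun_le (hh : 0 < h) (f : GSSpace d) (i : ℕ × ℕ × Rd d) :
    ‖jetFun h f i‖ ≤ (gsNorm h f.1).toReal := by
  rw [norm_jetFun hh, div_le_iff₀ (by positivity)]
  exact pow_mul_norm_iteratedFDeriv_le hh f _ _ _

/-- The embedding of `Σ₁` in the space of jets. -/
noncomputable def jet (hh : 0 < h) : GSSpace d →ₗ[ℂ] JetSpace d where
  toFun f := ⟨jetFun h f, memℓp_infty ⟨_, Set.forall_mem_range.2 (norm_jetFun_le hh f)⟩⟩
  map_add' f g := by
    ext1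
    funext i
    change jetFun h (f + g) i = jetFun h f i + jetFun h g i
    rw [jetFun, Submodule.coe_add, iteratedFDeriv_add_apply (contDiffAt f _ _) (contDiffAt g _ _),
      smul_add]
    rfl
  map_smul' c f := by
    ext1
    funext i
    change jetFun h (c • f) i = c • jetFun h f i
    rw [jetFun, Submodule.coe_smul, iteratedFDeriv_const_smul_apply (contDiffAt f _ _),
      smul_comm]
    rfl

theorem norm_jet (hh : 0 < h) (f : GSSpace d) : ‖jet hh f‖ = (gsNorm h f.1).toReal := by
  refine le_antisymm (lp.norm_le_of_forall_le ENNReal.toReal_nonneg (norm_jetFun_le hh f)) ?_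
  refine ENNReal.toReal_le_of_le_ofReal (norm_nonneg _) (gsNorm_le hh (norm_nonneg _) ?_)
  intro k n x
  have := lp.norm_apply_le_norm ENNReal.top_ne_zero (jet hh f) (k, n, x)
  change ‖jetFun h f (k, n, x)‖ ≤ _ at this
  rwa [norm_jetFun hh, div_le_iff₀ (by positivity)] at this

theorem enorm_jet (hh : 0 < h) (f : GSSpace d) : ‖jet hh f‖ₑ = gsNorm h f.1 := by
  rw [← ofReal_norm, norm_jet, ENNReal.ofReal_toReal (gsNorm_ne_top hh f)]

theorem ContinuousFamily.continuous_jet {W : Type*} [TopologicalSpace W] {a : W → GSSpace d}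
    (ha : ContinuousFamily a) (hh : 0 < h) : Continuous fun w => jet hh (a w) := by
  refine continuous_iff_continuousAt.2 fun w => ?_
  rw [ContinuousAt, tendsto_iff_edist_tendsto_0]
  simp_rw [edist_eq_enorm_sub, ← map_sub, enorm_jet]
  exact ha h hh w

theorem ContinuousFamily.continuous_iteratedFDeriv {W : Type*} [TopologicalSpace W]
    {a : W → GSSpace d} (ha : ContinuousFamily a) (n : ℕ) (x : Rd d) :
    Continuous fun w => iteratedFDeriv ℝ n (a w).1 x := by
  -- For h = 1 and k = 0 the jet coordinate is the n-th derivative divided by n!.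
  have h1 := (lp.evalCLM ℂ (fun i : ℕ × ℕ × Rd d =>
    ContinuousMultilinearMap ℝ (fun _ : Fin i.2.1 => Rd d) ℂ) ∞ (0, n, x)).continuous.comp
      (ha.continuous_jet one_pos)
  have h2 := h1.const_smul (n.factorial : ℂ)
  refine h2.congr fun w => ?_
  change (n.factorial : ℂ) • jetFun 1 (a w) (0, n, x) = _
  rw [jetFun, smul_smul]
  have : (n.factorial : ℂ) ≠ 0 := by exact_mod_cast n.factorial_ne_zero
  simp [this]

end GSSpace

/-! ### Differentiation and evaluation of functionals under the integral sign -/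

namespace GSSpace

variable {d : ℕ} {h : ℝ}

theorem integral_curryLeft {W : Type*} [MeasurableSpace W] {μ : Measure W} {n : ℕ}
    {p : W → Rd d [×(n + 1)]→L[ℝ] ℂ} (hp : Integrable p μ) :
    ∫ w, (p w).curryLeft ∂μ = (∫ w, p w ∂μ).curryLeft := by
  let L : (Rd d [×(n + 1)]→L[ℝ] ℂ) →L[ℝ] (Rd d →L[ℝ] (Rd d [×n]→L[ℝ] ℂ)) :=
    (continuousMultilinearCurryLeftEquiv ℝ (fun _ : Fin (n + 1) => Rd d) ℂ
      ).toContinuousLinearEquiv.toContinuousLinearMap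
  exact ContinuousLinearMap.integral_comp_comm (𝕜 := ℝ) (E := Rd d [×(n + 1)]→L[ℝ] ℂ)
    (Fₗ := Rd d →L[ℝ] (Rd d [×n]→L[ℝ] ℂ)) L hp

section superposition

variable {W : Type*} [TopologicalSpace W] [SecondCountableTopology W]
  [MeasurableSpace W] [OpensMeasurableSpace W] {μ : Measure W} {a : W → GSSpace d} {c : W → ℂ}

theorem integrable_smul_jet (hh : 0 < h) (ha : ContinuousFamily a) (hc : AEStronglyMeasurable c μ)
    (hint : ∀ h : ℝ, 0 < h → ∫⁻ w, ‖c w‖ₑ * gsNorm h (a w).1 ∂μ < ∞) :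
    Integrable (fun w => c w • jet hh (a w)) μ := by
  refine ⟨hc.smul (ha.continuous_jet hh).aestronglyMeasurable, ?_⟩
  rw [HasFiniteIntegral]
  simp_rw [enorm_smul, enorm_jet]
  exact hint h hh

theorem integrable_norm_mul_gsNorm (hh : 0 < h) (ha : ContinuousFamily a)
    (hc : AEStronglyMeasurable c μ)
    (hint : ∀ h : ℝ, 0 < h → ∫⁻ w, ‖c w‖ₑ * gsNorm h (a w).1 ∂μ < ∞) :
    Integrable (fun w => ‖c w‖ * (gsNorm h (a w).1).toReal) μ := by
  have := (integrable_smul_jet hh ha hc hint).norm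
  simpa only [norm_smul, norm_jet] using this

theorem aestronglyMeasurable_smul_iteratedFDeriv (ha : ContinuousFamily a)
    (hc : AEStronglyMeasurable c μ) (n : ℕ) (y : Rd d) :
    AEStronglyMeasurable (fun w => c w • iteratedFDeriv ℝ n (a w).1 y) μ :=
  hc.smul (ha.continuous_iteratedFDeriv n y).aestronglyMeasurable

theorem norm_smul_iteratedFDeriv_le (z : ℂ) (f : GSSpace d) (n : ℕ) (y : Rd d) :
    ‖z • iteratedFDeriv ℝ n f.1 y‖ ≤ ‖z‖ * (gsNorm 1 f.1).toReal * n.factorial := by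
  rw [norm_smul, mul_assoc]
  gcongr
  simpa using norm_iteratedFDeriv_le one_pos f n y

theorem integrable_smul_iteratedFDeriv (ha : ContinuousFamily a) (hc : AEStronglyMeasurable c μ)
    (hint : ∀ h : ℝ, 0 < h → ∫⁻ w, ‖c w‖ₑ * gsNorm h (a w).1 ∂μ < ∞) (n : ℕ) (y : Rd d) :
    Integrable (fun w => c w • iteratedFDeriv ℝ n (a w).1 y) μ :=
  ((integrable_norm_mul_gsNorm one_pos ha hc hint).mul_const (n.factorial : ℝ)).mono'
    (aestronglyMeasurable_smul_iteratedFDeriv ha hc n y)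
    (Eventually.of_forall fun w => norm_smul_iteratedFDeriv_le (c w) (a w) n y)

/-- The seminorm with h = 1 bounds the derivative of order n + 1 uniformly in y, which provides the
integrable majorant. -/
theorem hasFDerivAt_integral_iteratedFDeriv (ha : ContinuousFamily a)
    (hc : AEStronglyMeasurable c μ)
    (hint : ∀ h : ℝ, 0 < h → ∫⁻ w, ‖c w‖ₑ * gsNorm h (a w).1 ∂μ < ∞) (n : ℕ) (y : Rd d) :
    HasFDerivAt (fun y => ∫ w, c w • iteratedFDeriv ℝ n (a w).1 y ∂μ)
      (∫ w, c w • iteratedFDeriv ℝ (n + 1) (a w).1 y ∂μ).curryLeft y := by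
  rw [← integral_curryLeft (integrable_smul_iteratedFDeriv ha hc hint (n + 1) y)]
  refine hasFDerivAt_integral_of_dominated_of_fderiv_le (s := Set.univ)
    (F := fun y w => c w • iteratedFDeriv ℝ n (a w).1 y)
    (F' := fun y w => (c w • iteratedFDeriv ℝ (n + 1) (a w).1 y).curryLeft)
    (bound := fun w => ‖c w‖ * (gsNorm 1 (a w).1).toReal * (n + 1).factorial)
    univ_mem (Eventually.of_forall fun y => aestronglyMeasurable_smul_iteratedFDeriv ha hc n y)
    (integrable_smul_iteratedFDeriv ha hc hint n y) ?_ ?_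
    ((integrable_norm_mul_gsNorm one_pos ha hc hint).mul_const _) ?_
  · exact (continuousMultilinearCurryLeftEquiv ℝ (fun _ : Fin (n + 1) => Rd d) ℂ
      ).continuous.comp_aestronglyMeasurable
        (aestronglyMeasurable_smul_iteratedFDeriv ha hc (n + 1) y)
  · refine Eventually.of_forall fun w z _ => ?_
    rw [ContinuousMultilinearMap.curryLeft_norm]
    exact norm_smul_iteratedFDeriv_le _ _ (n + 1) z
  · refine Eventually.of_forall fun w z _ => ?_
    have h1 : HasFDerivAt (iteratedFDeriv ℝ n (a w).1)
        (fderiv ℝ (iteratedFDeriv ℝ n (a w).1) z) z :=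
      (((a w).2.1.differentiable_iteratedFDeriv (m := n)
        (mod_cast (WithTop.coe_lt_top _))) z).hasFDerivAt
    rw [fderiv_iteratedFDeriv] at h1
    exact h1.const_smul (c w)

theorem hasFTaylorSeriesUpTo_integral (ha : ContinuousFamily a) (hc : AEStronglyMeasurable c μ)
    (hint : ∀ h : ℝ, 0 < h → ∫⁻ w, ‖c w‖ₑ * gsNorm h (a w).1 ∂μ < ∞) :
    HasFTaylorSeriesUpTo ((⊤ : ℕ∞) : WithTop ℕ∞) (fun y => ∫ w, c w * (a w).1 y ∂μ)
      (fun y n => ∫ w, c w • iteratedFDeriv ℝ n (a w).1 y ∂μ) := by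
  have hfd := hasFDerivAt_integral_iteratedFDeriv ha hc hint
  refine ⟨fun y => ?_, fun n _ y => hfd n y,
    fun n _ => continuous_iff_continuousAt.2 fun y => (hfd n y).continuousAt⟩
  have hL := (continuousMultilinearCurryFin0 ℝ (Rd d) ℂ
    ).toContinuousLinearEquiv.toContinuousLinearMap.integral_comp_comm
      (integrable_smul_iteratedFDeriv ha hc hint 0 y)
  refine hL.symm.trans (integral_congr_ae (Eventually.of_forall fun w => ?_))
  simp

theorem integral_mem (ha : ContinuousFamily a) (hc : AEStronglyMeasurable c μ)
    (hint : ∀ h : ℝ, 0 < h → ∫⁻ w, ‖c w‖ₑ * gsNorm h (a w).1 ∂μ < ∞) :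
    (fun y => ∫ w, c w * (a w).1 y ∂μ) ∈ GSSpace d := by
  have hT := hasFTaylorSeriesUpTo_integral ha hc hint
  refine ⟨hT.contDiff, fun h hh => ?_⟩
  have hn := integrable_norm_mul_gsNorm hh ha hc hint
  refine (gsNorm_le hh (A := ∫ w, ‖c w‖ * (gsNorm h (a w).1).toReal ∂μ)
    (integral_nonneg fun w => by positivity) fun k n x => ?_).trans_lt ENNReal.ofReal_lt_top
  rw [← hT.eq_iteratedFDeriv (m := n) (mod_cast le_top) x]
  calc ‖x‖ ^ k * ‖∫ w, c w • iteratedFDeriv ℝ n (a w).1 x ∂μ‖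
      ≤ ‖x‖ ^ k * ∫ w, ‖c w • iteratedFDeriv ℝ n (a w).1 x‖ ∂μ := by
        gcongr
        exact norm_integral_le_integral_norm _
    _ = ∫ w, ‖x‖ ^ k * ‖c w • iteratedFDeriv ℝ n (a w).1 x‖ ∂μ := (integral_const_mul _ _).symm
    _ ≤ ∫ w, ‖c w‖ * (gsNorm h (a w).1).toReal * (h ^ (k + n) * (k.factorial * n.factorial)) ∂μ := by
        refine integral_mono ((integrable_smul_iteratedFDeriv ha hc hint n x).norm.const_mul _)
          (hn.mul_const _) fun w => ?_
        simp only
        rw [norm_smul, mul_left_comm, mul_assoc]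
        exact mul_le_mul_of_nonneg_left (pow_mul_norm_iteratedFDeriv_le hh (a w) k n x)
          (norm_nonneg _)
    _ = _ := integral_mul_const _ _

/-- Identifies the pointwise integral with a Bochner integral in the jet space, coordinate by
coordinate; bounded functionals commute with the latter. -/
theorem jet_integral (hh : 0 < h) (ha : ContinuousFamily a) (hc : AEStronglyMeasurable c μ)
    (hint : ∀ h : ℝ, 0 < h → ∫⁻ w, ‖c w‖ₑ * gsNorm h (a w).1 ∂μ < ∞) :
    jet hh ⟨_, integral_mem ha hc hint⟩ = ∫ w, c w • jet hh (a w) ∂μ := by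
  ext1
  funext i
  have h1 := (lp.evalCLM ℂ (fun i : ℕ × ℕ × Rd d =>
    ContinuousMultilinearMap ℝ (fun _ : Fin i.2.1 => Rd d) ℂ) ∞ i).integral_comp_comm
      (integrable_smul_jet hh ha hc hint)
  refine Eq.trans ?_ h1
  change jetFun h ⟨_, integral_mem ha hc hint⟩ i = ∫ w, c w • jetFun h (a w) i ∂μ
  simp_rw [jetFun, smul_comm (c _)]
  rw [integral_smul, ← (hasFTaylorSeriesUpTo_integral ha hc hint).eq_iteratedFDeriv
    (m := i.2.1) (mod_cast le_top) i.2.2]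

end superposition

theorem jet_injective (hh : 0 < h) : Function.Injective (jet (d := d) hh) := by
  rw [← LinearMap.ker_eq_bot, LinearMap.ker_eq_bot']
  intro f hf
  have h2 := norm_jet hh f
  rw [hf, norm_zero] at h2
  ext y
  have h3 := norm_iteratedFDeriv_le hh f 0 y
  rw [← h2, zero_mul, norm_iteratedFDeriv_zero] at h3
  simpa using h3

/-- An element of Σ₁' is bounded by a single seminorm, hence is a bounded functional on the image of
Σ₁ in the corresponding jet space; Hahn-Banach extends it. -/
theorem exists_clm_jet_eq (u : GSDual d) :
    ∃ (h : ℝ) (hh : 0 < h) (L : JetSpace d →L[ℂ] ℂ), ∀ f, L (jet hh f) = u.1 f := by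
  obtain ⟨h, hh, C, hu⟩ := u.2
  set eJ := LinearEquiv.ofInjective (jet (d := d) hh) (jet_injective hh)
  set L₀ : LinearMap.range (jet (d := d) hh) →ₗ[ℂ] ℂ := u.1 ∘ₗ eJ.symm.toLinearMap
  have hL₀ : ∀ f, L₀ (eJ f) = u.1 f := fun f => by simp [L₀]
  have hL₀b : ∀ v, ‖L₀ v‖ ≤ C * ‖v‖ := fun v => by
    obtain ⟨f, rfl⟩ := eJ.surjective v
    rw [hL₀]
    have h2 : ‖eJ f‖ = (gsNorm h f.1).toReal := norm_jet hh f
    have h3 := ENNReal.toReal_mono (ENNReal.mul_ne_top ENNReal.coe_ne_top (gsNorm_ne_top hh f)) (hu f)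
    rw [toReal_enorm, ENNReal.toReal_mul, ENNReal.coe_toReal] at h3
    rw [h2]
    exact h3
  obtain ⟨L, hL, -⟩ := exists_extension_norm_eq (LinearMap.range (jet (d := d) hh))
    (L₀.mkContinuous C hL₀b)
  exact ⟨h, hh, L, fun f => (hL (eJ f)).trans (hL₀ f)⟩

/-- Superpositions of elements of `Σ₁` belong to `Σ₁`, and the elements of `Σ₁'` can be applied
under the integral sign. -/
theorem exists_integral {W : Type*} [TopologicalSpace W] [SecondCountableTopology W]
    [MeasurableSpace W] [OpensMeasurableSpace W] {μ : Measure W} {a : W → GSSpace d}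
    (ha : ContinuousFamily a) {c : W → ℂ} (hc : AEStronglyMeasurable c μ)
    (hint : ∀ h : ℝ, 0 < h → ∫⁻ w, ‖c w‖ₑ * gsNorm h (a w).1 ∂μ < ∞) :
    ∃ g : GSSpace d, (∀ y, g.1 y = ∫ w, c w * (a w).1 y ∂μ) ∧
      ∀ u : GSDual d, Integrable (fun w => c w * u.1 (a w)) μ ∧
        u.1 g = ∫ w, c w * u.1 (a w) ∂μ := by
  refine ⟨⟨_, integral_mem ha hc hint⟩, fun y => rfl, fun u => ?_⟩
  obtain ⟨h, hh, L, hLu⟩ := exists_clm_jet_eq u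
  have h4 := L.integral_comp_comm (integrable_smul_jet hh ha hc hint)
  have h5 := L.integrable_comp (integrable_smul_jet hh ha hc hint)
  simp only [map_smul, hLu, smul_eq_mul] at h4 h5
  exact ⟨h5, by rw [h4, ← jet_integral hh ha hc hint, hLu]⟩

end GSSpace

/-! ### Fourier integrals of elements of `Σ₁` -/

/-- Polynomial bounds with factorial constants sum to exponential decay: each term of the series for
exp(s/2) contributes at most 2^(-k) B. -/
theorem exp_half_mul_le {s a B : ℝ} (h : ∀ k : ℕ, s ^ k * a ≤ B * k.factorial) :
    Real.exp (s / 2) * a ≤ 2 * B := by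
  have h1 : HasSum (fun n : ℕ => (s / 2) ^ n / n.factorial * a) (Real.exp (s / 2) * a) := by
    rw [Real.exp_eq_exp_ℝ]
    exact (NormedSpace.expSeries_div_hasSum_exp (s / 2)).mul_right a
  have h2 : HasSum (fun n : ℕ => (1 / 2 : ℝ) ^ n * B) (2 * B) := hasSum_geometric_two.mul_right B
  refine hasSum_le (fun n => ?_) h1 h2
  have := h n
  rw [div_pow, div_mul_eq_mul_div, div_le_iff₀ (by positivity), one_div, inv_pow]
  calc s ^ n / 2 ^ n * a = (2 ^ n)⁻¹ * (s ^ n * a) := by ring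
    _ ≤ (2 ^ n)⁻¹ * (B * n.factorial) := by gcongr
    _ = _ := by ring

theorem integrable_exp_neg_mul_norm {V : Type*} [NormedAddCommGroup V] [NormedSpace ℝ V]
    [FiniteDimensional ℝ V] [MeasureSpace V] [BorelSpace V]
    [(volume : Measure V).IsAddHaarMeasure] {l : ℝ} (hl : 0 < l) :
    Integrable (fun y : V => Real.exp (-l * ‖y‖)) := by
  refine ⟨Continuous.aestronglyMeasurable (by fun_prop), ?_⟩
  rw [hasFiniteIntegral_iff_ofReal (Eventually.of_forall fun y => (Real.exp_pos _).le)]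
  exact lintegral_wexp_neg_lt_top hl

namespace GSSpace

variable {d : ℕ} {h : ℝ}

theorem toDual_apply (f g : GSSpace d) : (toDual f).1 g = ∫ x, f.1 x * g.1 x := rfl

theorem toDual_comm (f g : GSSpace d) : (toDual f).1 g = (toDual g).1 f := by
  simp_rw [toDual_apply, mul_comm]

theorem continuous (f : GSSpace d) : Continuous f.1 := f.2.1.continuous

/-- The Fourier integral `∫ f(t) exp (-i ⟨ξ, t⟩) dt`. -/
noncomputable def fourierInt (f : GSSpace d) (ξ : Rd d) : ℂ :=
  ∫ t, f.1 t * Complex.exp (-((inner ℝ ξ t : ℝ) * Complex.I))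

open FourierTransform in
theorem fourierInt_two_pi_smul (f : GSSpace d) (η : Rd d) :
    fourierInt f ((2 * Real.pi) • η) = 𝓕 f.1 η := by
  rw [Real.fourier_eq', fourierInt]
  refine integral_congr_ae (Eventually.of_forall fun t => ?_)
  simp only [smul_eq_mul]
  rw [mul_comm, real_inner_smul_left, real_inner_comm]
  congr 2
  push_cast
  ring

theorem integrable_iteratedFDeriv (f : GSSpace d) (n : ℕ) :
    Integrable (iteratedFDeriv ℝ n f.1) := by
  have h1 := (toSchwartz f).integrable_pow_mul_iteratedFDeriv volume 0 n
  simp only [pow_zero, one_mul] at h1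
  refine (integrable_norm_iff ?_).1 h1
  exact (f.2.1.continuous_iteratedFDeriv (m := n) (mod_cast le_top)).aestronglyMeasurable

open FourierTransform in
-- The transform of the n-th derivative is evaluated on n copies of the frequency vector itself, so
-- no dimensional constant is lost.
theorem norm_pow_mul_norm_fourierInt_le (f : GSSpace d) (n : ℕ) (ξ : Rd d) :
    ‖ξ‖ ^ n * ‖fourierInt f ξ‖ ≤ ∫ t, ‖iteratedFDeriv ℝ n f.1 t‖ := by
  obtain ⟨η, rfl⟩ : ∃ η : Rd d, ξ = (2 * Real.pi) • η :=
    ⟨(2 * Real.pi)⁻¹ • ξ, by rw [smul_smul, mul_inv_cancel₀ (by positivity), one_smul]⟩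
  rw [fourierInt_two_pi_smul, norm_smul, Real.norm_of_nonneg (by positivity)]
  have h1 := Real.fourier_iteratedFDeriv (N := (⊤ : ℕ∞)) f.2.1
    (fun n _ => integrable_iteratedFDeriv f n) (n := n) le_top
  have h2 := congrFun h1 η
  have h3 : ‖𝓕 (iteratedFDeriv ℝ n f.1) η‖ ≤ ∫ t, ‖iteratedFDeriv ℝ n f.1 t‖ :=
    VectorFourier.norm_fourierIntegral_le_integral_norm _ _ _ _ _
  -- The general argument divides by ‖η‖^n, so η = 0 is treated apart, where only n = 0 has content.
  rcases eq_or_ne η 0 with rfl | hη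
  · rcases Nat.eq_zero_or_pos n with rfl | hn
    · have h4 := congrArg (fun p => p (fun _ : Fin 0 => (0 : Rd d))) h2
      simp only [VectorFourier.fourierPowSMulRight_apply, pow_zero, Finset.univ_eq_empty,
        Finset.prod_empty, one_smul] at h4
      rw [pow_zero, one_mul, ← h4]
      refine (ContinuousMultilinearMap.le_opNorm _ _).trans ?_
      simpa using h3
    · rw [norm_zero, mul_zero, zero_pow hn.ne', zero_mul]
      exact integral_nonneg fun _ => norm_nonneg _
  have hη' : 0 < ‖η‖ := norm_pos_iff.2 hη
  have h4 := congrArg (fun p => ‖p (fun _ : Fin n => η)‖) h2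
  simp only [VectorFourier.fourierPowSMulRight_apply] at h4
  have h5 := ContinuousMultilinearMap.le_opNorm (𝓕 (iteratedFDeriv ℝ n f.1) η) (fun _ : Fin n => η)
  rw [h4] at h5
  have h7 : ‖innerSL ℝ η η‖ = ‖η‖ ^ 2 := by
    rw [innerSL_apply_apply, real_inner_self_eq_norm_sq, Real.norm_of_nonneg (by positivity)]
  simp only [norm_smul, norm_pow, norm_neg, norm_mul, Complex.norm_I, mul_one, Finset.prod_const,
    Finset.card_univ, Fintype.card_fin, neg_apply, Complex.norm_real, RCLike.norm_ofNat,
    Real.norm_of_nonneg Real.pi_pos.le] at h5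
  rw [h7] at h5
  have h6 : (2 * Real.pi * ‖η‖) ^ n * ‖𝓕 f.1 η‖ * ‖η‖ ^ n ≤
      (∫ t, ‖iteratedFDeriv ℝ n f.1 t‖) * ‖η‖ ^ n := by
    calc _ = (2 * Real.pi) ^ n * ((‖η‖ ^ 2) ^ n * ‖𝓕 f.1 η‖) := by ring
      _ ≤ _ := h5
      _ ≤ _ := by gcongr
  exact le_of_mul_le_mul_right h6 (by positivity)

open FourierTransform in
-- Fourier inversion after the dilation ξ = 2πη, whose Jacobian is the factor (2π)^d.
theorem integral_fourierInt_mul_exp (f : GSSpace d) (y : Rd d) :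
    ∫ ξ, fourierInt f ξ * Complex.exp ((inner ℝ ξ y : ℝ) * Complex.I) =
      (((2 * Real.pi) ^ d : ℝ) : ℂ) * f.1 y := by
  have h1 := Measure.integral_comp_smul (volume : Measure (Rd d))
    (fun ξ => fourierInt f ξ * Complex.exp ((inner ℝ ξ y : ℝ) * Complex.I)) (2 * Real.pi)
  have h2 : ∫ η : Rd d, fourierInt f ((2 * Real.pi) • η) *
      Complex.exp ((inner ℝ ((2 * Real.pi) • η) y : ℝ) * Complex.I) = f.1 y := by
    have h3 : 𝓕⁻ (𝓕 f.1) y = f.1 y := by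
      have hF : Integrable (𝓕 f.1) := by
        have : ⇑(𝓕 (toSchwartz f) : SchwartzMap (Rd d) ℂ) = 𝓕 f.1 := SchwartzMap.fourier_coe _
        rw [← this]
        exact SchwartzMap.integrable _
      rw [Continuous.fourierInv_fourier_eq (continuous f) (toSchwartz f).integrable hF]
    rw [← h3, Real.fourierInv_eq']
    refine integral_congr_ae (Eventually.of_forall fun η => ?_)
    simp only [smul_eq_mul]
    rw [fourierInt_two_pi_smul, mul_comm, real_inner_smul_left]
  rw [h2, finrank_euclideanSpace_fin, abs_of_pos (by positivity)] at h1
  rw [h1, Complex.real_smul, ← mul_assoc, ← Complex.ofReal_mul, mul_inv_cancel₀ (by positivity),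
    Complex.ofReal_one, one_mul]

theorem exp_mul_norm_iteratedFDeriv_le (hh : 0 < h) (f : GSSpace d) (n : ℕ) (x : Rd d) :
    ‖iteratedFDeriv ℝ n f.1 x‖ ≤ 2 * (gsNorm h f.1).toReal * (h ^ n * n.factorial) *
      Real.exp (-(‖x‖ / h / 2)) := by
  have h1 := exp_half_mul_le (s := ‖x‖ / h) (a := ‖iteratedFDeriv ℝ n f.1 x‖)
    (B := (gsNorm h f.1).toReal * (h ^ n * n.factorial)) (fun k => by
      rw [div_pow, div_mul_eq_mul_div, div_le_iff₀ (by positivity)]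
      refine (pow_mul_norm_iteratedFDeriv_le hh f k n x).trans (le_of_eq ?_)
      rw [pow_add]
      ring)
  rw [Real.exp_neg, ← div_eq_mul_inv, le_div_iff₀ (Real.exp_pos _), mul_comm]
  linarith

theorem norm_iteratedFDeriv_mul_shift_le (hh : 0 < h) (f g : GSSpace d) (n : ℕ) (x t : Rd d) :
    ‖iteratedFDeriv ℝ n (mul f (shift g x)).1 t‖ ≤
      4 * (gsNorm h f.1).toReal * (gsNorm h g.1).toReal * ((2 * h) ^ n * n.factorial) *
        (Real.exp (-(‖x‖ / h / 4)) * Real.exp (-(1 / h / 4) * ‖t‖)) := by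
  set A := (gsNorm h f.1).toReal
  set B := (gsNorm h g.1).toReal
  have hA : 0 ≤ A := ENNReal.toReal_nonneg
  have hB : 0 ≤ B := ENNReal.toReal_nonneg
  have key := norm_iteratedFDeriv_mul_le f.2.1 (shift g x).2.1 t (n := n) (mod_cast le_top)
  -- Half of the decay yields decay in x by the triangle inequality; the other half keeps
  -- integrability in t.
  have hexp : Real.exp (-(‖t‖ / h / 2)) * Real.exp (-(‖t - x‖ / h / 2)) ≤
      Real.exp (-(‖x‖ / h / 4)) * Real.exp (-(1 / h / 4) * ‖t‖) := by
    rw [← Real.exp_add, ← Real.exp_add]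
    refine Real.exp_le_exp.2 ?_
    have h1 : ‖x‖ ≤ ‖t‖ + ‖t - x‖ := by
      simpa using norm_sub_le t (t - x)
    have h2 : -(‖t‖ / h / 2) + -(‖t - x‖ / h / 2) = -(2 * ‖t‖ + 2 * ‖t - x‖) / h / 4 := by ring
    have h3 : -(‖x‖ / h / 4) + -(1 / h / 4) * ‖t‖ = -(‖x‖ + ‖t‖) / h / 4 := by ring
    rw [h2, h3]
    refine div_le_div_of_nonneg_right (div_le_div_of_nonneg_right ?_ hh.le) (by norm_num)
    linarith [norm_nonneg (t - x)]
  calc _ ≤ ∑ i ∈ Finset.range (n + 1), (n.choose i : ℝ) * ‖iteratedFDeriv ℝ i f.1 t‖ *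
          ‖iteratedFDeriv ℝ (n - i) (shift g x).1 t‖ := key
    _ ≤ ∑ i ∈ Finset.range (n + 1), 4 * A * B * (h ^ n * n.factorial) *
          (Real.exp (-(‖t‖ / h / 2)) * Real.exp (-(‖t - x‖ / h / 2))) := by
        refine Finset.sum_le_sum fun i hi => ?_
        have hi' : i ≤ n := Nat.lt_succ_iff.1 (Finset.mem_range.1 hi)
        have e : iteratedFDeriv ℝ (n - i) (shift g x).1 t = iteratedFDeriv ℝ (n - i) g.1 (t - x) :=
          iteratedFDeriv_comp_sub (f := g.1) (n - i) x t
        rw [e]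
        calc _ ≤ (n.choose i : ℝ) * (2 * A * (h ^ i * i.factorial) * Real.exp (-(‖t‖ / h / 2))) *
              (2 * B * (h ^ (n - i) * (n - i).factorial) * Real.exp (-(‖t - x‖ / h / 2))) := by
              gcongr
              · exact exp_mul_norm_iteratedFDeriv_le hh f i t
              · exact exp_mul_norm_iteratedFDeriv_le hh g (n - i) (t - x)
          _ = 4 * A * B * ((h ^ i * h ^ (n - i)) *
                ((n.choose i : ℝ) * (i.factorial * (n - i).factorial))) *
                (Real.exp (-(‖t‖ / h / 2)) * Real.exp (-(‖t - x‖ / h / 2))) := by ring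
          _ = _ := by rw [choose_mul_factorials hi', ← pow_add, Nat.add_sub_cancel' hi']
    _ = 4 * A * B * ((((n : ℝ) + 1) * h ^ n) * n.factorial) *
          (Real.exp (-(‖t‖ / h / 2)) * Real.exp (-(‖t - x‖ / h / 2))) := by
        rw [Finset.sum_const, Finset.card_range, nsmul_eq_mul]; push_cast; ring
    _ ≤ 4 * A * B * ((2 ^ n * h ^ n) * n.factorial) *
          (Real.exp (-(‖x‖ / h / 4)) * Real.exp (-(1 / h / 4) * ‖t‖)) := by
        gcongr
        exact add_one_le_two_pow n
    _ = _ := by rw [mul_pow]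

theorem toDual_atom (f g : GSSpace d) (x ξ : Rd d) :
    (toDual f).1 (atom g x ξ) = fourierInt (mul f (shift (conj g) x)) ξ := by
  rw [toDual_apply, fourierInt]
  simp only [atom_eq, modul, GSSpace.mul, mul_assoc]

/-- Decay in position comes from the overlap of f with the translated window, decay in frequency
from the derivative bounds of all orders. The bound is linear in one seminorm of f, which later
gives continuity of functionals. -/
theorem exists_enorm_toDual_atom_le (g : GSSpace d) {l : ℝ} (hl : 0 < l) :
    ∃ h : ℝ, 0 < h ∧ ∃ C : ℝ≥0, ∀ (f : GSSpace d) (w : Rd d × Rd d),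
      ‖(toDual f).1 (atom g w.1 w.2)‖ₑ ≤ C * gsNorm h f.1 * wexp (-l) w := by
  -- Both variables turn out to decay with the rate 1/(4h).
  obtain ⟨h, hh, hl4⟩ : ∃ h : ℝ, 0 < h ∧ 1 / h / 4 = l :=
    ⟨1 / (4 * l), by positivity, by field_simp⟩
  set B := (gsNorm h (conj g).1).toReal
  have hB : 0 ≤ B := ENNReal.toReal_nonneg
  set I := ∫ t : Rd d, Real.exp (-(1 / h / 4) * ‖t‖)
  have hI : 0 ≤ I := integral_nonneg fun _ => (Real.exp_pos _).le
  refine ⟨h, hh, (8 * B * I).toNNReal, fun f w => ?_⟩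
  obtain ⟨A, hA'⟩ : ∃ A, A = (gsNorm h f.1).toReal := ⟨_, rfl⟩
  have hA : 0 ≤ A := hA' ▸ ENNReal.toReal_nonneg
  have e : gsNorm h f.1 = ENNReal.ofReal A := by
    rw [hA', ENNReal.ofReal_toReal (gsNorm_ne_top hh f)]
  set s := mul f (shift (conj g) w.1)
  have h1 : ∀ n : ℕ, ‖w.2‖ ^ n * ‖fourierInt s w.2‖ ≤
      4 * A * B * ((2 * h) ^ n * n.factorial) * (Real.exp (-(‖w.1‖ / h / 4)) * I) := fun n => by
    refine (norm_pow_mul_norm_fourierInt_le s n w.2).trans ?_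
    calc ∫ t, ‖iteratedFDeriv ℝ n s.1 t‖
        ≤ ∫ t : Rd d, 4 * A * B * ((2 * h) ^ n * n.factorial) *
            (Real.exp (-(‖w.1‖ / h / 4)) * Real.exp (-(1 / h / 4) * ‖t‖)) := by
          refine integral_mono (integrable_iteratedFDeriv s n).norm ?_
            (fun t => hA' ▸ norm_iteratedFDeriv_mul_shift_le hh f (conj g) n w.1 t)
          exact ((integrable_exp_neg_mul_norm (by positivity)).const_mul _).const_mul _
      _ = _ := by rw [integral_const_mul, integral_const_mul]
  have h2 := exp_half_mul_le (s := ‖w.2‖ / (2 * h)) (a := ‖fourierInt s w.2‖)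
    (B := 4 * A * B * (Real.exp (-(‖w.1‖ / h / 4)) * I)) (fun k => by
      rw [div_pow, div_mul_eq_mul_div, div_le_iff₀ (by positivity)]
      refine (h1 k).trans (le_of_eq ?_)
      ring)
  have h3 : ‖fourierInt s w.2‖ ≤ 8 * B * I * A * Real.exp (-l * ‖w‖) := by
    have h4 : Real.exp (-(‖w.1‖ / h / 4)) * Real.exp (-(‖w.2‖ / (2 * h) / 2)) ≤
        Real.exp (-l * ‖w‖) := by
      rw [← Real.exp_add]
      refine Real.exp_le_exp.2 ?_
      have h5 : ‖w‖ ≤ ‖w.1‖ + ‖w.2‖ := by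
        rw [Prod.norm_def]
        exact max_le_add_of_nonneg (norm_nonneg _) (norm_nonneg _)
      have h6 : -(‖w.1‖ / h / 4) + -(‖w.2‖ / (2 * h) / 2) = -((1 / h / 4) * (‖w.1‖ + ‖w.2‖)) := by
        field_simp
        ring
      rw [h6, hl4]
      nlinarith
    calc ‖fourierInt s w.2‖ ≤ 2 * (4 * A * B * (Real.exp (-(‖w.1‖ / h / 4)) * I)) *
          Real.exp (-(‖w.2‖ / (2 * h) / 2)) := by
          rw [Real.exp_neg (‖w.2‖ / (2 * h) / 2), ← div_eq_mul_inv, le_div_iff₀ (Real.exp_pos _),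
            mul_comm]
          exact h2
      _ = 8 * B * I * A * (Real.exp (-(‖w.1‖ / h / 4)) * Real.exp (-(‖w.2‖ / (2 * h) / 2))) := by
          ring
      _ ≤ _ := by gcongr
  rw [toDual_atom, ← ofReal_norm, e]
  refine (ENNReal.ofReal_le_ofReal h3).trans (le_of_eq ?_)
  rw [ENNReal.ofReal_mul (by positivity), ENNReal.ofReal_mul (by positivity)]
  rfl

end GSSpace

instance isAddHaarMeasure_volume_prod (d : ℕ) :
    (volume : Measure (Rd d × Rd d)).IsAddHaarMeasure :=
  inferInstanceAs ((volume : Measure (Rd d)).prod (volume : Measure (Rd d))).IsAddHaarMeasure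

/-! ### The reproducing formula -/

namespace GSSpace

variable {d : ℕ} {h : ℝ}

@[simp] theorem conj_conj (f : GSSpace d) : conj (conj f) = f := by
  ext y
  simp [conj]

/-- The coefficient functional of `g` in the synthesis with the atoms of the window `φ`. -/
noncomputable def kern (φ g : GSSpace d) (w : Rd d × Rd d) : ℂ :=
  (toDual g).1 (atom (conj φ) w.1 (-w.2))

theorem kern_eq_fourierInt (φ g : GSSpace d) (w : Rd d × Rd d) :
    kern φ g w = fourierInt (mul g (shift φ w.1)) (-w.2) := by
  rw [kern, toDual_atom, conj_conj]

theorem continuous_kern (φ g : GSSpace d) : Continuous (kern φ g) :=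
  ((continuousFamily_atom (conj φ)).comp
    (φ := fun w : Rd d × Rd d => (w.1, -w.2)) (by fun_prop)).continuous_apply (toDual g)

theorem exists_enorm_kern_le (φ : GSSpace d) {l : ℝ} (hl : 0 < l) :
    ∃ h : ℝ, 0 < h ∧ ∃ C : ℝ≥0, ∀ (g : GSSpace d) (w : Rd d × Rd d),
      ‖kern φ g w‖ₑ ≤ C * gsNorm h g.1 * wexp (-l) w := by
  obtain ⟨h, hh, C, hC⟩ := exists_enorm_toDual_atom_le (conj φ) hl
  refine ⟨h, hh, C, fun g w => ?_⟩
  have := hC g (w.1, -w.2)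
  rwa [show wexp (-l) (w.1, -w.2) = wexp (-l) w by simp [wexp, Prod.norm_def]] at this

/-- Covariance: translating the integration variable by the position of z leaves only a phase
factor, so the modulus of the kernel depends on w - z alone. -/
theorem norm_kern_atom (φ ψ : GSSpace d) (z w : Rd d × Rd d) :
    ‖kern φ (atom ψ z.1 z.2) w‖ = ‖kern φ (conj ψ) (w - z)‖ := by
  have h1 : kern φ (atom ψ z.1 z.2) w =
      Complex.exp (-((inner ℝ (z.2 - w.2) z.1 : ℝ) * Complex.I)) * kern φ (conj ψ) (w - z) := by
    rw [kern_eq_fourierInt, kern_eq_fourierInt, fourierInt, fourierInt, ← integral_const_mul,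
      ← integral_add_right_eq_self _ z.1]
    refine integral_congr_ae (Eventually.of_forall fun t => ?_)
    simp only [GSSpace.mul, shift, conj, atom, Prod.fst_sub, Prod.snd_sub]
    rw [add_sub_cancel_right, show t + z.1 - w.1 = t - (w.1 - z.1) by abel]
    have h2 : Complex.exp (-((inner ℝ z.2 (t + z.1) : ℝ) * Complex.I)) *
        Complex.exp (-((inner ℝ (-w.2) (t + z.1) : ℝ) * Complex.I)) =
        Complex.exp (-((inner ℝ (z.2 - w.2) z.1 : ℝ) * Complex.I)) *
        Complex.exp (-((inner ℝ (-(w.2 - z.2)) t : ℝ) * Complex.I)) := by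
      rw [← Complex.exp_add, ← Complex.exp_add]
      congr 1
      simp only [inner_add_right, inner_neg_left, inner_sub_left]
      push_cast
      ring
    linear_combination (starRingEnd ℂ (ψ.1 t) * φ.1 (t - (w.1 - z.1))) * h2
  have h3 : ‖Complex.exp (-((inner ℝ (z.2 - w.2) z.1 : ℝ) * Complex.I))‖ = 1 := by
    rw [← neg_mul, ← Complex.ofReal_neg, Complex.norm_exp_ofReal_mul_I]
  rw [h1, norm_mul, h3, one_mul]

theorem exists_enorm_kern_atom_le (φ ψ : GSSpace d) {l : ℝ} (hl : 0 < l) :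
    ∃ C : ℝ≥0, ∀ z w : Rd d × Rd d,
      ‖kern φ (atom ψ z.1 z.2) w‖ₑ ≤ C * wexp (-l) (z - w) := by
  obtain ⟨h, hh, C, hC⟩ := exists_enorm_kern_le φ hl
  refine ⟨C * (gsNorm h (conj ψ).1).toNNReal, fun z w => ?_⟩
  have h1 := hC (conj ψ) (w - z)
  rw [ENNReal.coe_mul, ENNReal.coe_toNNReal (gsNorm_ne_top hh _), wexp_sub_comm]
  refine le_trans (le_of_eq ?_) h1
  rw [← ofReal_norm, norm_kern_atom, ofReal_norm]

theorem lintegral_enorm_kern_mul_lt_top (φ g : GSSpace d) {m : ℝ} {A : ℝ≥0}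
    {F : Rd d × Rd d → ℝ≥0∞} (hF : ∀ w, F w ≤ A * wexp m w) :
    ∫⁻ w, ‖kern φ g w‖ₑ * F w < ∞ := by
  have hm : 0 < max m 0 + 1 := by positivity
  obtain ⟨h, hh, C, hC⟩ := exists_enorm_kern_le φ hm
  calc ∫⁻ w, ‖kern φ g w‖ₑ * F w
      ≤ ∫⁻ w : Rd d × Rd d, C * gsNorm h g.1 * A * wexp (-1) w := by
        refine lintegral_mono fun w => ?_
        calc ‖kern φ g w‖ₑ * F w ≤ C * gsNorm h g.1 * wexp (-(max m 0 + 1)) w * (A * wexp m w) :=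
              mul_le_mul' (hC g w) (hF w)
          _ = C * gsNorm h g.1 * A * (wexp (-(max m 0 + 1)) w * wexp m w) := by ring
          _ ≤ _ := by
              rw [wexp_mul_wexp]
              gcongr
              refine wexp_mono ?_ w
              linarith [le_max_left m 0]
    _ < ∞ := by
        rw [lintegral_const_mul _ (measurable_wexp _)]
        refine ENNReal.mul_lt_top ?_ (lintegral_wexp_neg_lt_top one_pos)
        exact ENNReal.mul_lt_top (ENNReal.mul_lt_top ENNReal.coe_lt_top
          (gsNorm_ne_top hh g).lt_top) ENNReal.coe_lt_top

/-- The normalization constant `(2π)^d ‖φ‖²` of the reproducing formula. -/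
noncomputable def frameConst (φ : GSSpace d) : ℂ :=
  (((2 * Real.pi) ^ d * ∫ t, ‖φ.1 t‖ ^ 2 : ℝ) : ℂ)

theorem integrable_norm_sq (φ : GSSpace d) : Integrable (fun t => ‖φ.1 t‖ ^ 2) := by
  have h1 := (toSchwartz (mul φ φ)).integrable (μ := volume).norm
  refine h1.congr (Eventually.of_forall fun t => ?_)
  change ‖φ.1 t * φ.1 t‖ = _
  simp only [norm_mul, sq]

theorem frameConst_ne_zero {φ : GSSpace d} (hφ : φ ≠ 0) : frameConst φ ≠ 0 := by
  rw [frameConst, Ne, Complex.ofReal_eq_zero, mul_eq_zero, not_or]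
  refine ⟨by positivity, fun h0 => hφ ?_⟩
  rw [integral_eq_zero_iff_of_nonneg (fun t => by positivity) (integrable_norm_sq φ)] at h0
  have h1 := (Continuous.ae_eq_iff_eq volume ((continuous φ).norm.pow 2) continuous_zero).1 h0
  ext t
  have := congrFun h1 t
  simpa using this

/-- For fixed x, Fourier inversion in ξ yields (2π)^d |φ(y - x)|² g(y); the integral over x then
gives the L² norm of the window. -/
theorem integral_kern_mul_atom (φ g : GSSpace d) (y : Rd d) :
    ∫ w : Rd d × Rd d, kern φ g w * (atom φ w.1 w.2).1 y = frameConst φ * g.1 y := by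
  have hint : Integrable (fun w : Rd d × Rd d => kern φ g w * (atom φ w.1 w.2).1 y) := by
    refine ⟨((continuous_kern φ g).mul ?_).aestronglyMeasurable, ?_⟩
    · have := continuous φ
      simp only [atom]
      fun_prop
    · rw [HasFiniteIntegral]
      simp_rw [enorm_mul]
      refine lintegral_enorm_kern_mul_lt_top φ g (m := 0) (A := (gsNorm 1 φ.1).toNNReal) fun w => ?_
      rw [ENNReal.coe_toNNReal (gsNorm_ne_top one_pos φ)]
      have h1 := norm_iteratedFDeriv_le one_pos φ 0 (y - w.1)
      simp only [norm_iteratedFDeriv_zero, pow_zero, Nat.factorial_zero, Nat.cast_one,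
        mul_one] at h1
      have h2 : ‖(atom φ w.1 w.2).1 y‖ = ‖φ.1 (y - w.1)‖ := by
        simp only [atom]
        rw [norm_mul, ← neg_mul, ← Complex.ofReal_neg, Complex.norm_exp_ofReal_mul_I, mul_one,
          RCLike.norm_conj]
      rw [← ofReal_norm, h2, wexp, zero_mul, Real.exp_zero, ENNReal.ofReal_one, mul_one]
      exact ENNReal.ofReal_le_of_le_toReal h1
  rw [Measure.volume_eq_prod] at hint ⊢
  rw [integral_prod _ hint]
  have hin : ∀ x : Rd d, ∫ ξ : Rd d, kern φ g (x, ξ) * (atom φ x ξ).1 y =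
      (((2 * Real.pi) ^ d * ‖φ.1 (y - x)‖ ^ 2 : ℝ) : ℂ) * g.1 y := by
    intro x
    have h1 := integral_fourierInt_mul_exp (mul g (shift φ x)) y
    rw [← integral_neg_eq_self] at h1
    have h2 : ∀ ξ : Rd d, kern φ g (x, ξ) * (atom φ x ξ).1 y = starRingEnd ℂ (φ.1 (y - x)) *
        (fourierInt (mul g (shift φ x)) (-ξ) *
          Complex.exp ((inner ℝ (-ξ) y : ℝ) * Complex.I)) := fun ξ => by
      rw [kern_eq_fourierInt, inner_neg_left]
      simp only [atom]
      push_cast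
      rw [neg_mul]
      ring
    simp_rw [h2]
    rw [integral_const_mul, h1]
    simp only [GSSpace.mul, shift]
    have h3 := Complex.conj_mul' (φ.1 (y - x))
    push_cast at h3 ⊢
    linear_combination ((2 * (Real.pi : ℂ)) ^ d * g.1 y) * h3
  simp_rw [hin]
  rw [integral_mul_const, integral_complex_ofReal, integral_const_mul,
    integral_sub_left_eq_self (fun t => ‖φ.1 t‖ ^ 2) volume y, frameConst]

/-- The reproducing formula. -/
theorem reproducing (φ g : GSSpace d) (u : GSDual d) :
    Integrable (fun w : Rd d × Rd d => kern φ g w * u.1 (atom φ w.1 w.2)) ∧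
      ∫ w : Rd d × Rd d, kern φ g w * u.1 (atom φ w.1 w.2) = frameConst φ * u.1 g := by
  -- The pointwise identity holds in Σ₁ as a superposition of atoms, so u can be applied under the
  -- integral.
  obtain ⟨g', hg', hu⟩ := exists_integral (μ := (volume : Measure (Rd d × Rd d)))
    (continuousFamily_atom φ) (continuous_kern φ g).aestronglyMeasurable (fun h hh => by
      obtain ⟨m, A, -, hA⟩ := exists_gsNorm_atom_le hh φ
      exact lintegral_enorm_kern_mul_lt_top φ g hA)
  have e : g' = frameConst φ • g := by
    ext y
    rw [hg', integral_kern_mul_atom]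
    rfl
  refine ⟨(hu u).1, ?_⟩
  rw [← (hu u).2, e, map_smul, smul_eq_mul]

/-- The qualitative growth bound required by `rpow_le_of_le_lintegral`; its constants depend on u.
-/
theorem exists_enorm_atom_growth (φ : GSSpace d) (u : GSDual d) :
    ∃ (m : ℝ) (A : ℝ≥0), ∀ w : Rd d × Rd d, ‖u.1 (atom φ w.1 w.2)‖ₑ ≤ A * wexp m w := by
  obtain ⟨h, hh, C, hu⟩ := u.2
  obtain ⟨m, A, -, hA⟩ := exists_gsNorm_atom_le hh φ
  refine ⟨m, C * A, fun w => (hu _).trans ?_⟩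
  rw [ENNReal.coe_mul, mul_assoc]
  gcongr
  exact hA w

/-- The reproducing formula is applied to an atom of the window ψ. The decay of the kernel is
arbitrary, and the constant does not depend on u. -/
theorem exists_enorm_atom_le_lintegral {φ : GSSpace d} (hφ : φ ≠ 0) (ψ : GSSpace d) {l : ℝ}
    (hl : 0 < l) : ∃ C : ℝ≥0, ∀ (u : GSDual d) (z : Rd d × Rd d), ‖u.1 (atom ψ z.1 z.2)‖ₑ ≤
      C * ∫⁻ w : Rd d × Rd d, ‖u.1 (atom φ w.1 w.2)‖ₑ * wexp (-l) (z - w) := by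
  obtain ⟨C, hC⟩ := exists_enorm_kern_atom_le φ ψ hl
  have hN := frameConst_ne_zero hφ
  refine ⟨‖(frameConst φ)⁻¹‖₊ * C, fun u z => ?_⟩
  have h1 := (reproducing φ (atom ψ z.1 z.2) u).2
  have h2 : u.1 (atom ψ z.1 z.2) = (frameConst φ)⁻¹ *
      ∫ w : Rd d × Rd d, kern φ (atom ψ z.1 z.2) w * u.1 (atom φ w.1 w.2) := by
    rw [h1, inv_mul_cancel_left₀ hN]
  rw [h2, enorm_mul, ENNReal.coe_mul, mul_assoc]
  refine mul_le_mul_right ((enorm_integral_le_lintegral_enorm _).trans ?_) _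
  rw [← lintegral_const_mul' _ _ ENNReal.coe_ne_top]
  refine lintegral_mono fun w => ?_
  rw [enorm_mul]
  calc _ ≤ C * wexp (-l) (z - w) * ‖u.1 (atom φ w.1 w.2)‖ₑ := by
        gcongr
        exact hC z w
    _ = _ := by ring

end GSSpace

/-! ### The modulation space quasi-norm -/

namespace GSSpace

variable {d : ℕ}

/-- The size of the (unnormalized) short-time Fourier transform of `u` with window `φ`. -/
noncomputable def ampl (φ : GSSpace d) (u : GSDual d) (z : Rd d × Rd d) : ℝ≥0∞ :=
  ‖u.1 (atom φ z.1 z.2)‖ₑ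

theorem continuous_atom_apply (φ : GSSpace d) (u : GSDual d) :
    Continuous fun z : Rd d × Rd d => u.1 (atom φ z.1 z.2) :=
  (continuousFamily_atom φ).continuous_apply u

theorem measurable_ampl (φ : GSSpace d) (u : GSDual d) : Measurable (ampl φ u) :=
  (continuous_atom_apply φ u).enorm.measurable

theorem ampl_add_le (φ : GSSpace d) (u v : GSDual d) (z : Rd d × Rd d) :
    ampl φ (u + v) z ≤ ampl φ u z + ampl φ v z :=
  enorm_add_le _ _

theorem modNorm_eq {p q : ℝ≥0∞} (hp : 0 < p ∧ p < ∞) (hq : 0 < q ∧ q < ∞)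
    {ω : Rd d × Rd d → ℝ} (hω : ∀ z, 0 < ω z) (φ : GSSpace d) (u : GSDual d) :
    modNorm p q ω φ u = ENNReal.ofReal ((2 * Real.pi) ^ (-(d : ℝ) / 2)) *
      mlpn p.toReal q.toReal fun z => ampl φ u z * ENNReal.ofReal (ω z) := by
  rw [← mlpn_const_mul (ENNReal.toReal_pos hp.1.ne' hp.2.ne) (ENNReal.toReal_pos hq.1.ne' hq.2.ne)
    ENNReal.ofReal_ne_top, modNorm, mixedNorm,
    eLpNorm_eq_lintegral_rpow_enorm_toReal hq.1.ne' hq.2.ne, mlpn, lpn]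
  simp_rw [enorm_eq_self, eLpNorm_eq_lintegral_rpow_enorm_toReal hp.1.ne' hp.2.ne, lpn, stft, ampl]
  congr! 10 with ξ x
  rw [enorm_mul, enorm_mul, mul_assoc]
  congr 1
  · rw [← ofReal_norm, Complex.norm_real, Real.norm_of_nonneg (by positivity)]
  · congr 1
    rw [← ofReal_norm, Complex.norm_real, Real.norm_of_nonneg (hω _).le]

/-- The modulation space quasi-norm is equivalent to one with a measurable, slowly varying
weight. -/
theorem exists_modNorm_equiv {p q : ℝ≥0∞} (hp : 0 < p ∧ p < ∞) (hq : 0 < q ∧ q < ∞)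
    {ω : Rd d × Rd d → ℝ} (hω : IsModerateWeight ω) :
    ∃ (K : ℝ≥0) (R : ℝ) (W : Rd d × Rd d → ℝ≥0∞), 0 ≤ R ∧ Measurable W ∧ IsSlow 1 R W ∧
      (∀ z, ENNReal.ofReal (ω z) ≤ W z) ∧ (∀ z, W z ≤ K * ENNReal.ofReal (ω z)) ∧
      (∀ φ u, modNorm p q ω φ u ≤ K * mlpn p.toReal q.toReal fun z => ampl φ u z * W z) ∧
      ∀ φ u, (mlpn p.toReal q.toReal fun z => ampl φ u z * W z) ≤ K * modNorm p q ω φ u := by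
  obtain ⟨K, R, W, hR, hWm, hWs, h1, h2⟩ := hω.exists_equiv
  have hp' := ENNReal.toReal_pos hp.1.ne' hp.2.ne
  have hq' := ENNReal.toReal_pos hq.1.ne' hq.2.ne
  set c : ℝ := (2 * Real.pi) ^ (-(d : ℝ) / 2) with hc
  have hc0 : 0 < c := by positivity
  refine ⟨K + c.toNNReal + K * c⁻¹.toNNReal, R, W, hR, hWm, hWs, h1, fun z => (h2 z).trans ?_,
    fun φ u => ?_, fun φ u => ?_⟩
  · gcongr
    rw [add_assoc]
    exact le_self_add
  · rw [modNorm_eq hp hq hω.1.1]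
    refine mul_le_mul' ?_ (mlpn_mono hp' hq' fun z => by gcongr; exact h1 z)
    exact ENNReal.coe_le_coe.2 (le_add_self.trans le_self_add)
  · rw [modNorm_eq hp hq hω.1.1]
    calc (mlpn p.toReal q.toReal fun z => ampl φ u z * W z)
        ≤ mlpn p.toReal q.toReal fun z => K * (ampl φ u z * ENNReal.ofReal (ω z)) := by
          refine mlpn_mono hp' hq' fun z => ?_
          rw [mul_left_comm]
          gcongr
          exact h2 z
      _ = K * (ENNReal.ofReal c⁻¹ * ENNReal.ofReal c) *
            mlpn p.toReal q.toReal fun z => ampl φ u z * ENNReal.ofReal (ω z) := by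
          rw [mlpn_const_mul hp' hq' ENNReal.coe_ne_top, ← ENNReal.ofReal_mul (by positivity),
            inv_mul_cancel₀ hc0.ne', ENNReal.ofReal_one, mul_one]
      _ ≤ _ := by
          rw [← mul_assoc, mul_assoc (K * _ : ℝ≥0∞)]
          gcongr
          rw [ENNReal.ofReal]
          exact_mod_cast le_add_self

theorem exists_ampl_le_expAvg_self {φ : GSSpace d} (hφ : φ ≠ 0) {r l : ℝ} (hr : 0 < r)
    (hr1 : r ≤ 1) (hl : 0 < l) :
    ∃ C : ℝ≥0, ∀ u z, ampl φ u z ≤ C * expAvg r l (ampl φ u) z := by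
  -- The constants for all rates are needed at once, since the self-improvement passes through a
  -- rate larger than l.
  choose! C hC using fun l (hl : 0 < l) => exists_enorm_atom_le_lintegral hφ φ hl
  refine ⟨C l ^ (1 / r), fun u z => ?_⟩
  have h1 := rpow_le_of_le_lintegral hr hr1 (F := ampl φ u) (fun l hl z => hC l hl u z)
    (exists_enorm_atom_growth φ u) hl z
  have h2 := ENNReal.rpow_le_rpow h1 (by positivity : 0 ≤ 1 / r)
  rwa [← ENNReal.rpow_mul, mul_one_div_cancel hr.ne', ENNReal.rpow_one,
    ENNReal.mul_rpow_of_nonneg _ _ (by positivity), ← ENNReal.coe_rpow_of_nonneg _ (by positivity)]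
    at h2

theorem exists_lintegral_ampl_le_expAvg {φ : GSSpace d} (hφ : φ ≠ 0) {r l : ℝ} (hr : 0 < r)
    (hr1 : r ≤ 1) (hl : 0 < l) : ∃ C : ℝ≥0, ∀ u z,
      ∫⁻ w, ampl φ u w * wexp (-(l + 1)) (z - w) ≤ C * expAvg r l (ampl φ u) z := by
  obtain ⟨C, hC⟩ := exists_ampl_le_expAvg_self hφ hr hr1 hl
  have hfin := lintegral_wexp_neg_lt_top (V := Rd d × Rd d) one_pos
  refine ⟨C * (∫⁻ w : Rd d × Rd d, wexp (-1) w).toNNReal, fun u z => ?_⟩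
  calc ∫⁻ w, ampl φ u w * wexp (-(l + 1)) (z - w)
      ≤ ∫⁻ w, C * (expAvg r l (ampl φ u) w * wexp (-(l + 1)) (z - w)) := by
        refine lintegral_mono fun w => ?_
        rw [← mul_assoc]
        gcongr
        exact hC u w
    _ = C * ∫⁻ w, expAvg r l (ampl φ u) w * wexp (-(l + 1)) (z - w) :=
        lintegral_const_mul' _ _ ENNReal.coe_ne_top
    _ ≤ _ := by
        rw [ENNReal.coe_mul, ENNReal.coe_toNNReal hfin.ne, mul_assoc]
        gcongr
        simpa using (isSlow_expAvg hr hl.le (ampl φ u)).lintegral_mul_wexp_le (m := 1) z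

/-- The change of window is linear, with an L¹ average of the transform for φ; that average is
bounded by the L^r one through the case of equal windows. -/
theorem exists_ampl_le_expAvg {φ : GSSpace d} (hφ : φ ≠ 0) (ψ : GSSpace d) {r l : ℝ} (hr : 0 < r)
    (hr1 : r ≤ 1) (hl : 0 < l) :
    ∃ C : ℝ≥0, ∀ u z, ampl ψ u z ≤ C * expAvg r l (ampl φ u) z := by
  obtain ⟨C, hC⟩ := exists_lintegral_ampl_le_expAvg hφ hr hr1 hl
  obtain ⟨D, hD⟩ := exists_enorm_atom_le_lintegral hφ ψ (by linarith : 0 < l + 1)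
  refine ⟨D * C, fun u z => (hD u z).trans ?_⟩
  rw [ENNReal.coe_mul, mul_assoc]
  gcongr
  exact hC u z

/-- A change of the window leads to an equivalent quasi-norm. -/
theorem exists_mlpn_ampl_le {φ : GSSpace d} (hφ : φ ≠ 0) (ψ : GSSpace d) {p q R : ℝ} (hp : 0 < p)
    (hq : 0 < q) (hR : 0 ≤ R) {W : Rd d × Rd d → ℝ≥0∞} (hW : Measurable W) (hWs : IsSlow 1 R W) :
    ∃ C : ℝ≥0, ∀ u, (mlpn p q fun z => ampl ψ u z * W z) ≤
      C * mlpn p q fun z => ampl φ u z * W z := by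
  have hr : 0 < min 1 (min p q) := by positivity
  obtain ⟨C, hC⟩ := exists_ampl_le_expAvg hφ ψ hr (min_le_left _ _) (by linarith : 0 < R + 1)
  obtain ⟨D, hD⟩ := exists_mlpn_expAvg_mul_le (E := Rd d) 1 (by linarith : R < R + 1) hr
    ((min_le_right _ _).trans (min_le_left _ _)) ((min_le_right _ _).trans (min_le_right _ _))
  refine ⟨C * D, fun u => ?_⟩
  calc (mlpn p q fun z => ampl ψ u z * W z)
      ≤ mlpn p q fun z => C * (expAvg (min 1 (min p q)) (R + 1) (ampl φ u) z * W z) := by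
        refine mlpn_mono hp hq fun z => ?_
        rw [← mul_assoc]
        gcongr
        exact hC u z
    _ ≤ _ := by
        rw [mlpn_const_mul hp hq ENNReal.coe_ne_top, ENNReal.coe_mul, mul_assoc]
        gcongr
        exact hD _ _ (measurable_ampl φ u) hW hWs

theorem mlpn_wexp_neg_lt_top {p q l : ℝ} (hp : 0 < p) (hq : 0 < q) (hl : 0 < l) :
    mlpn p q (fun z : Rd d × Rd d => wexp (-(l + l)) z) < ∞ := by
  have hfin : ∀ s : ℝ, 0 < s → lpn s (fun x : Rd d => wexp (-l) x) < ∞ := fun s hs => by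
    refine ENNReal.rpow_lt_top_of_nonneg (by positivity) ?_
    simp_rw [wexp_rpow]
    rw [neg_mul]
    exact (lintegral_wexp_neg_lt_top (by positivity)).ne
  calc mlpn p q (fun z : Rd d × Rd d => wexp (-(l + l)) z)
      ≤ mlpn p q (fun z : Rd d × Rd d => wexp (-l) z.1 * wexp (-l) z.2) := by
        refine mlpn_mono hp hq fun z => ?_
        simp only [wexp]
        rw [← ENNReal.ofReal_mul (by positivity), ← Real.exp_add]
        refine ENNReal.ofReal_le_ofReal (Real.exp_le_exp.2 ?_)
        nlinarith [norm_fst_le z, norm_snd_le z]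
    _ = lpn p (fun x : Rd d => wexp (-l) x) * lpn q (fun x : Rd d => wexp (-l) x) := by
        rw [mlpn, ← lpn_const_mul hq (hfin p hp).ne]
        congr 1
        ext ξ
        simp only []
        simp_rw [mul_comm _ (wexp (-l) ξ)]
        rw [lpn_const_mul hp (wexp_ne_top _ _)]
    _ < ∞ := ENNReal.mul_lt_top (hfin p hp) (hfin q hq)

theorem mlpn_ampl_toDual_lt_top (φ f : GSSpace d) {p q R : ℝ} (hp : 0 < p)
    (hq : 0 < q) (hR : 0 ≤ R) {W : Rd d × Rd d → ℝ≥0∞} (hWs : IsSlow 1 R W) (h0 : W 0 ≠ ∞) :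
    (mlpn p q fun z => ampl φ (toDual f) z * W z) < ∞ := by
  obtain ⟨h, hh, C, hC⟩ := exists_enorm_toDual_atom_le φ (by linarith : 0 < R + (1 + 1))
  have hc : (C * gsNorm h f.1 * W 0 : ℝ≥0∞) ≠ ∞ :=
    ENNReal.mul_ne_top (ENNReal.mul_ne_top ENNReal.coe_ne_top (gsNorm_ne_top hh f)) h0
  calc (mlpn p q fun z => ampl φ (toDual f) z * W z)
      ≤ mlpn p q fun z => (C * gsNorm h f.1 * W 0) * wexp (-(1 + 1)) z := by
        refine mlpn_mono hp hq fun z => ?_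
        have h1 := hWs 0 z
        rw [zero_add, ENNReal.coe_one, one_mul] at h1
        calc ampl φ (toDual f) z * W z
            ≤ C * gsNorm h f.1 * wexp (-(R + (1 + 1))) z * (wexp R z * W 0) :=
              mul_le_mul' (hC f z) h1
          _ = C * gsNorm h f.1 * W 0 * (wexp (-(R + (1 + 1))) z * wexp R z) := by ring
          _ = _ := by
              rw [wexp_mul_wexp]
              congr 2
              ring
    _ < ∞ := by
        rw [mlpn_const_mul hp hq hc]
        exact ENNReal.mul_lt_top hc.lt_top (mlpn_wexp_neg_lt_top hp hq one_pos)

end GSSpace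

/-! ### The product of distributions -/

namespace GSSpace

variable {d : ℕ}

/-- The convolution in the second variable of `F` and `G`. -/
noncomputable def partialConv (F G : Rd d × Rd d → ℝ≥0∞) (z : Rd d × Rd d) : ℝ≥0∞ :=
  ∫⁻ η, F (z.1, z.2 - η) * G (z.1, η)

theorem partialConv_mono {F F' G G' : Rd d × Rd d → ℝ≥0∞} (hF : ∀ z, F z ≤ F' z)
    (hG : ∀ z, G z ≤ G' z) (z : Rd d × Rd d) : partialConv F G z ≤ partialConv F' G' z :=
  lintegral_mono fun _ => mul_le_mul' (hF _) (hG _)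

/-- For fixed η the first factor moves by the full translation, the second only by its position
part. -/
theorem isSlow_partialConv {K₁ K₂ : ℝ≥0} {l₁ l₂ : ℝ} (hl₂ : 0 ≤ l₂) {F G : Rd d × Rd d → ℝ≥0∞}
    (hF : IsSlow K₁ l₁ F) (hG : IsSlow K₂ l₂ G) :
    IsSlow (K₁ * K₂) (l₁ + l₂) (partialConv F G) := by
  refine IsSlow.lintegral_apply
    (H := fun (z : Rd d × Rd d) η => F (z.1, z.2 - η) * G (z.1, η)) fun η => ?_
  refine IsSlow.mul (H := fun z : Rd d × Rd d => F (z.1, z.2 - η))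
    (H' := fun z : Rd d × Rd d => G (z.1, η)) (fun x y => ?_) fun x y => ?_
  · have := hF (x.1, x.2 - η) y
    rwa [show (x.1, x.2 - η) + y = ((x + y).1, (x + y).2 - η) by
      ext1 <;> simp [add_sub_right_comm]] at this
  · have := hG (x.1, η) (y.1, 0)
    refine le_trans (le_of_eq ?_) (this.trans ?_)
    · simp
    · gcongr
      simp only [wexp]
      refine ENNReal.ofReal_le_ofReal (Real.exp_le_exp.2 ?_)
      refine mul_le_mul_of_nonneg_left ?_ hl₂
      simp [Prod.norm_def]

/-- `(2π)^d` times the short-time Fourier transform of the product of `u` and `v`, for the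
window `φ²`. -/
noncomputable def prodCoeff (φ : GSSpace d) (u v : GSDual d) (z : Rd d × Rd d) : ℂ :=
  ∫ η, u.1 (atom φ z.1 (z.2 - η)) * v.1 (atom φ z.1 η)

/-- The convolution of the short-time Fourier transforms of `u` and `v` converges absolutely and
has at most exponential growth. -/
def HasProduct (φ : GSSpace d) (u v : GSDual d) : Prop :=
  ∃ (m : ℝ) (A : ℝ≥0), ∀ z, partialConv (ampl φ u) (ampl φ v) z ≤ A * wexp m z

theorem continuous_prodCoeff_integrand (φ : GSSpace d) (u v : GSDual d) :
    Continuous fun w : (Rd d × Rd d) × Rd d =>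
      u.1 (atom φ w.1.1 (w.1.2 - w.2)) * v.1 (atom φ w.1.1 w.2) := by
  have h1 := (continuous_atom_apply φ u).comp
    (g := fun z : Rd d × Rd d => u.1 (atom φ z.1 z.2))
    (f := fun w : (Rd d × Rd d) × Rd d => (w.1.1, w.1.2 - w.2)) (by fun_prop)
  have h2 := (continuous_atom_apply φ v).comp
    (g := fun z : Rd d × Rd d => v.1 (atom φ z.1 z.2))
    (f := fun w : (Rd d × Rd d) × Rd d => (w.1.1, w.2)) (by fun_prop)
  exact h1.mul h2

theorem stronglyMeasurable_prodCoeff (φ : GSSpace d) (u v : GSDual d) :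
    StronglyMeasurable (prodCoeff φ u v) :=
  (continuous_prodCoeff_integrand φ u v).stronglyMeasurable.integral_prod_right'

theorem enorm_prodCoeff_le (φ : GSSpace d) (u v : GSDual d) (z : Rd d × Rd d) :
    ‖prodCoeff φ u v z‖ₑ ≤ partialConv (ampl φ u) (ampl φ v) z := by
  refine (enorm_integral_le_lintegral_enorm _).trans (le_of_eq ?_)
  simp_rw [enorm_mul]
  rfl

theorem HasProduct.integrable {φ : GSSpace d} {u v : GSDual d} (h : HasProduct φ u v)
    (z : Rd d × Rd d) :
    Integrable fun η => u.1 (atom φ z.1 (z.2 - η)) * v.1 (atom φ z.1 η) := by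
  obtain ⟨m, A, hA⟩ := h
  refine ⟨((continuous_prodCoeff_integrand φ u v).comp
    (f := fun η => (z, η)) (by fun_prop)).aestronglyMeasurable, ?_⟩
  rw [HasFiniteIntegral]
  simp_rw [enorm_mul]
  exact (hA z).trans_lt (ENNReal.mul_lt_top ENNReal.coe_lt_top (wexp_ne_top _ _).lt_top)

theorem integrable_kern_mul (ψ g : GSSpace d) {P : Rd d × Rd d → ℂ} (hP : StronglyMeasurable P)
    {m : ℝ} {A : ℝ≥0} (hA : ∀ w, ‖P w‖ₑ ≤ A * wexp m w) :
    Integrable fun w => kern ψ g w * P w := by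
  refine ⟨(continuous_kern ψ g).aestronglyMeasurable.mul hP.aestronglyMeasurable, ?_⟩
  rw [HasFiniteIntegral]
  simp_rw [enorm_mul]
  exact lintegral_enorm_kern_mul_lt_top ψ g hA

theorem HasProduct.integrable_kern {φ : GSSpace d} {u v : GSDual d} (h : HasProduct φ u v)
    (ψ g : GSSpace d) : Integrable fun w => kern ψ g w * prodCoeff φ u v w := by
  obtain ⟨m, A, hA⟩ := h
  exact integrable_kern_mul ψ g (stronglyMeasurable_prodCoeff φ u v) fun w =>
    (enorm_prodCoeff_le φ u v w).trans (hA w)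

/-- The product of `u` and `v`, tested against `g`. -/
noncomputable def mulForm (φ : GSSpace d) (u v : GSDual d) (g : GSSpace d) : ℂ :=
  (frameConst (mul φ φ))⁻¹ * (((2 * Real.pi) ^ d : ℝ) : ℂ)⁻¹ *
    ∫ w, kern (mul φ φ) g w * prodCoeff φ u v w

theorem kern_add (ψ g g' : GSSpace d) (w : Rd d × Rd d) :
    kern ψ (g + g') w = kern ψ g w + kern ψ g' w := by
  simp_rw [kern, toDual_comm _ (atom (conj ψ) w.1 (-w.2)), map_add]

theorem kern_smul (ψ : GSSpace d) (c : ℂ) (g : GSSpace d) (w : Rd d × Rd d) :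
    kern ψ (c • g) w = c * kern ψ g w := by
  simp_rw [kern, toDual_comm _ (atom (conj ψ) w.1 (-w.2)), map_smul, smul_eq_mul]

/-- The kernel decays at any prescribed rate with a constant linear in a seminorm of g; a rate
exceeding the growth of the convolution by 1 gives convergence and continuity together. -/
theorem HasProduct.exists_dual {φ : GSSpace d} {u v : GSDual d} (h : HasProduct φ u v) :
    ∃ w : GSDual d, ∀ g, w.1 g = mulForm φ u v g := by
  set c := (frameConst (mul φ φ))⁻¹ * (((2 * Real.pi) ^ d : ℝ) : ℂ)⁻¹ with hc
  have hi := h.integrable_kern (mul φ φ)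
  obtain ⟨m, A, hA⟩ := h
  have hm : 0 < max m 0 + 1 := by positivity
  obtain ⟨h, hh, C, hC⟩ := exists_enorm_kern_le (mul φ φ) hm
  have hfin := lintegral_wexp_neg_lt_top (V := Rd d × Rd d) one_pos
  refine ⟨⟨{ toFun := mulForm φ u v, map_add' := fun g g' => ?_, map_smul' := fun a g => ?_ },
    h, hh, ‖c‖₊ * (C * A * (∫⁻ w : Rd d × Rd d, wexp (-1) w).toNNReal), fun g => ?_⟩,
    fun g => rfl⟩
  · simp only [mulForm, kern_add, add_mul]
    rw [integral_add (hi g) (hi g'), mul_add]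
  · simp only [mulForm, kern_smul, mul_assoc]
    rw [integral_const_mul, RingHom.id_apply, smul_eq_mul]
    ring
  · change ‖c * ∫ w, kern (mul φ φ) g w * prodCoeff φ u v w‖ₑ ≤ _
    rw [enorm_mul, ENNReal.coe_mul, mul_assoc]
    refine mul_le_mul_right ?_ _
    calc ‖∫ w, kern (mul φ φ) g w * prodCoeff φ u v w‖ₑ
        ≤ ∫⁻ w : Rd d × Rd d, C * A * gsNorm h g.1 * wexp (-1) w := by
          refine (enorm_integral_le_lintegral_enorm _).trans (lintegral_mono fun w => ?_)
          rw [enorm_mul]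
          calc ‖kern (mul φ φ) g w‖ₑ * ‖prodCoeff φ u v w‖ₑ
              ≤ C * gsNorm h g.1 * wexp (-(max m 0 + 1)) w * (A * wexp m w) :=
                mul_le_mul' (hC g w) ((enorm_prodCoeff_le φ u v w).trans (hA w))
            _ = C * A * gsNorm h g.1 * (wexp (-(max m 0 + 1)) w * wexp m w) := by ring
            _ ≤ _ := by
                rw [wexp_mul_wexp]
                gcongr
                refine wexp_mono ?_ w
                linarith [le_max_left m 0]
      _ = _ := by
          rw [lintegral_const_mul _ (measurable_wexp _), ENNReal.coe_mul, ENNReal.coe_mul,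
            ENNReal.coe_toNNReal hfin.ne]
          ring

/-- Additivity of the integrals requires absolute convergence, which is what the two hypotheses
provide. -/
theorem mulForm_sub_left {φ : GSSpace d} {u u' v : GSDual d} (h : HasProduct φ u v)
    (h' : HasProduct φ u' v) (g : GSSpace d) :
    mulForm φ (u - u') v g = mulForm φ u v g - mulForm φ u' v g := by
  have h1 : ∀ w, prodCoeff φ (u - u') v w = prodCoeff φ u v w - prodCoeff φ u' v w := fun w => by
    rw [prodCoeff, prodCoeff, prodCoeff, ← integral_sub (h.integrable w) (h'.integrable w)]
    exact integral_congr_ae (Eventually.of_forall fun η => sub_mul _ _ _)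
  simp only [mulForm, h1, mul_sub]
  rw [integral_sub (h.integrable_kern _ g) (h'.integrable_kern _ g), mul_sub]

theorem mulForm_sub_right {φ : GSSpace d} {u v v' : GSDual d} (h : HasProduct φ u v)
    (h' : HasProduct φ u v') (g : GSSpace d) :
    mulForm φ u (v - v') g = mulForm φ u v g - mulForm φ u v' g := by
  have h1 : ∀ w, prodCoeff φ u (v - v') w = prodCoeff φ u v w - prodCoeff φ u v' w := fun w => by
    rw [prodCoeff, prodCoeff, prodCoeff, ← integral_sub (h.integrable w) (h'.integrable w)]
    exact integral_congr_ae (Eventually.of_forall fun η => mul_sub _ _ _)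
  simp only [mulForm, h1, mul_sub]
  rw [integral_sub (h.integrable_kern _ g) (h'.integrable_kern _ g), mul_sub]

/-- The Fourier transform of a product is a convolution. -/
theorem prodCoeff_toDual (φ f₁ f₂ : GSSpace d) (z : Rd d × Rd d) :
    prodCoeff φ (toDual f₁) (toDual f₂) z =
      (((2 * Real.pi) ^ d : ℝ) : ℂ) * (toDual (mul f₁ f₂)).1 (atom (mul φ φ) z.1 z.2) := by
  set a := mul f₁ (shift (conj φ) z.1) with ha
  set b := mul f₂ (shift (conj φ) z.1) with hb
  have hbi : Integrable (fourierInt b) := by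
    obtain ⟨h, hh, C, hC⟩ := exists_enorm_toDual_atom_le φ one_pos
    have hx := (continuous_atom_apply φ (toDual f₂)).comp
      (g := fun z : Rd d × Rd d => (toDual f₂).1 (atom φ z.1 z.2))
      (f := fun η : Rd d => (z.1, η)) (by fun_prop)
    simp only [Function.comp_def, toDual_atom] at hx
    refine ⟨hx.aestronglyMeasurable, ?_⟩
    rw [HasFiniteIntegral]
    calc ∫⁻ η, ‖fourierInt b η‖ₑ ≤ ∫⁻ η : Rd d, C * gsNorm h f₂.1 * wexp (-1) η := by
          refine lintegral_mono fun η => ?_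
          rw [hb, ← toDual_atom]
          refine (hC f₂ (z.1, η)).trans ?_
          gcongr
          simp only [wexp]
          refine ENNReal.ofReal_le_ofReal (Real.exp_le_exp.2 ?_)
          have := norm_snd_le (z.1, η)
          simp only at this
          linarith
      _ < ∞ := by
          rw [lintegral_const_mul _ (measurable_wexp _)]
          exact ENNReal.mul_lt_top (ENNReal.mul_lt_top ENNReal.coe_lt_top
            (gsNorm_ne_top hh f₂).lt_top) (lintegral_wexp_neg_lt_top one_pos)
  have hai : Integrable a.1 := (toSchwartz a).integrable
  have h1 : ∀ η t : Rd d, Complex.exp (-((inner ℝ (z.2 - η) t : ℝ) * Complex.I)) =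
      Complex.exp (-((inner ℝ z.2 t : ℝ) * Complex.I)) *
        Complex.exp ((inner ℝ η t : ℝ) * Complex.I) := fun η t => by
    rw [← Complex.exp_add, inner_sub_left]
    congr 1
    push_cast
    ring
  -- Absolute integrability in (η, t) justifies Fubini; the integral over η then inverts the Fourier
  -- transform of b at t.
  have hint : Integrable (Function.uncurry fun (η t : Rd d) => (fourierInt b η * a.1 t) *
      Complex.exp (-((inner ℝ (z.2 - η) t : ℝ) * Complex.I)))
      ((volume : Measure (Rd d)).prod volume) := by
    refine (hbi.mul_prod hai).mul_bdd (c := 1) (Continuous.aestronglyMeasurable ?_)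
      (Eventually.of_forall fun w => ?_)
    · fun_prop
    · rw [← neg_mul, ← Complex.ofReal_neg, Complex.norm_exp_ofReal_mul_I]
  calc prodCoeff φ (toDual f₁) (toDual f₂) z
      = ∫ η, ∫ t, (fourierInt b η * a.1 t) *
          Complex.exp (-((inner ℝ (z.2 - η) t : ℝ) * Complex.I)) := by
        refine integral_congr_ae (Eventually.of_forall fun η => ?_)
        simp only [toDual_atom]
        rw [mul_comm, ← ha, ← hb, fourierInt.eq_def a, ← integral_const_mul]
        simp_rw [mul_assoc]
    _ = ∫ t, ∫ η, (fourierInt b η * a.1 t) *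
          Complex.exp (-((inner ℝ (z.2 - η) t : ℝ) * Complex.I)) := integral_integral_swap hint
    _ = ∫ t, (((2 * Real.pi) ^ d : ℝ) : ℂ) * (a.1 t * b.1 t *
          Complex.exp (-((inner ℝ z.2 t : ℝ) * Complex.I))) := by
        refine integral_congr_ae (Eventually.of_forall fun t => ?_)
        have h2 := integral_fourierInt_mul_exp b t
        simp only [h1]
        calc _ = ∫ η, (a.1 t * Complex.exp (-((inner ℝ z.2 t : ℝ) * Complex.I))) *
              (fourierInt b η * Complex.exp ((inner ℝ η t : ℝ) * Complex.I)) := by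
              congr 1
              ext η
              ring
          _ = _ := by
              rw [integral_const_mul, h2]
              ring
    _ = _ := by
        rw [integral_const_mul, toDual_atom, fourierInt]
        congr 2
        ext t
        simp only [ha, hb, GSSpace.mul, shift, conj, map_mul]
        ring

theorem mul_self_ne_zero {φ : GSSpace d} (hφ : φ ≠ 0) : mul φ φ ≠ 0 := by
  refine fun h => hφ ?_
  ext t
  have h1 : (mul φ φ).1 t = 0 := by rw [h]; rfl
  exact mul_self_eq_zero.1 h1

/-- Consistency with the pointwise product: the convolution is the transform of f₁f₂ for the window
φ², and the reproducing formula for this window inverts it. -/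
theorem mulForm_toDual {φ : GSSpace d} (hφ : φ ≠ 0) (f₁ f₂ g : GSSpace d) :
    mulForm φ (toDual f₁) (toDual f₂) g = (toDual (mul f₁ f₂)).1 g := by
  have h1 := (reproducing (mul φ φ) g (toDual (mul f₁ f₂))).2
  have h2 : (((2 * Real.pi) ^ d : ℝ) : ℂ) ≠ 0 := by
    rw [Complex.ofReal_ne_zero]
    positivity
  simp only [mulForm, prodCoeff_toDual, mul_left_comm (kern (mul φ φ) g _)]
  rw [integral_const_mul, h1]
  field_simp [frameConst_ne_zero (mul_self_ne_zero hφ)]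

end GSSpace

/-! ### Quasi-norm estimates for the product -/

namespace GSSpace

variable {d : ℕ}

/-- The product is controlled by the partial convolution of the averages. -/
theorem exists_ampl_mulForm_le (φ ψ : GSSpace d) {r l : ℝ} (hr : 0 < r) (hl : 0 < l) {C : ℝ≥0}
    (hC : ∀ u z, ampl φ u z ≤ C * expAvg r l (ampl φ u) z) :
    ∃ D : ℝ≥0, ∀ u v w : GSDual d, (∀ g, w.1 g = mulForm φ u v g) → ∀ z, ampl ψ w z ≤
      D * partialConv (expAvg r l (ampl φ u)) (expAvg r l (ampl φ v)) z := by
  obtain ⟨B, hB⟩ := exists_enorm_kern_atom_le (mul φ φ) ψ (by linarith : 0 < (l + l) + 1)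
  set c := (frameConst (mul φ φ))⁻¹ * (((2 * Real.pi) ^ d : ℝ) : ℂ)⁻¹ with hc
  have hfin := lintegral_wexp_neg_lt_top (V := Rd d × Rd d) one_pos
  refine ⟨‖c‖₊ * (B * (C * C) * (∫⁻ w : Rd d × Rd d, wexp (-1) w).toNNReal),
    fun u v w hw z => ?_⟩
  set G := partialConv (expAvg r l (ampl φ u)) (expAvg r l (ampl φ v)) with hG
  have hGs : IsSlow (1 * 1) (l + l) G :=
    isSlow_partialConv hl.le (isSlow_expAvg hr hl.le _) (isSlow_expAvg hr hl.le _)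
  have hle : ∀ w', ‖prodCoeff φ u v w'‖ₑ ≤ C * C * G w' := fun w' => by
    refine (enorm_prodCoeff_le φ u v w').trans ?_
    refine (partialConv_mono (hC u) (hC v) w').trans (le_of_eq ?_)
    rw [hG, partialConv, partialConv,
      ← lintegral_const_mul' _ _ (ENNReal.mul_ne_top ENNReal.coe_ne_top ENNReal.coe_ne_top)]
    congr 1
    ext η
    ring
  change ‖w.1 (atom ψ z.1 z.2)‖ₑ ≤ _
  rw [hw, mulForm, enorm_mul, ENNReal.coe_mul, mul_assoc]
  refine mul_le_mul_right ?_ _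
  calc ‖∫ w', kern (mul φ φ) (atom ψ z.1 z.2) w' * prodCoeff φ u v w'‖ₑ
      ≤ ∫⁻ w', (B * (C * C)) * (G w' * wexp (-((l + l) + 1)) (z - w')) := by
        refine (enorm_integral_le_lintegral_enorm _).trans (lintegral_mono fun w' => ?_)
        rw [enorm_mul]
        calc _ ≤ (B * wexp (-((l + l) + 1)) (z - w')) * (C * C * G w') :=
              mul_le_mul' (hB z w') (hle w')
          _ = _ := by ring
    _ = (B * (C * C)) * ∫⁻ w', G w' * wexp (-((l + l) + 1)) (z - w') :=
        lintegral_const_mul' _ _ (by exact_mod_cast ENNReal.coe_ne_top)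
    _ ≤ (B * (C * C)) * ((1 * 1 : ℝ≥0) * (∫⁻ w : Rd d × Rd d, wexp (-1) w) * G z) := by
        gcongr
        exact hGs.lintegral_mul_wexp_le z
    _ = _ := by
        simp only [ENNReal.coe_mul, ENNReal.coe_toNNReal hfin.ne, ENNReal.coe_one]
        ring

/-- The weight condition distributes W₀ over the two factors of the convolution. Averages times
weights are slowly varying, so the convolution estimate applies, and afterwards the averages are
removed. -/
theorem exists_mlpn_partialConv_expAvg_le {p₀ p₁ p₂ q₀ q₁ q₂ : ℝ} (hp₀ : 0 < p₀) (hp₁ : 0 < p₁)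
    (hp₂ : 0 < p₂) (hq₀ : 0 < q₀) (hq₁ : 0 < q₁) (hq₂ : 0 < q₂) (hp : 1 / p₀ ≤ 1 / p₁ + 1 / p₂)
    (hq : 1 / q₀ ≤ 1 / q₁ + 1 / q₂ - max 1 (max (1 / p₀) (max (1 / q₁) (1 / q₂))))
    {W₀ W₁ W₂ : Rd d × Rd d → ℝ≥0∞} {K : ℝ≥0} {R₁ R₂ : ℝ} (hR₁ : 0 ≤ R₁)
    (hR₂ : 0 ≤ R₂) (hW₁ : Measurable W₁) (hW₂ : Measurable W₂)
    (hs₁ : IsSlow 1 R₁ W₁) (hs₂ : IsSlow 1 R₂ W₂)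
    (hW : ∀ x ξ₁ ξ₂, W₀ (x, ξ₁ + ξ₂) ≤ K * (W₁ (x, ξ₁) * W₂ (x, ξ₂))) {r l : ℝ} (hr : 0 < r)
    (hrp₁ : r ≤ p₁) (hrq₁ : r ≤ q₁) (hrp₂ : r ≤ p₂) (hrq₂ : r ≤ q₂) (hl₁ : R₁ < l)
    (hl₂ : R₂ < l) :
    ∃ C : ℝ≥0, ∀ F₁ F₂ : Rd d × Rd d → ℝ≥0∞, Measurable F₁ → Measurable F₂ →
      (mlpn p₀ q₀ fun z => partialConv (expAvg r l F₁) (expAvg r l F₂) z * W₀ z) ≤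
        C * ((mlpn p₁ q₁ fun z => F₁ z * W₁ z) * mlpn p₂ q₂ fun z => F₂ z * W₂ z) := by
  have hl : 0 ≤ l := by linarith
  obtain ⟨C₁, hC₁⟩ := exists_mlpn_expAvg_mul_le (E := Rd d) 1 hl₁ hr hrp₁ hrq₁
  obtain ⟨C₂, hC₂⟩ := exists_mlpn_expAvg_mul_le (E := Rd d) 1 hl₂ hr hrp₂ hrq₂
  obtain ⟨C₀, hC₀⟩ := exists_mlpn_partialConv_le (E := Rd d) (1 * 1) (1 * 1)
    (by linarith : 0 ≤ l + R₁) (by linarith : 0 ≤ l + R₂) hp₀ hp₁ hp₂ hq₀ hq₁ hq₂ hp hq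
  refine ⟨K * C₀ * C₁ * C₂, fun F₁ F₂ hF₁ hF₂ => ?_⟩
  have m₁ := measurable_expAvg (r := r) (l := l) hF₁
  have m₂ := measurable_expAvg (r := r) (l := l) hF₂
  have hpt : ∀ z, partialConv (expAvg r l F₁) (expAvg r l F₂) z * W₀ z ≤
      K * partialConv (fun z => expAvg r l F₁ z * W₁ z) (fun z => expAvg r l F₂ z * W₂ z) z := by
    intro z
    have h1 : Measurable fun η => expAvg r l F₁ (z.1, z.2 - η) := m₁.comp (by fun_prop)
    have h2 : Measurable fun η => expAvg r l F₂ (z.1, η) := m₂.comp (by fun_prop)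
    have h3 : Measurable fun η => expAvg r l F₁ (z.1, z.2 - η) * expAvg r l F₂ (z.1, η) :=
      h1.mul h2
    simp only [partialConv]
    rw [← lintegral_mul_const _ h3, ← lintegral_const_mul' _ _ ENNReal.coe_ne_top]
    refine lintegral_mono fun η => ?_
    have := hW z.1 (z.2 - η) η
    rw [sub_add_cancel] at this
    calc _ ≤ expAvg r l F₁ (z.1, z.2 - η) * expAvg r l F₂ (z.1, η) *
          (K * (W₁ (z.1, z.2 - η) * W₂ (z.1, η))) := by gcongr
      _ = _ := by ring
  calc _ ≤ K * mlpn p₀ q₀ (partialConv (fun z => expAvg r l F₁ z * W₁ z)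
            (fun z => expAvg r l F₂ z * W₂ z)) := by
        rw [← mlpn_const_mul hp₀ hq₀ ENNReal.coe_ne_top]
        exact mlpn_mono hp₀ hq₀ hpt
    _ ≤ K * (C₀ * ((mlpn p₁ q₁ fun z => expAvg r l F₁ z * W₁ z) *
          mlpn p₂ q₂ fun z => expAvg r l F₂ z * W₂ z)) := by
        gcongr
        exact hC₀ _ _ (m₁.mul hW₁) (m₂.mul hW₂) ((isSlow_expAvg hr hl _).mul hs₁)
          ((isSlow_expAvg hr hl _).mul hs₂)
    _ ≤ K * (C₀ * ((C₁ * mlpn p₁ q₁ fun z => F₁ z * W₁ z) *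
          (C₂ * mlpn p₂ q₂ fun z => F₂ z * W₂ z))) := by
        gcongr
        · exact hC₁ _ _ hF₁ hW₁ hs₁
        · exact hC₂ _ _ hF₂ hW₂ hs₂
    _ = _ := by
        push_cast
        ring

/-- The estimate for the averages is used twice: its finiteness at one point makes the product well
defined, and its size bounds the product. -/
theorem exists_hasProduct_bound {φ : GSSpace d} (hφ : φ ≠ 0) (ψ : GSSpace d)
    {p₀ p₁ p₂ q₀ q₁ q₂ : ℝ} (hp₀ : 0 < p₀) (hp₁ : 0 < p₁) (hp₂ : 0 < p₂) (hq₀ : 0 < q₀)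
    (hq₁ : 0 < q₁) (hq₂ : 0 < q₂) (hp : 1 / p₀ ≤ 1 / p₁ + 1 / p₂)
    (hq : 1 / q₀ ≤ 1 / q₁ + 1 / q₂ - max 1 (max (1 / p₀) (max (1 / q₁) (1 / q₂))))
    {W₀ W₁ W₂ : Rd d × Rd d → ℝ≥0∞} {K : ℝ≥0} {R₀ R₁ R₂ : ℝ} (hR₀ : 0 ≤ R₀) (hR₁ : 0 ≤ R₁)
    (hR₂ : 0 ≤ R₂) (hW₁ : Measurable W₁) (hW₂ : Measurable W₂)
    (hs₀ : IsSlow 1 R₀ W₀) (hs₁ : IsSlow 1 R₁ W₁) (hs₂ : IsSlow 1 R₂ W₂) (h0 : W₀ 0 ≠ 0)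
    (hW : ∀ x ξ₁ ξ₂, W₀ (x, ξ₁ + ξ₂) ≤ K * (W₁ (x, ξ₁) * W₂ (x, ξ₂))) :
    ∃ C : ℝ≥0, ∀ u v : GSDual d, (mlpn p₁ q₁ fun z => ampl φ u z * W₁ z) < ∞ →
      (mlpn p₂ q₂ fun z => ampl φ v z * W₂ z) < ∞ → HasProduct φ u v ∧
      ∀ w : GSDual d, (∀ g, w.1 g = mulForm φ u v g) →
        (mlpn p₀ q₀ fun z => ampl ψ w z * W₀ z) ≤
          C * ((mlpn p₁ q₁ fun z => ampl φ u z * W₁ z) *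
            mlpn p₂ q₂ fun z => ampl φ v z * W₂ z) := by
  obtain ⟨r, hr, hr1, hrp₁, hrq₁, hrp₂, hrq₂⟩ :
      ∃ r : ℝ, 0 < r ∧ r ≤ 1 ∧ r ≤ p₁ ∧ r ≤ q₁ ∧ r ≤ p₂ ∧ r ≤ q₂ :=
    ⟨min 1 (min (min p₁ q₁) (min p₂ q₂)), by positivity, by simp, by simp, by simp, by simp, by simp⟩
  obtain ⟨l, hl₁, hl₂⟩ := exists_gt (max R₁ R₂) |>.imp fun _ h => max_lt_iff.1 h
  have hl : 0 < l := by linarith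
  obtain ⟨B, hB⟩ := exists_ampl_le_expAvg_self hφ hr hr1 hl
  obtain ⟨D, hD⟩ := exists_ampl_mulForm_le φ ψ hr hl hB
  obtain ⟨C, key⟩ := exists_mlpn_partialConv_expAvg_le hp₀ hp₁ hp₂ hq₀ hq₁ hq₂ hp hq hR₁ hR₂
    hW₁ hW₂ hs₁ hs₂ hW hr hrp₁ hrq₁ hrp₂ hrq₂ hl₁ hl₂
  obtain ⟨C₃, hC₃⟩ := IsSlow.exists_le_mlpn (E := Rd d) (1 * 1 * 1)
    (by linarith : 0 ≤ l + l + R₀) hp₀ hq₀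
  refine ⟨D * C, fun u v hu hv => ⟨?_, fun w hw => ?_⟩⟩
  · set G := partialConv (expAvg r l (ampl φ u)) (expAvg r l (ampl φ v)) with hG
    have hGs : IsSlow (1 * 1) (l + l) G :=
      isSlow_partialConv hl.le (isSlow_expAvg hr hl.le _) (isSlow_expAvg hr hl.le _)
    -- A finite quasi-norm makes the slowly varying function G W₀ finite at the origin, and slow
    -- variation of G turns this into an exponential bound everywhere.
    have h1 : G 0 * W₀ 0 < ∞ := (hC₃ _ (hGs.mul hs₀) 0).trans_lt
      (ENNReal.mul_lt_top ENNReal.coe_lt_top ((key _ _ (measurable_ampl φ u) (measurable_ampl φ v)).trans_lt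
        (ENNReal.mul_lt_top ENNReal.coe_lt_top (ENNReal.mul_lt_top hu hv))))
    have h2 : G 0 ≠ ∞ := fun h => by
      rw [h, ENNReal.top_mul h0] at h1
      exact lt_irrefl _ h1
    refine ⟨l + l, B * B * (G 0).toNNReal, fun z => ?_⟩
    calc partialConv (ampl φ u) (ampl φ v) z ≤ B * B * G z := by
          refine (partialConv_mono (hB u) (hB v) z).trans (le_of_eq ?_)
          rw [hG, partialConv, partialConv,
            ← lintegral_const_mul' _ _ (ENNReal.mul_ne_top ENNReal.coe_ne_top ENNReal.coe_ne_top)]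
          congr 1
          ext η
          ring
      _ ≤ B * B * ((1 * 1 : ℝ≥0) * wexp (l + l) z * G 0) := by
          gcongr
          simpa using hGs 0 z
      _ = _ := by
          simp only [ENNReal.coe_mul, ENNReal.coe_toNNReal h2, ENNReal.coe_one]
          ring
  · calc (mlpn p₀ q₀ fun z => ampl ψ w z * W₀ z)
        ≤ mlpn p₀ q₀ fun z => D *
          (partialConv (expAvg r l (ampl φ u)) (expAvg r l (ampl φ v)) z * W₀ z) := by
          refine mlpn_mono hp₀ hq₀ fun z => ?_
          rw [← mul_assoc]
          gcongr
          exact hD u v w hw z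
      _ ≤ _ := by
          rw [mlpn_const_mul hp₀ hq₀ ENNReal.coe_ne_top, ENNReal.coe_mul, mul_assoc]
          gcongr
          exact key _ _ (measurable_ampl φ u) (measurable_ampl φ v)

end GSSpace

/-! ### Density of `Σ₁` -/

theorem tendsto_lpn_zero {α : Type*} [MeasureSpace α] {s : ℝ} (hs : 0 < s) {f : ℕ → α → ℝ≥0∞}
    {g : α → ℝ≥0∞} (hf : ∀ n, Measurable (f n)) (hle : ∀ n x, f n x ≤ g x) (hg : lpn s g < ∞)
    (hlim : ∀ᵐ x, Tendsto (fun n => f n x) atTop (𝓝 0)) :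
    Tendsto (fun n => lpn s (f n)) atTop (𝓝 0) := by
  have hg' : ∫⁻ x, g x ^ s ≠ ∞ := fun h => by
    rw [lpn, h, ENNReal.top_rpow_of_pos (by positivity)] at hg
    exact lt_irrefl _ hg
  have h1 : Tendsto (fun n => ∫⁻ x, f n x ^ s) atTop (𝓝 (∫⁻ _ : α, 0)) := by
    refine tendsto_lintegral_of_dominated_convergence (fun x => g x ^ s)
      (fun n => (hf n).pow_const _) (fun n => Eventually.of_forall fun x => ?_) hg' ?_
    · exact ENNReal.rpow_le_rpow (hle n x) hs.le
    · filter_upwards [hlim] with x hx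
      have := (ENNReal.continuous_rpow_const (y := s)).tendsto 0 |>.comp hx
      rwa [ENNReal.zero_rpow_of_pos hs] at this
  rw [lintegral_zero] at h1
  have := (ENNReal.continuous_rpow_const (y := 1 / s)).tendsto 0 |>.comp h1
  rwa [ENNReal.zero_rpow_of_pos (by positivity)] at this

/-- Dominated convergence in x and then in ξ; the inner majorant is finite only for almost every ξ,
which suffices. -/
theorem tendsto_mlpn_zero {E F : Type*} [MeasureSpace E] [SFinite (volume : Measure E)]
    [MeasureSpace F] {p q : ℝ} (hp : 0 < p) (hq : 0 < q)
    {H : ℕ → E × F → ℝ≥0∞} {G : E × F → ℝ≥0∞} (hH : ∀ n, Measurable (H n)) (hG : Measurable G)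
    (hle : ∀ n z, H n z ≤ G z) (hfin : mlpn p q G < ∞)
    (hlim : ∀ z, Tendsto (fun n => H n z) atTop (𝓝 0)) :
    Tendsto (fun n => mlpn p q (H n)) atTop (𝓝 0) := by
  refine tendsto_lpn_zero hq (fun n => measurable_lpn_fst (hH n))
    (fun n ξ => lpn_mono hp fun x => hle n (x, ξ)) hfin ?_
  have h1 : ∫⁻ ξ, lpn p (fun x => G (x, ξ)) ^ q ≠ ∞ := fun h => by
    rw [mlpn, lpn, h, ENNReal.top_rpow_of_pos (by positivity)] at hfin
    exact lt_irrefl _ hfin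
  filter_upwards [ae_lt_top ((measurable_lpn_fst hG).pow_const q) h1] with ξ hξ
  refine tendsto_lpn_zero hp (fun n => (hH n).comp measurable_prodMk_right)
    (fun n x => hle n (x, ξ)) ?_ (Eventually.of_forall fun x => hlim (x, ξ))
  exact (ENNReal.rpow_lt_top_iff_of_pos hq).1 hξ

namespace GSSpace

variable {d : ℕ}

theorem exists_expAvg_mul_le_mlpn (φ : GSSpace d) {p q R r l : ℝ} (hp : 0 < p) (hq : 0 < q)
    (hR : 0 ≤ R) (hr : 0 < r) (hrp : r ≤ p) (hrq : r ≤ q) (hl : R < l)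
    {W : Rd d × Rd d → ℝ≥0∞} (hW : Measurable W) (hWs : IsSlow 1 R W) :
    ∃ C : ℝ≥0, ∀ u z, expAvg r l (ampl φ u) z * W z ≤
      C * mlpn p q fun z => ampl φ u z * W z := by
  obtain ⟨C, hC⟩ := exists_mlpn_expAvg_mul_le (E := Rd d) 1 hl hr hrp hrq
  obtain ⟨D, hD⟩ := IsSlow.exists_le_mlpn (E := Rd d) (1 * 1) (by linarith : 0 ≤ l + R) hp hq
  refine ⟨D * C, fun u z => (hD _ ((isSlow_expAvg hr (by linarith) _).mul hWs) z).trans ?_⟩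
  rw [ENNReal.coe_mul, mul_assoc]
  gcongr
  exact hC _ _ (measurable_ampl φ u) hW hWs

theorem eq_zero_of_ampl_eq_zero {φ : GSSpace d} (hφ : φ ≠ 0) {u : GSDual d}
    (h : ∀ z, ampl φ u z = 0) : u = 0 := by
  ext g
  have h1 := (reproducing φ g u).2
  have h2 : ∀ w : Rd d × Rd d, u.1 (atom φ w.1 w.2) = 0 := fun w => enorm_eq_zero.1 (h w)
  simp only [h2, mul_zero, integral_zero] at h1
  exact (mul_eq_zero.1 h1.symm).resolve_left (frameConst_ne_zero hφ)

/-- A vanishing quasi-norm forces the averages, hence the transform, to vanish at every point; the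
reproducing formula then gives u = 0. -/
theorem eq_zero_of_mlpn_eq_zero {φ : GSSpace d} (hφ : φ ≠ 0) {p q R : ℝ} (hp : 0 < p) (hq : 0 < q)
    (hR : 0 ≤ R) {W : Rd d × Rd d → ℝ≥0∞} (hW : Measurable W) (hWs : IsSlow 1 R W)
    (h0 : ∀ z, W z ≠ 0) {u : GSDual d} (hu : (mlpn p q fun z => ampl φ u z * W z) = 0) :
    u = 0 := by
  have hr : 0 < min 1 (min p q) := by positivity
  obtain ⟨C, hC⟩ := exists_ampl_le_expAvg_self hφ hr (min_le_left _ _) (by linarith : 0 < R + 1)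
  obtain ⟨D, hD⟩ := exists_expAvg_mul_le_mlpn φ hp hq hR hr
    ((min_le_right _ _).trans (min_le_left _ _)) ((min_le_right _ _).trans (min_le_right _ _))
    (by linarith : R < R + 1) hW hWs
  refine eq_zero_of_ampl_eq_zero hφ fun z => ?_
  have h1 := hD u z
  rw [hu, mul_zero, nonpos_iff_eq_zero, mul_eq_zero] at h1
  have h2 := hC u z
  rwa [h1.resolve_right (h0 z), mul_zero, nonpos_iff_eq_zero] at h2

/-- The tail outside of the ball of radius `n` of the convolution of `F` with an exponential. -/
noncomputable def tail (l : ℝ) (F : Rd d × Rd d → ℝ≥0∞) (n : ℕ) (z : Rd d × Rd d) : ℝ≥0∞ :=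
  ∫⁻ w, (Metric.closedBall 0 (n : ℝ))ᶜ.indicator (fun w => F w * wexp (-l) (z - w)) w

theorem measurable_tail {l : ℝ} {F : Rd d × Rd d → ℝ≥0∞} (hF : Measurable F) (n : ℕ) :
    Measurable (tail l F n) := by
  have h1 : Measurable fun w : (Rd d × Rd d) × (Rd d × Rd d) =>
      F w.2 * wexp (-l) (w.1 - w.2) :=
    (hF.comp measurable_snd).mul ((measurable_wexp _).comp (measurable_fst.sub measurable_snd))
  have h2 := (h1.indicator (measurable_snd
    (Metric.isClosed_closedBall (x := (0 : Rd d × Rd d)) (ε := n)).measurableSet.compl))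
  exact Measurable.lintegral_prod_right' h2

theorem tail_le (l : ℝ) (F : Rd d × Rd d → ℝ≥0∞) (n : ℕ) (z : Rd d × Rd d) :
    tail l F n z ≤ ∫⁻ w, F w * wexp (-l) (z - w) :=
  lintegral_mono fun _ => Set.indicator_le_self _ _ _

theorem tendsto_tail {l : ℝ} {F : Rd d × Rd d → ℝ≥0∞} (hF : Measurable F) {z : Rd d × Rd d}
    (hfin : ∫⁻ w, F w * wexp (-l) (z - w) ≠ ∞) :
    Tendsto (fun n => tail l F n z) atTop (𝓝 0) := by
  have hm : Measurable fun w => F w * wexp (-l) (z - w) :=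
    hF.mul ((measurable_wexp _).comp (measurable_const.sub measurable_id))
  rw [← lintegral_zero (α := Rd d × Rd d) (μ := volume)]
  refine tendsto_lintegral_of_dominated_convergence _
    (fun n => hm.indicator Metric.isClosed_closedBall.measurableSet.compl)
    (fun n => Eventually.of_forall fun w => Set.indicator_le_self _ _ _) hfin
    (Eventually.of_forall fun w => ?_)
  obtain ⟨N, hN⟩ := exists_nat_ge ‖w‖
  refine tendsto_const_nhds.congr' ?_
  filter_upwards [eventually_ge_atTop N] with n hn
  rw [Set.indicator_of_notMem]
  simp only [Set.mem_compl_iff, not_not, mem_closedBall_zero_iff]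
  exact hN.trans (by exact_mod_cast hn)

/-- The reproducing integral restricted to a ball of phase space is an element of Σ₁, and the error
is the integral over the complement. -/
theorem exists_approx {φ : GSSpace d} (hφ : φ ≠ 0) {l : ℝ} (hl : 0 < l) :
    ∃ C : ℝ≥0, ∀ (u : GSDual d) (n : ℕ), ∃ g : GSSpace d, ∀ z,
      ampl φ (toDual g - u) z ≤ C * tail l (ampl φ u) n z := by
  obtain ⟨C, hC⟩ := exists_enorm_kern_atom_le φ φ hl
  set c := (frameConst φ)⁻¹ with hc
  refine ⟨‖c‖₊ * C, fun u n => ?_⟩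
  set B : Set (Rd d × Rd d) := Metric.closedBall 0 (n : ℝ) with hB
  have hBm : MeasurableSet B := Metric.isClosed_closedBall.measurableSet
  have hcF : ContinuousFamily fun w : Rd d × Rd d => atom (conj φ) w.1 (-w.2) :=
    (continuousFamily_atom (conj φ)).comp (φ := fun w : Rd d × Rd d => (w.1, -w.2)) (by fun_prop)
  have hcont := continuous_atom_apply φ u
  -- Conjugate window and reversed frequency appear because the pairing is bilinear; by its
  -- symmetry, testing g against an atom reproduces `kern`.
  obtain ⟨g, -, hg⟩ := exists_integral (μ := (volume : Measure (Rd d × Rd d)).restrict B) hcF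
    (c := fun w => c * u.1 (atom φ w.1 w.2))
    (hcont.const_mul c |>.aestronglyMeasurable) (fun h hh => by
      obtain ⟨m, A, -, hA⟩ := exists_gsNorm_atom_le hh (conj φ)
      obtain ⟨m', A', hA'⟩ := exists_enorm_atom_growth φ u
      have hle : ∀ w ∈ B, ‖c * u.1 (atom φ w.1 w.2)‖ₑ * gsNorm h (atom (conj φ) w.1 (-w.2)).1 ≤
          ‖c‖ₑ * (A' * ENNReal.ofReal (Real.exp (|m'| * n))) *
            (A * ENNReal.ofReal (Real.exp (|m| * n))) := by
        intro w hw
        rw [hB, mem_closedBall_zero_iff] at hw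
        have hb : ∀ a : ℝ, wexp a w ≤ ENNReal.ofReal (Real.exp (|a| * n)) := fun a => by
          refine ENNReal.ofReal_le_ofReal (Real.exp_le_exp.2 ?_)
          calc a * ‖w‖ ≤ |a| * ‖w‖ := by gcongr; exact le_abs_self a
            _ ≤ _ := by gcongr
        rw [enorm_mul]
        refine mul_le_mul' (mul_le_mul_right ((hA' w).trans (by gcongr; exact hb m')) _)
          ((hA (w.1, -w.2)).trans ?_)
        gcongr
        refine le_trans (le_of_eq ?_) (hb m)
        simp [wexp, Prod.norm_def]
      calc _ ≤ ∫⁻ _ in B, ‖c‖ₑ * (A' * ENNReal.ofReal (Real.exp (|m'| * n))) *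
            (A * ENNReal.ofReal (Real.exp (|m| * n))) := setLIntegral_mono' hBm hle
        _ < ∞ := by
          rw [setLIntegral_const]
          refine ENNReal.mul_lt_top (ENNReal.mul_lt_top (ENNReal.mul_lt_top enorm_lt_top
            (ENNReal.mul_lt_top ENNReal.coe_lt_top ENNReal.ofReal_lt_top))
            (ENNReal.mul_lt_top ENNReal.coe_lt_top ENNReal.ofReal_lt_top))
            measure_closedBall_lt_top)
  refine ⟨g, fun z => ?_⟩
  obtain ⟨hi, he⟩ := reproducing φ (atom φ z.1 z.2) u
  have h1 : (toDual g).1 (atom φ z.1 z.2) =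
      ∫ w in B, c * (kern φ (atom φ z.1 z.2) w * u.1 (atom φ w.1 w.2)) := by
    rw [toDual_comm, (hg _).2]
    refine integral_congr_ae (Eventually.of_forall fun w => ?_)
    simp only [kern]
    ring
  have h2 : (toDual g - u).1 (atom φ z.1 z.2) =
      -(c * ∫ w in Bᶜ, kern φ (atom φ z.1 z.2) w * u.1 (atom φ w.1 w.2)) := by
    have h3 := integral_add_compl hBm hi
    have h4 : u.1 (atom φ z.1 z.2) =
        c * ∫ w, kern φ (atom φ z.1 z.2) w * u.1 (atom φ w.1 w.2) := by
      rw [he, hc, inv_mul_cancel_left₀ (frameConst_ne_zero hφ)]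
    change (toDual g).1 (atom φ z.1 z.2) - u.1 (atom φ z.1 z.2) = _
    rw [h1, h4, ← h3, integral_const_mul]
    ring
  change ‖(toDual g - u).1 (atom φ z.1 z.2)‖ₑ ≤ _
  rw [h2, enorm_neg, enorm_mul, ENNReal.coe_mul, mul_assoc]
  refine mul_le_mul_right ((enorm_integral_le_lintegral_enorm _).trans ?_) _
  rw [tail, lintegral_indicator hBm.compl, ← lintegral_const_mul' _ _ ENNReal.coe_ne_top]
  refine lintegral_mono fun w => ?_
  rw [enorm_mul]
  calc _ ≤ C * wexp (-l) (z - w) * ‖u.1 (atom φ w.1 w.2)‖ₑ := by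
        gcongr
        exact hC z w
    _ = C * (ampl φ u w * wexp (-l) (z - w)) := by
        rw [ampl]
        ring

/-- Elements of modulation spaces are limits of elements of `Σ₁`. -/
theorem exists_mlpn_ampl_sub_lt {φ : GSSpace d} (hφ : φ ≠ 0) {p q R : ℝ} (hp : 0 < p) (hq : 0 < q)
    (hR : 0 ≤ R) {W : Rd d × Rd d → ℝ≥0∞} (hW : Measurable W) (hWs : IsSlow 1 R W)
    (h0 : ∀ z, W z ≠ 0) (hfin : ∀ z, W z ≠ ∞) {u : GSDual d}
    (hu : (mlpn p q fun z => ampl φ u z * W z) < ∞)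
    {ε : ℝ≥0∞} (hε : 0 < ε) :
    ∃ g : GSSpace d, (mlpn p q fun z => ampl φ (toDual g - u) z * W z) < ε := by
  have hr : 0 < min 1 (min p q) := by positivity
  have hrp : min 1 (min p q) ≤ p := (min_le_right _ _).trans (min_le_left _ _)
  have hrq : min 1 (min p q) ≤ q := (min_le_right _ _).trans (min_le_right _ _)
  obtain ⟨C, hC⟩ := exists_approx hφ (by linarith : 0 < R + 1 + 1)
  obtain ⟨D, hD⟩ := exists_lintegral_ampl_le_expAvg hφ hr (min_le_left _ _)
    (by linarith : 0 < R + 1)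
  obtain ⟨B, hB⟩ := exists_expAvg_mul_le_mlpn φ hp hq hR hr hrp hrq (by linarith : R < R + 1)
    hW hWs
  obtain ⟨A, hA⟩ := exists_mlpn_expAvg_mul_le (E := Rd d) 1 (by linarith : R < R + 1) hr hrp hrq
  have hF := measurable_ampl φ u
  have hint : ∀ z, ∫⁻ w, ampl φ u w * wexp (-(R + 1 + 1)) (z - w) ≠ ∞ := fun z => by
    refine ((hD u z).trans_lt (ENNReal.mul_lt_top ENNReal.coe_lt_top ?_)).ne
    have h1 := (hB u z).trans_lt (ENNReal.mul_lt_top ENNReal.coe_lt_top hu)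
    refine lt_top_iff_ne_top.2 fun h => ?_
    rw [h, ENNReal.top_mul (h0 z)] at h1
    exact lt_irrefl _ h1
  -- The tails decrease to zero pointwise and are dominated by an average with finite weighted
  -- quasi-norm.
  have hlim : Tendsto (fun n => mlpn p q fun z =>
      tail (R + 1 + 1) (ampl φ u) n z * W z) atTop (𝓝 0) := by
    refine tendsto_mlpn_zero hp hq
      (G := fun z => D * (expAvg (min 1 (min p q)) (R + 1) (ampl φ u) z * W z))
      (fun n => (measurable_tail hF n).mul hW)
      (((measurable_expAvg hF).mul hW).const_mul _) (fun n z => ?_) ?_ fun z => ?_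
    · rw [← mul_assoc]
      gcongr
      exact (tail_le _ _ n z).trans (hD u z)
    · rw [mlpn_const_mul hp hq ENNReal.coe_ne_top]
      exact ENNReal.mul_lt_top ENNReal.coe_lt_top ((hA _ _ hF hW hWs).trans_lt
        (ENNReal.mul_lt_top ENNReal.coe_lt_top hu))
    · have := ENNReal.Tendsto.mul_const (tendsto_tail hF (hint z)) (Or.inr (hfin z))
      rwa [zero_mul] at this
  have hlim' := ENNReal.Tendsto.const_mul (a := (C : ℝ≥0∞)) hlim (Or.inr ENNReal.coe_ne_top)
  rw [mul_zero] at hlim'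
  obtain ⟨n, hn⟩ := (hlim'.eventually_lt_const hε).exists
  obtain ⟨g, hg⟩ := hC u n
  refine ⟨g, lt_of_le_of_lt ?_ hn⟩
  rw [← mlpn_const_mul hp hq ENNReal.coe_ne_top]
  refine mlpn_mono hp hq fun z => ?_
  rw [← mul_assoc]
  gcongr
  exact hg z

end GSSpace

/-! ### The topology of modulation spaces -/

section topology

open GSSpace

variable {d : ℕ} {p q : ℝ≥0∞} {ω : Rd d × Rd d → ℝ}

theorem modNorm_neg (hp : 0 < p ∧ p < ∞) (hq : 0 < q ∧ q < ∞) (hω : IsModerateWeight ω)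
    (φ : GSSpace d) (u : GSDual d) : modNorm p q ω φ (-u) = modNorm p q ω φ u := by
  rw [modNorm_eq hp hq hω.1.1, modNorm_eq hp hq hω.1.1]
  congr! 4 with z
  exact enorm_neg (u.1 (atom φ z.1 z.2))

theorem modNorm_sub_comm (hp : 0 < p ∧ p < ∞) (hq : 0 < q ∧ q < ∞) (hω : IsModerateWeight ω)
    (φ : GSSpace d) (u v : GSDual d) : modNorm p q ω φ (u - v) = modNorm p q ω φ (v - u) := by
  rw [← neg_sub, modNorm_neg hp hq hω]

theorem modNorm_zero (hp : 0 < p ∧ p < ∞) (hq : 0 < q ∧ q < ∞) (hω : IsModerateWeight ω)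
    (φ : GSSpace d) : modNorm p q ω φ 0 = 0 := by
  have hp' := ENNReal.toReal_pos hp.1.ne' hp.2.ne
  have hq' := ENNReal.toReal_pos hq.1.ne' hq.2.ne
  rw [modNorm_eq hp hq hω.1.1]
  simp [ampl, mlpn, lpn, hp', hq']

theorem exists_modNorm_add_le (hp : 0 < p ∧ p < ∞) (hq : 0 < q ∧ q < ∞)
    (hω : IsModerateWeight ω) : ∃ C : ℝ≥0, ∀ (φ : GSSpace d) (u v : GSDual d),
      modNorm p q ω φ (u + v) ≤ C * (modNorm p q ω φ u + modNorm p q ω φ v) := by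
  have hp' := ENNReal.toReal_pos hp.1.ne' hp.2.ne
  have hq' := ENNReal.toReal_pos hq.1.ne' hq.2.ne
  obtain ⟨K, R, W, -, hW, -, -, -, h1, h2⟩ := exists_modNorm_equiv hp hq hω
  obtain ⟨C, hC⟩ := mlpn_add_le (E := Rd d) (F := Rd d) hp' hq'
  refine ⟨K * C * K, fun φ u v => ?_⟩
  calc modNorm p q ω φ (u + v) ≤ K * mlpn p.toReal q.toReal fun z => ampl φ (u + v) z * W z :=
        h1 φ _
    _ ≤ K * mlpn p.toReal q.toReal fun z => ampl φ u z * W z + ampl φ v z * W z := by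
        gcongr
        refine mlpn_mono hp' hq' fun z => ?_
        rw [← add_mul]
        gcongr
        exact ampl_add_le φ u v z
    _ ≤ K * (C * (K * modNorm p q ω φ u + K * modNorm p q ω φ v)) := by
        gcongr
        refine (hC _ _ ((measurable_ampl φ u).mul hW)).trans ?_
        gcongr
        · exact h2 φ u
        · exact h2 φ v
    _ = _ := by
        push_cast
        ring

theorem exists_modNorm_sub_le (hp : 0 < p ∧ p < ∞) (hq : 0 < q ∧ q < ∞)
    (hω : IsModerateWeight ω) : ∃ C : ℝ≥0, 0 < C ∧ ∀ (φ : GSSpace d) (u v w : GSDual d),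
      modNorm p q ω φ (u - w) ≤ C * (modNorm p q ω φ (u - v) + modNorm p q ω φ (v - w)) := by
  obtain ⟨C, hC⟩ := exists_modNorm_add_le hp hq hω
  refine ⟨C + 1, by positivity, fun φ u v w => ?_⟩
  rw [← sub_add_sub_cancel u v w]
  refine (hC φ _ _).trans ?_
  gcongr
  exact le_self_add

/-- The quasi-norm balls form a basis of neighbourhoods. -/
theorem mem_nhds_iff_modNorm (hp : 0 < p ∧ p < ∞) (hq : 0 < q ∧ q < ∞)
    (hω : IsModerateWeight ω) {φ : GSSpace d} {f : ModulationSpace p q ω φ}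
    {U : Set (ModulationSpace p q ω φ)} :
    U ∈ 𝓝 f ↔ ∃ ε : ℝ≥0∞, 0 < ε ∧ ∀ g, modNorm p q ω φ (g.1 - f.1) < ε → g ∈ U := by
  have h0 : ∀ g : ModulationSpace p q ω φ, modNorm p q ω φ (g.1 - g.1) = 0 := fun g => by
    rw [sub_self, modNorm_zero hp hq hω]
  constructor
  · intro hU
    obtain ⟨V, hVU, hV, hf⟩ := mem_nhds_iff.1 hU
    obtain ⟨ε, hε, h⟩ := hV f hf
    exact ⟨ε, hε, fun g hg => hVU (h g hg)⟩
  · rintro ⟨ε, hε, hU⟩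
    obtain ⟨C, hC, hadd⟩ := exists_modNorm_sub_le hp hq hω
    -- Quasi-norm balls need not be open. The open set used is that of all points around which U
    -- contains a ball; by the quasi-triangle inequality the radius δ/(2C) shows that it is open.
    refine mem_nhds_iff.2 ⟨{f' | ∃ δ : ℝ≥0∞, 0 < δ ∧
      ∀ g : ModulationSpace p q ω φ, modNorm p q ω φ (g.1 - f'.1) < δ → g ∈ U}, ?_, ?_,
      ⟨ε, hε, hU⟩⟩
    · rintro f' ⟨δ, hδ, h⟩
      exact h f' (by rwa [h0])
    · rintro f' ⟨δ, hδ, h⟩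
      have hC' : (C : ℝ≥0∞) ≠ 0 := by exact_mod_cast hC.ne'
      have hδ' : 0 < δ / C / 2 := by
        refine ENNReal.div_pos (ENNReal.div_pos hδ.ne' ENNReal.coe_ne_top).ne' (by simp)
      refine ⟨δ / C / 2, hδ', fun f'' hf'' => ⟨δ / C / 2, hδ', fun g hg => h g ?_⟩⟩
      calc modNorm p q ω φ (g.1 - f'.1)
          ≤ C * (modNorm p q ω φ (g.1 - f''.1) + modNorm p q ω φ (f''.1 - f'.1)) := hadd φ _ _ _
        _ < C * (δ / C / 2 + δ / C / 2) :=
            ENNReal.mul_lt_mul_right hC' ENNReal.coe_ne_top (ENNReal.add_lt_add hg hf'')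
        _ = δ := by
            rw [ENNReal.add_halves, ENNReal.mul_div_cancel hC' ENNReal.coe_ne_top]

theorem tendsto_nhds_iff_modNorm (hp : 0 < p ∧ p < ∞) (hq : 0 < q ∧ q < ∞)
    (hω : IsModerateWeight ω) {φ : GSSpace d} {α : Type*} {L : Filter α}
    {F : α → ModulationSpace p q ω φ} {f : ModulationSpace p q ω φ} :
    Tendsto F L (𝓝 f) ↔ Tendsto (fun x => modNorm p q ω φ ((F x).1 - f.1)) L (𝓝 0) := by
  constructor
  · intro h
    refine tendsto_order.2 ⟨fun a ha => absurd ha not_lt_zero, fun ε hε => ?_⟩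
    exact h ((mem_nhds_iff_modNorm hp hq hω).2 ⟨ε, hε, fun g hg => hg⟩)
  · intro h U hU
    obtain ⟨ε, hε, hU⟩ := (mem_nhds_iff_modNorm hp hq hω).1 hU
    exact mem_map.2 ((h.eventually_lt_const hε).mono fun x hx => hU _ hx)

theorem eq_of_modNorm_sub_eq_zero (hp : 0 < p ∧ p < ∞) (hq : 0 < q ∧ q < ∞)
    (hω : IsModerateWeight ω) {φ : GSSpace d} (hφ : φ ≠ 0) {u v : GSDual d}
    (h : modNorm p q ω φ (u - v) = 0) : u = v := by
  obtain ⟨K, R, W, hR, hW, hWs, hωW, -, -, h2⟩ := exists_modNorm_equiv hp hq hω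
  have h3 := h2 φ (u - v)
  rw [h, mul_zero, nonpos_iff_eq_zero] at h3
  exact sub_eq_zero.1 (eq_zero_of_mlpn_eq_zero hφ (ENNReal.toReal_pos hp.1.ne' hp.2.ne)
    (ENNReal.toReal_pos hq.1.ne' hq.2.ne) hR hW hWs
    (fun z => ((ENNReal.ofReal_pos.2 (hω.1.1 z)).trans_le (hωW z)).ne') h3)

theorem t2Space_modulationSpace (hp : 0 < p ∧ p < ∞) (hq : 0 < q ∧ q < ∞)
    (hω : IsModerateWeight ω) {φ : GSSpace d} (hφ : φ ≠ 0) :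
    T2Space (ModulationSpace p q ω φ) := by
  refine t2_iff_nhds.2 fun {f g} hfg => ?_
  have h1 := (tendsto_nhds_iff_modNorm hp hq hω (F := id)).1
    (tendsto_id.mono_left (inf_le_left : 𝓝 f ⊓ 𝓝 g ≤ 𝓝 f))
  have h2 := (tendsto_nhds_iff_modNorm hp hq hω (F := id)).1
    (tendsto_id.mono_left (inf_le_right : 𝓝 f ⊓ 𝓝 g ≤ 𝓝 g))
  obtain ⟨C, -, hC⟩ := exists_modNorm_sub_le hp hq hω
  have h3 := ENNReal.Tendsto.const_mul (a := (C : ℝ≥0∞)) (h1.add h2) (Or.inr ENNReal.coe_ne_top)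
  rw [add_zero, mul_zero] at h3
  refine Subtype.ext (eq_of_modNorm_sub_eq_zero hp hq hω hφ ?_)
  refine nonpos_iff_eq_zero.1 (ge_of_tendsto' h3 fun x => ?_)
  refine (hC φ f.1 x.1 g.1).trans ?_
  rw [modNorm_sub_comm hp hq hω φ f.1]
  rfl

theorem modNorm_toDual_lt_top (hp : 0 < p ∧ p < ∞) (hq : 0 < q ∧ q < ∞)
    (hω : IsModerateWeight ω) (φ f : GSSpace d) : modNorm p q ω φ (toDual f) < ∞ := by
  obtain ⟨K, R, W, hR, hW, hWs, -, hWω, h1, -⟩ := exists_modNorm_equiv hp hq hω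
  refine (h1 φ _).trans_lt (ENNReal.mul_lt_top ENNReal.coe_lt_top ?_)
  exact mlpn_ampl_toDual_lt_top φ f (ENNReal.toReal_pos hp.1.ne' hp.2.ne)
    (ENNReal.toReal_pos hq.1.ne' hq.2.ne) hR hWs
    ((hWω 0).trans_lt (ENNReal.mul_lt_top ENNReal.coe_lt_top ENNReal.ofReal_lt_top)).ne

/-- The embedding of `Σ₁` into a modulation space. -/
noncomputable def toModulationSpace (hp : 0 < p ∧ p < ∞) (hq : 0 < q ∧ q < ∞)
    (hω : IsModerateWeight ω) (φ : GSSpace d) (f : GSSpace d) : ModulationSpace p q ω φ :=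
  ⟨toDual f, modNorm_toDual_lt_top hp hq hω φ f⟩

theorem denseRange_toModulationSpace (hp : 0 < p ∧ p < ∞) (hq : 0 < q ∧ q < ∞)
    (hω : IsModerateWeight ω) {φ : GSSpace d} (hφ : φ ≠ 0) :
    DenseRange (toModulationSpace hp hq hω φ) := by
  obtain ⟨K, R, W, hR, hW, hWs, hωW, hWω, h1, h2⟩ := exists_modNorm_equiv hp hq hω
  intro f
  refine mem_closure_iff_nhds.2 fun U hU => ?_
  obtain ⟨ε, hε, hU⟩ := (mem_nhds_iff_modNorm hp hq hω).1 hU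
  obtain ⟨g, hg⟩ := exists_mlpn_ampl_sub_lt hφ (ENNReal.toReal_pos hp.1.ne' hp.2.ne)
    (ENNReal.toReal_pos hq.1.ne' hq.2.ne) hR hW hWs
    (fun z => ((ENNReal.ofReal_pos.2 (hω.1.1 z)).trans_le (hωW z)).ne')
    (fun z => ((hWω z).trans_lt (ENNReal.mul_lt_top ENNReal.coe_lt_top ENNReal.ofReal_lt_top)).ne)
    ((h2 φ f.1).trans_lt (ENNReal.mul_lt_top ENNReal.coe_lt_top f.2))
    (ε := ε / (K + 1 : ℝ≥0)) (ENNReal.div_pos hε.ne' ENNReal.coe_ne_top)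
  refine ⟨toModulationSpace hp hq hω φ g, hU _ ?_, g, rfl⟩
  refine (h1 φ _).trans_lt ?_
  have hK : ((K + 1 : ℝ≥0) : ℝ≥0∞) ≠ 0 := by simp
  calc _ ≤ ((K + 1 : ℝ≥0) : ℝ≥0∞) *
        mlpn p.toReal q.toReal fun z => ampl φ (toDual g - f.1) z * W z := by
        exact mul_le_mul_left (ENNReal.coe_le_coe.2 le_self_add) _
    _ < (K + 1 : ℝ≥0) * (ε / (K + 1 : ℝ≥0)) :=
        ENNReal.mul_lt_mul_right hK ENNReal.coe_ne_top hg
    _ = ε := ENNReal.mul_div_cancel hK ENNReal.coe_ne_top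

end topology

/-! ### The multiplication theorem -/

section product

open GSSpace

variable {d : ℕ} {p q : Fin 3 → ℝ≥0∞} {ω : Fin 3 → Rd d × Rd d → ℝ}

/-- Both factors are transferred to the common window φ 0, and the weights are replaced by
measurable, slowly varying equivalents. -/
theorem exists_mul_bound (hp : ∀ j, 0 < p j ∧ p j < ∞) (hq : ∀ j, 0 < q j ∧ q j < ∞)
    (hω : ∀ j, IsModerateWeight (ω j))
    (hpexp : 1 / (p 0).toReal ≤ 1 / (p 1).toReal + 1 / (p 2).toReal)
    (hqexp : 1 / (q 0).toReal ≤ 1 / (q 1).toReal + 1 / (q 2).toReal -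
      max 1 (max (1 / (p 0).toReal) (max (1 / (q 1).toReal) (1 / (q 2).toReal))))
    (hωmul : ∀ x ξ₁ ξ₂ : Rd d, ω 0 (x, ξ₁ + ξ₂) ≤ ω 1 (x, ξ₁) * ω 2 (x, ξ₂))
    {φ : Fin 3 → GSSpace d} (hφ : ∀ j, φ j ≠ 0) :
    ∃ C : ℝ≥0, ∀ u v : GSDual d, modNorm (p 1) (q 1) (ω 1) (φ 1) u < ∞ →
      modNorm (p 2) (q 2) (ω 2) (φ 2) v < ∞ → HasProduct (φ 0) u v ∧
      ∀ w : GSDual d, (∀ g, w.1 g = mulForm (φ 0) u v g) →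
        modNorm (p 0) (q 0) (ω 0) (φ 0) w ≤
          C * (modNorm (p 1) (q 1) (ω 1) (φ 1) u * modNorm (p 2) (q 2) (ω 2) (φ 2) v) := by
  have hp' := fun j => ENNReal.toReal_pos (hp j).1.ne' (hp j).2.ne
  have hq' := fun j => ENNReal.toReal_pos (hq j).1.ne' (hq j).2.ne
  choose K R W hR hW hWs hωW hWω h1 h2 using
    fun j => exists_modNorm_equiv (hp j) (hq j) (hω j)
  obtain ⟨C₁, hC₁⟩ := exists_mlpn_ampl_le (hφ 1) (φ 0) (hp' 1) (hq' 1) (hR 1) (hW 1) (hWs 1)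
  obtain ⟨C₂, hC₂⟩ := exists_mlpn_ampl_le (hφ 2) (φ 0) (hp' 2) (hq' 2) (hR 2) (hW 2) (hWs 2)
  have hWmul : ∀ x ξ₁ ξ₂, W 0 (x, ξ₁ + ξ₂) ≤ K 0 * (W 1 (x, ξ₁) * W 2 (x, ξ₂)) :=
    fun x ξ₁ ξ₂ => by
      refine (hWω 0 _).trans (mul_le_mul_right ?_ _)
      refine (ENNReal.ofReal_le_ofReal (hωmul x ξ₁ ξ₂)).trans ?_
      rw [ENNReal.ofReal_mul ((hω 1).1.1 _).le]
      exact mul_le_mul' (hωW 1 _) (hωW 2 _)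
  obtain ⟨C, hC⟩ := exists_hasProduct_bound (hφ 0) (φ 0) (hp' 0) (hp' 1) (hp' 2) (hq' 0) (hq' 1)
    (hq' 2) hpexp hqexp (hR 0) (hR 1) (hR 2) (hW 1) (hW 2) (hWs 0) (hWs 1) (hWs 2)
    ((ENNReal.ofReal_pos.2 ((hω 0).1.1 0)).trans_le (hωW 0 0)).ne' hWmul
  have b₁ : ∀ u, (mlpn (p 1).toReal (q 1).toReal fun z => ampl (φ 0) u z * W 1 z) ≤
      (C₁ * K 1 : ℝ≥0) * modNorm (p 1) (q 1) (ω 1) (φ 1) u := fun u => by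
    refine (hC₁ u).trans ?_
    rw [ENNReal.coe_mul, mul_assoc]
    exact mul_le_mul_right (h2 1 _ _) _
  have b₂ : ∀ u, (mlpn (p 2).toReal (q 2).toReal fun z => ampl (φ 0) u z * W 2 z) ≤
      (C₂ * K 2 : ℝ≥0) * modNorm (p 2) (q 2) (ω 2) (φ 2) u := fun u => by
    refine (hC₂ u).trans ?_
    rw [ENNReal.coe_mul, mul_assoc]
    exact mul_le_mul_right (h2 2 _ _) _
  refine ⟨K 0 * C * (C₁ * K 1) * (C₂ * K 2), fun u v hu hv => ?_⟩
  obtain ⟨hprod, hbound⟩ := hC u v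
    ((b₁ u).trans_lt (ENNReal.mul_lt_top ENNReal.coe_lt_top hu))
    ((b₂ v).trans_lt (ENNReal.mul_lt_top ENNReal.coe_lt_top hv))
  refine ⟨hprod, fun w hw => ?_⟩
  calc modNorm (p 0) (q 0) (ω 0) (φ 0) w
      ≤ K 0 * (C * (((C₁ * K 1 : ℝ≥0) * modNorm (p 1) (q 1) (ω 1) (φ 1) u) *
          ((C₂ * K 2 : ℝ≥0) * modNorm (p 2) (q 2) (ω 2) (φ 2) v))) := by
        refine (h1 0 _ _).trans (mul_le_mul_right ((hbound w hw).trans ?_) _)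
        exact mul_le_mul_right (mul_le_mul' (b₁ u) (b₂ v)) _
    _ = _ := by
        push_cast
        ring

end product

theorem mainTheorem2 (d : ℕ) (p q : Fin 3 → ℝ≥0∞)
    (hp : ∀ j, 0 < p j ∧ p j < ∞) (hq : ∀ j, 0 < q j ∧ q j < ∞)
    (ω : Fin 3 → Rd d × Rd d → ℝ) (hω : ∀ j, IsModerateWeight (ω j))
    (hpexp : 1 / (p 0).toReal ≤ 1 / (p 1).toReal + 1 / (p 2).toReal)
    (hqexp : 1 / (q 0).toReal ≤ 1 / (q 1).toReal + 1 / (q 2).toReal -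
      max 1 (max (1 / (p 0).toReal) (max (1 / (q 1).toReal) (1 / (q 2).toReal))))
    (hωmul : ∀ x ξ₁ ξ₂ : Rd d, ω 0 (x, ξ₁ + ξ₂) ≤ ω 1 (x, ξ₁) * ω 2 (x, ξ₂))
    (φ : Fin 3 → GSSpace d) (hφ : ∀ j, φ j ≠ 0) :
    (∀ (j : Fin 3) (f : GSSpace d),
      modNorm (p j) (q j) (ω j) (φ j) (GSSpace.toDual f) < ∞) ∧
    ∃ T : ModulationSpace (p 1) (q 1) (ω 1) (φ 1) × ModulationSpace (p 2) (q 2) (ω 2) (φ 2) →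
        ModulationSpace (p 0) (q 0) (ω 0) (φ 0),
      IsContinuousMulExtension p q ω φ T ∧
      (∀ S, IsContinuousMulExtension p q ω φ S → S = T) ∧
      ∃ C : ℝ≥0, ∀ (f₁ : ModulationSpace (p 1) (q 1) (ω 1) (φ 1))
        (f₂ : ModulationSpace (p 2) (q 2) (ω 2) (φ 2)),
        modNorm (p 0) (q 0) (ω 0) (φ 0) (T (f₁, f₂)).1 ≤
          C * modNorm (p 1) (q 1) (ω 1) (φ 1) f₁.1 * modNorm (p 2) (q 2) (ω 2) (φ 2) f₂.1 := by
  refine ⟨fun j f => modNorm_toDual_lt_top (hp j) (hq j) (hω j) (φ j) f, ?_⟩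
  obtain ⟨C, hC⟩ := exists_mul_bound hp hq hω hpexp hqexp hωmul hφ
  -- The extension is given by `mulForm` on the whole product space, not by a limiting procedure;
  -- the estimate shows that its values lie in the target.
  have hex : ∀ x : ModulationSpace (p 1) (q 1) (ω 1) (φ 1) ×
      ModulationSpace (p 2) (q 2) (ω 2) (φ 2), ∃ w : ModulationSpace (p 0) (q 0) (ω 0) (φ 0),
      ∀ g, w.1.1 g = GSSpace.mulForm (φ 0) x.1.1 x.2.1 g := fun x => by
    obtain ⟨hprod, hbound⟩ := hC x.1.1 x.2.1 x.1.2 x.2.2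
    obtain ⟨w, hw⟩ := hprod.exists_dual
    exact ⟨⟨w, (hbound w hw).trans_lt (ENNReal.mul_lt_top ENNReal.coe_lt_top
      (ENNReal.mul_lt_top x.1.2 x.2.2))⟩, hw⟩
  choose T hT using hex
  have hext : ∀ (f₁ f₂ : GSSpace d) (g₁ : ModulationSpace (p 1) (q 1) (ω 1) (φ 1))
      (g₂ : ModulationSpace (p 2) (q 2) (ω 2) (φ 2)),
      g₁.1 = GSSpace.toDual f₁ → g₂.1 = GSSpace.toDual f₂ → (T (g₁, g₂)).1 = GSSpace.toDual (GSSpace.mul f₁ f₂) := by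
    intro f₁ f₂ g₁ g₂ h₁ h₂
    ext g
    rw [hT]
    simp only [h₁, h₂]
    exact GSSpace.mulForm_toDual (hφ 0) f₁ f₂ g
  obtain ⟨C₀, -, hC₀⟩ := exists_modNorm_sub_le (hp 0) (hq 0) (hω 0)
  obtain ⟨C₁, hC₁⟩ := exists_modNorm_add_le (hp 1) (hq 1) (hω 1)
  obtain ⟨C₂, hC₂⟩ := exists_modNorm_add_le (hp 2) (hq 2) (hω 2)
  have hcont : Continuous T := by
    refine continuous_iff_continuousAt.2 fun x => ?_
    refine (tendsto_nhds_iff_modNorm (hp 0) (hq 0) (hω 0)).2 ?_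
    set n₁ : ModulationSpace (p 1) (q 1) (ω 1) (φ 1) ×
      ModulationSpace (p 2) (q 2) (ω 2) (φ 2) → ℝ≥0∞ :=
      fun y => modNorm (p 1) (q 1) (ω 1) (φ 1) (y.1.1 - x.1.1) with hn₁
    set n₂ : ModulationSpace (p 1) (q 1) (ω 1) (φ 1) ×
      ModulationSpace (p 2) (q 2) (ω 2) (φ 2) → ℝ≥0∞ :=
      fun y => modNorm (p 2) (q 2) (ω 2) (φ 2) (y.2.1 - x.2.1) with hn₂
    set N₁ := modNorm (p 1) (q 1) (ω 1) (φ 1) x.1.1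
    set N₂ := modNorm (p 2) (q 2) (ω 2) (φ 2) x.2.1
    have hN₁ : N₁ ≠ ∞ := x.1.2.ne
    have hN₂ : N₂ ≠ ∞ := x.2.2.ne
    have t₁ : Tendsto n₁ (𝓝 x) (𝓝 0) := (tendsto_nhds_iff_modNorm (hp 1) (hq 1) (hω 1)).1
      (continuous_fst.tendsto x)
    have t₂ : Tendsto n₂ (𝓝 x) (𝓝 0) := (tendsto_nhds_iff_modNorm (hp 2) (hq 2) (hω 2)).1
      (continuous_snd.tendsto x)
    have lt₁ : ∀ y, n₁ y < ∞ := fun y => by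
      refine lt_of_le_of_lt ?_ (ENNReal.mul_lt_top (ENNReal.coe_lt_top (r := C₁))
        (ENNReal.add_lt_top.2 ⟨y.1.2, hN₁.lt_top⟩))
      have := hC₁ (φ 1) y.1.1 (-x.1.1)
      rwa [modNorm_neg (hp 1) (hq 1) (hω 1), ← sub_eq_add_neg] at this
    have lt₂ : ∀ y, n₂ y < ∞ := fun y => by
      refine lt_of_le_of_lt ?_ (ENNReal.mul_lt_top (ENNReal.coe_lt_top (r := C₂))
        (ENNReal.add_lt_top.2 ⟨y.2.2, hN₂.lt_top⟩))
      have := hC₂ (φ 2) y.2.1 (-x.2.1)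
      rwa [modNorm_neg (hp 2) (hq 2) (hω 2), ← sub_eq_add_neg] at this
    -- Passage through T(x₁, y₂): both differences are products with a small factor, and the
    -- quasi-norm of y₂ is bounded by those of y₂ - x₂ and x₂.
    have hle : ∀ y, modNorm (p 0) (q 0) (ω 0) (φ 0) ((T y).1 - (T x).1) ≤
        C₀ * (C * (n₁ y * (C₂ * (n₂ y + N₂))) + C * (N₁ * n₂ y)) := fun y => by
      have hmid := hT (x.1, y.2)
      refine (hC₀ (φ 0) _ (T (x.1, y.2)).1 _).trans (mul_le_mul_right (add_le_add ?_ ?_) _)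
      · refine ((hC (y.1.1 - x.1.1) y.2.1 (lt₁ y) y.2.2).2 _ fun g => ?_).trans ?_
        · rw [GSSpace.mulForm_sub_left (hC _ _ y.1.2 y.2.2).1 (hC _ _ x.1.2 y.2.2).1, ← hT y, ← hmid]
          rfl
        · refine mul_le_mul_right (mul_le_mul_right ?_ _) _
          have := hC₂ (φ 2) (y.2.1 - x.2.1) x.2.1
          rwa [sub_add_cancel] at this
      · refine (hC x.1.1 (y.2.1 - x.2.1) x.1.2 (lt₂ y)).2 _ fun g => ?_
        rw [GSSpace.mulForm_sub_right (hC _ _ x.1.2 y.2.2).1 (hC _ _ x.1.2 x.2.2).1, ← hT x, ← hmid]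
        rfl
    refine tendsto_of_tendsto_of_tendsto_of_le_of_le tendsto_const_nhds ?_
      (fun _ => zero_le) hle
    have s₁ := ENNReal.Tendsto.const_mul (a := (C₂ : ℝ≥0∞)) (t₂.add_const N₂)
      (Or.inr ENNReal.coe_ne_top)
    have s₂ := ENNReal.Tendsto.mul t₁ (Or.inr (ENNReal.mul_ne_top ENNReal.coe_ne_top
      (by rwa [zero_add]))) s₁ (Or.inr ENNReal.zero_ne_top)
    have s₃ := ENNReal.Tendsto.const_mul (a := N₁) t₂ (Or.inr hN₁)
    have s₄ := ENNReal.Tendsto.const_mul (a := (C₀ : ℝ≥0∞))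
      ((ENNReal.Tendsto.const_mul (a := (C : ℝ≥0∞)) s₂ (Or.inr ENNReal.coe_ne_top)).add
        (ENNReal.Tendsto.const_mul (a := (C : ℝ≥0∞)) s₃ (Or.inr ENNReal.coe_ne_top)))
      (Or.inr ENNReal.coe_ne_top)
    simpa only [zero_mul, mul_zero, add_zero] using s₄
  refine ⟨T, ⟨hcont, hext⟩, fun S hS => ?_, C, fun f₁ f₂ => ?_⟩
  -- Two continuous maps into a Hausdorff space which agree on the dense set of pairs from Σ₁
  -- coincide.
  · have := t2Space_modulationSpace (hp 0) (hq 0) (hω 0) (hφ 0)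
    refine ((denseRange_toModulationSpace (hp 1) (hq 1) (hω 1) (hφ 1)).prodMap
      (denseRange_toModulationSpace (hp 2) (hq 2) (hω 2) (hφ 2))).equalizer hS.1 hcont ?_
    ext1 ⟨f₁, f₂⟩
    refine Subtype.ext ?_
    exact (hS.2 f₁ f₂ _ _ rfl rfl).trans (hext f₁ f₂ _ _ rfl rfl).symm
  · rw [mul_assoc]
    exact (hC f₁.1 f₂.1 f₁.2 f₂.2).2 _ (hT (f₁, f₂))
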